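/- **Setting.** Let $\mathcal I$ be a finite index set with $|\mathcal I|\ge 2$. For each $i\in\mathcal I$ let $S_i=T_i\circ L_i+t_i:\mathbb R^2\to\mathbb R^2$, where $T_i=\operatorname{diag}(a_i,b_i)$ with $a_i,b_i\in(0,1)$, $L_i$ is a linear isometry of the plane with $L_i([-1,1]^2)=[-1,1]^2$, and $t_i\in\mathbb R^2$. Let $F$ be the attractor, i.e. the unique non-empty compact set with $F=\bigcup_{i\in\mathcal I}S_i(F)$; such an $F$ is called a *box-like self-affine set*. Write $\dim_{\rm P}$ for packing dimension (defined through packing measures), and, for a bounded set $A$, let $\underline{\dim}_{\rm B}A$ and $\overline{\dim}_{\rm B}A$ be the lower and upper limits of $\log N_\delta(A)/(-\log\delta)$ as $\delta\to0^+$, where $N_\delta(A)$ is the least number of sets of diameter at most $\delta$ that cover $A$; if they agree, the common value is $\dim_{\rm B}A$. Let $\pi_1(x,y)=x$ and $\pi_2(x,y)=y$. For a word $\mathbf i=(i_1,\dots,i_k)\in\mathcal I^k$, $k\ge1$, let $S_{\mathbf i}=S_{i_1}\circ\cdots\circ S_{i_k}$, let $\alpha_1(\mathbf i)\ge\alpha_2(\mathbf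 i)$ be the singular values of its linear part, and let $b(\mathbf i)$ and $h(\mathbf i)$ be the lengths of $\pi_1(S_{\mathbf i}([0,1]^2))$ and $\pi_2(S_{\mathbf i}([0,1]^2))$. Each $S_{\mathbf i}$ maps horizontal lines either to horizontal lines or to vertical lines. Put $\pi_{\mathbf i}=\pi_1$ if $S_{\mathbf i}$ maps horizontal lines to horizontal lines and $b(\mathbf i)\ge h(\mathbf i)$, or if $S_{\mathbf i}$ maps horizontal lines to vertical lines and $b(\mathbf i)<h(\mathbf i)$; put $\pi_{\mathbf i}=\pi_2$ otherwise. Let $s(\mathbf i)=\dim_{\rm B}\pi_{\mathbf i}(F)$ and, for $t\ge0$ and $k\ge1$, $$\psi^t(S_{\mathbf i})=\alpha_1(\mathbf i)^{s(\mathbf i)}\,\alpha_2(\mathbf i)^{t-s(\mathbf i)},\qquad \Psi^t_k=\sum_{\mathbf i\in\mathcal I^k}\psi^t(S_{\mathbf i}),\qquad P(t)=\lim_{k\to\infty}(\Psi_k^t)^{1/k}.$$ The system satisfies the *rectangular open set condition* (ROSC) if there is a non-empty open rectangle $R=(a,b)\times(c,d)\subset\mathbb R^2$ such that the sets $S_i(R)$,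 $i\in\mathcal I$, are pairwise disjoint subsets of $R$. **Theorem.** The box dimensions of $\pi_1(F)$ and $\pi_2(F)$ exist, the limit $P(t)$ exists and is finite for every $t\ge0$, and there is a unique $s\ge0$ with $P(s)=1$. For this $s$, $$\dim_{\rm P}F=\overline{\dim}_{\rm B}F\le s.$$ If, furthermore, the ROSC is satisfied, then the box dimension of $F$ exists and $\dim_{\rm P}F=\dim_{\rm B}F=s$. -/

import Mathlib

open Filter Topology

noncomputable section

namespace BoxLike

/-- The Euclidean plane. -/
abbrev Plane : Type := EuclideanSpace ℝ (Fin 2)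

/-! ### Box-counting dimensions -/

/-- `N_δ(A)`: the smallest number of sets of diameter at most `δ` required to cover `A`.
(For a bounded subset of a Euclidean space and `δ > 0` such finite covers exist.) -/
def coverNumber {X : Type*} [MetricSpace X] (δ : ℝ) (A : Set X) : ℕ :=
  sInf {n : ℕ | ∃ U : Fin n → Set X,
    (∀ i, Metric.ediam (U i) ≤ ENNReal.ofReal δ) ∧ A ⊆ ⋃ i, U i}

/-- The upper box-counting dimension of a bounded set. -/
def upperBoxDim {X : Type*} [MetricSpace X] (A : Set X) : EReal :=
  limsup (fun δ : ℝ => ((Real.log (coverNumber δ A) / (-Real.log δ) : ℝ) : EReal)) (𝓝[>] 0)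

/-- The lower box-counting dimension of a bounded set. -/
def lowerBoxDim {X : Type*} [MetricSpace X] (A : Set X) : EReal :=
  liminf (fun δ : ℝ => ((Real.log (coverNumber δ A) / (-Real.log δ) : ℝ) : EReal)) (𝓝[>] 0)

/-- The box-counting dimension of `A` exists (lower and upper dimension agree) and equals `d`. -/
def HasBoxDim {X : Type*} [MetricSpace X] (A : Set X) (d : ℝ) : Prop :=
  lowerBoxDim A = (d : EReal) ∧ upperBoxDim A = (d : EReal)

/-- The box-counting dimension as a real number; it is meaningful when it exists, that is, when
`HasBoxDim A (boxDim A)` holds. -/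
def boxDim {X : Type*} [MetricSpace X] (A : Set X) : ℝ := (upperBoxDim A).toReal

/-! ### Packing measure and packing dimension -/

/-- A family of (centre, radius) pairs is a `δ`-packing of `A` if the radii lie in `(0, δ]`, the
centres lie in `A` and the closed balls are pairwise disjoint. -/
def IsPacking {X : Type*} [MetricSpace X] (δ : ℝ) (A : Set X) (C : Set (X × ℝ)) : Prop :=
  (∀ p ∈ C, p.1 ∈ A ∧ 0 < p.2 ∧ p.2 ≤ δ) ∧
    C.PairwiseDisjoint (fun p => Metric.closedBall p.1 p.2)

/-- `P^t_δ(A)`: the supremum of `∑ |B_i|^t` over all countable `δ`-packings `{B_i}` of `A`,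
the diameter of a ball of radius `r` being `2r`. -/
def packingPreDelta {X : Type*} [MetricSpace X] (t : NNReal) (δ : ℝ) (A : Set X) : ENNReal :=
  ⨆ (C : Set (X × ℝ)) (_ : C.Countable ∧ IsPacking δ A C),
    ∑' p : C, ENNReal.ofReal (2 * (p : X × ℝ).2) ^ (t : ℝ)

/-- The packing premeasure `P^t_0(A) = lim_{δ → 0} P^t_δ(A)`; the limit is an infimum as `P^t_δ` is
nondecreasing in `δ`. -/
def packingPre {X : Type*} [MetricSpace X] (t : NNReal) (A : Set X) : ENNReal :=
  ⨅ (δ : ℝ) (_ : 0 < δ), packingPreDelta t δ A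

/-- The `t`-dimensional packing measure
`P^t(A) = inf {∑ n, P^t_0(U n) : A ⊆ ⋃ n, U n}`. -/
def packingMeasure {X : Type*} [MetricSpace X] (t : NNReal) (A : Set X) : ENNReal :=
  ⨅ (U : ℕ → Set X) (_ : A ⊆ ⋃ n, U n), ∑' n, packingPre t (U n)

/-- The packing dimension `sup {t ≥ 0 : P^t(A) = ∞}` (with `sup ∅ = 0`). -/
def packingDim {X : Type*} [MetricSpace X] (A : Set X) : ENNReal :=
  ⨆ (t : NNReal) (_ : packingMeasure t A = ⊤), (t : ENNReal)

/-! ### Box-like iterated function systems -/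

/-- The square `[-1,1]²`. -/
def bigSquare : Set Plane := {x | ∀ i, x i ∈ Set.Icc (-1 : ℝ) 1}

/-- The unit square `[0,1]²`. -/
def unitSquare : Set Plane := {x | ∀ i, x i ∈ Set.Icc (0 : ℝ) 1}

/-- `S = T ∘ L + t` where `T = diag(a, b)` with `a, b ∈ (0,1)`, `L` is a linear isometry of the
plane mapping `[-1,1]²` onto itself and `t` is a translation vector. -/
def IsBoxLikeMap (S : Plane →ᵃ[ℝ] Plane) : Prop :=
  ∃ (a b : ℝ) (L : Plane ≃ₗᵢ[ℝ] Plane) (t : Plane),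
    a ∈ Set.Ioo (0 : ℝ) 1 ∧ b ∈ Set.Ioo (0 : ℝ) 1 ∧ L '' bigSquare = bigSquare ∧
      ∀ x, S x = !₂[a * L x 0, b * L x 1] + t

/-- `F` is the attractor of the system: the non-empty compact set with `F = ⋃ i, S i (F)`. -/
def IsAttractor {ι : Type*} (S : ι → Plane →ᵃ[ℝ] Plane) (F : Set Plane) : Prop :=
  F.Nonempty ∧ IsCompact F ∧ F = ⋃ i, S i '' F

/-- The open rectangle `(a,b) × (c,d)`. -/
def openRect (a b c d : ℝ) : Set Plane := {x | x 0 ∈ Set.Ioo a b ∧ x 1 ∈ Set.Ioo c d}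

/-- The rectangular open set condition. -/
def ROSC {ι : Type*} (S : ι → Plane →ᵃ[ℝ] Plane) : Prop :=
  ∃ a b c d : ℝ, a < b ∧ c < d ∧
    (∀ i, S i '' openRect a b c d ⊆ openRect a b c d) ∧
    ∀ i j, i ≠ j → Disjoint (S i '' openRect a b c d) (S j '' openRect a b c d)

/-- The composition `S_w = S_{w 0} ∘ ⋯ ∘ S_{w (k-1)}` along a word `w` of length `k`
(multiplication of affine self-maps is composition). -/
def wordMap {ι : Type*} (S : ι → Plane →ᵃ[ℝ] Plane) {k : ℕ} (w : Fin k → ι) :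
    Plane →ᵃ[ℝ] Plane :=
  (List.ofFn fun j => S (w j)).prod

/-- The larger singular value of the linear part. -/
def α₁ (T : Plane →ᵃ[ℝ] Plane) : ℝ := T.linear.singularValues 0

/-- The smaller singular value of the linear part. -/
def α₂ (T : Plane →ᵃ[ℝ] Plane) : ℝ := T.linear.singularValues 1

/-- Projection onto the horizontal axis. -/
def π₁ (x : Plane) : ℝ := x 0

/-- Projection onto the vertical axis. -/
def π₂ (x : Plane) : ℝ := x 1

/-- The length of the base of the rectangle `T([0,1]²)`. -/
def base (T : Plane →ᵃ[ℝ] Plane) : ℝ := Metric.diam (π₁ '' (T '' unitSquare))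

/-- The height of the rectangle `T([0,1]²)`. -/
def height (T : Plane →ᵃ[ℝ] Plane) : ℝ := Metric.diam (π₂ '' (T '' unitSquare))

/-- `T` maps horizontal lines to horizontal lines. -/
def MapsHToH (T : Plane →ᵃ[ℝ] Plane) : Prop :=
  ∀ c : ℝ, ∃ c' : ℝ, T '' {x | x 1 = c} = {x | x 1 = c'}

/-- `T` maps horizontal lines to vertical lines. -/
def MapsHToV (T : Plane →ᵃ[ℝ] Plane) : Prop :=
  ∀ c : ℝ, ∃ c' : ℝ, T '' {x | x 1 = c} = {x | x 0 = c'}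

open Classical in
/-- The projection `π_w` attached to the map `T = S_w`. A composition of box-like maps satisfies
exactly one of `MapsHToH`, `MapsHToV`, so the second branch is the case
(`MapsHToH` and `base < height`) or (`MapsHToV` and `height ≤ base`). -/
def wordProj (T : Plane →ᵃ[ℝ] Plane) : Plane → ℝ :=
  if (MapsHToH T ∧ height T ≤ base T) ∨ (MapsHToV T ∧ base T < height T) then π₁ else π₂

/-- The modified singular value function `ψ^t(T) = α₁^σ α₂^(t-σ)`, where `σ` is the box dimension
of the projection of `F` by `wordProj T`. -/
def modSV (F : Set Plane) (t : ℝ) (T : Plane →ᵃ[ℝ] Plane) : ℝ :=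
  α₁ T ^ boxDim (wordProj T '' F) * α₂ T ^ (t - boxDim (wordProj T '' F))

/-- `Ψ_k^t`: the sum of `ψ^t(S_w)` over all words `w` of length `k`. -/
def Psi {ι : Type*} [Fintype ι] (S : ι → Plane →ᵃ[ℝ] Plane) (F : Set Plane) (k : ℕ) (t : ℝ) : ℝ :=
  ∑ w : Fin k → ι, modSV F t (wordMap S w)

end BoxLike

end

/-!
Covering numbers on a logarithmic scale are governed by Fekete's lemma twice over.

*Projections.* Every ball centred in a projection of `F` contains a copy of that projection whose
size is comparable to the ball (a cylinder, followed by one further map if the axes have to be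
exchanged). Hence the covering numbers are supermultiplicative up to a constant in the scale, and
they have an exact growth exponent (`HasSmallCopies.exists_hasPowerGrowth`), with a bound
`N_δ ≤ C δ^(-d)` from above and `N_δ ≥ c δ^(-(d-ε))` from below. If some composition exchanges the
axes, then the two projections contain similar copies of each other and their dimensions agree.

*Pressure.* A composition `T` of the maps sends the coordinate axes to coordinate axes, with
stretches `p 0` and `p 1`. Its modified singular value is one of the two weights
`p j ^ s j * p (1 - j) ^ (t - s j)`, `s j` being the dimension of the `j`-th projection: the larger
one if `t ≤ s 0 + s 1`, the smaller one if `t ≥ s 0 + s 1`. As each weight is multiplicative, `ψ^t`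
is submultiplicative or supermultiplicative, so that the pressure exists
(`IsTreeWeight.exists_pressure`). All stretches lie in some `[m, M]` with `0 < m ≤ M < 1`, so its
logarithm decreases in `t` at a rate between two positive constants and has exactly one zero `s`.

*Upper bound.* Stop each word when its smaller singular value first becomes comparable to `δ`. A
stopped cylinder is a strip of width about `δ`, which is covered along its longer side by about
`(α₁ / δ) ^ s(w)` sets, a number comparable to `δ^(-t) ψ^t(w)`. For `t > s` the level sums of `ψ^t`
are summable, so the sum over the stopped words is bounded
(`BoxLikeSystem.upperBoxDim_le_of_pressure`).

*Lower bound.* Under the rectangular open set condition the images of the open rectangle along the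
stopped words are disjoint and contain squares of side comparable to `δ`, so that a set of diameter
`δ` meets boundedly many stopped cylinders. For `t < s` the sum of `ψ^t` over the stopped words is
bounded below (`IsTreeWeight.exists_le_sum_cut`). This gives
`BoxLikeSystem.le_lowerBoxDim_of_pressure`.

*Packing dimension.* It never exceeds the upper box dimension. Conversely, every relatively open
part of `F` contains an invertible affine image of `F` and so has the same upper box dimension; by
Baire's theorem some set of any countable cover of `F` is dense in such a part, and the centres of a
large packing can be moved into it (`BoxLikeSystem.packingDim_eq_upperBoxDim`).
-/

noncomputable section

namespace BoxLike

/-! ### Covering numbers -/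

section Covering

variable {X Y Z : Type*} [MetricSpace X] [MetricSpace Y]

theorem coverNumber_le_card {κ : Type*} {δ : ℝ} {A : Set X} (s : Finset κ) (U : κ → Set X)
    (hU : ∀ i ∈ s, Metric.ediam (U i) ≤ ENNReal.ofReal δ) (hA : A ⊆ ⋃ i ∈ s, U i) :
    coverNumber δ A ≤ s.card := by
  refine Nat.sInf_le ⟨fun j => U (s.equivFin.symm j), fun j => hU _ (s.equivFin.symm j).2, ?_⟩
  intro x hx
  obtain ⟨i, hi, hxi⟩ := Set.mem_iUnion₂.1 (hA hx)
  exact Set.mem_iUnion.2 ⟨s.equivFin ⟨i, hi⟩, by simpa using hxi⟩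

theorem exists_cover {δ : ℝ} (hδ : 0 < δ) {A : Set X} (hA : TotallyBounded A) :
    ∃ U : Fin (coverNumber δ A) → Set X,
      (∀ i, Metric.ediam (U i) ≤ ENNReal.ofReal δ) ∧ A ⊆ ⋃ i, U i := by
  refine Nat.sInf_mem (s := {n : ℕ | ∃ U : Fin n → Set X,
    (∀ i, Metric.ediam (U i) ≤ ENNReal.ofReal δ) ∧ A ⊆ ⋃ i, U i}) ?_
  obtain ⟨t, ht, hAt⟩ := Metric.totallyBounded_iff.1 hA (δ / 2) (by positivity)
  refine ⟨ht.toFinset.card, fun j => Metric.ball (ht.toFinset.equivFin.symm j : X) (δ / 2),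
    fun j => ?_, fun x hx => ?_⟩
  · refine Metric.ediam_le_of_forall_dist_le fun x hx y hy => ?_
    have := dist_triangle_right x y (ht.toFinset.equivFin.symm j : X)
    rw [Metric.mem_ball] at hx hy
    linarith
  · obtain ⟨i, hi, hxi⟩ := Set.mem_iUnion₂.1 (hAt hx)
    exact Set.mem_iUnion.2 ⟨ht.toFinset.equivFin ⟨i, by simpa using hi⟩, by simpa using hxi⟩

theorem dist_le_of_ediam_le {U : Set X} {δ : ℝ} (hδ : 0 ≤ δ)
    (hU : Metric.ediam U ≤ ENNReal.ofReal δ) {x y : X} (hx : x ∈ U) (hy : y ∈ U) :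
    dist x y ≤ δ := by
  have := (Metric.edist_le_ediam_of_mem hx hy).trans hU
  rwa [edist_dist, ENNReal.ofReal_le_ofReal_iff hδ] at this

/-- If distances between values of `g` are controlled by distances between values of `h`, then
covers of the image under `h` pull back to covers of the image under `g`. -/
theorem coverNumber_image_le {g : Z → X} {h : Z → Y} {B : Set Z} {K L δ : ℝ} (hδ : 0 < δ)
    (hK : 0 ≤ K) (hB : TotallyBounded (h '' B))
    (hgh : ∀ x ∈ B, ∀ y ∈ B, dist (g x) (g y) ≤ K * dist (h x) (h y) + L) :
    coverNumber (K * δ + L) (g '' B) ≤ coverNumber δ (h '' B) := by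
  obtain ⟨U, hU, hBU⟩ := exists_cover hδ hB
  have := coverNumber_le_card (δ := K * δ + L) (A := g '' B) Finset.univ
    (fun i => g '' (B ∩ h ⁻¹' U i)) (fun i _ => ?_) ?_
  · simpa using this
  · refine Metric.ediam_le_of_forall_dist_le ?_
    rintro _ ⟨x, hx, rfl⟩ _ ⟨y, hy, rfl⟩
    have := dist_le_of_ediam_le hδ.le (hU i) hx.2 hy.2
    exact (hgh x hx.1 y hy.1).trans (by gcongr)
  · rintro _ ⟨x, hx, rfl⟩
    obtain ⟨i, hi⟩ := Set.mem_iUnion.1 (hBU ⟨x, hx, rfl⟩)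
    exact Set.mem_iUnion₂.2 ⟨i, Finset.mem_univ _, x, ⟨hx, hi⟩, rfl⟩

theorem coverNumber_mono {δ δ' : ℝ} (hδ : 0 < δ) (h : δ ≤ δ') {A B : Set X} (hAB : A ⊆ B)
    (hB : TotallyBounded B) : coverNumber δ' A ≤ coverNumber δ B := by
  obtain ⟨U, hU, hBU⟩ := exists_cover hδ hB
  exact Nat.sInf_le ⟨U, fun i => (hU i).trans (ENNReal.ofReal_le_ofReal h), hAB.trans hBU⟩

theorem card_le_coverNumber {δ : ℝ} (hδ : 0 < δ) {A : Set X} (hA : TotallyBounded A)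
    {s : Finset X} (hsA : ↑s ⊆ A) (hs : ∀ x ∈ s, ∀ y ∈ s, x ≠ y → δ < dist x y) :
    s.card ≤ coverNumber δ A := by
  obtain ⟨U, hU, hAU⟩ := exists_cover hδ hA
  have hex : ∀ x ∈ s, ∃ i, x ∈ U i := fun x hx => Set.mem_iUnion.1 (hAU (hsA hx))
  choose f hf using hex
  have hinj : Function.Injective fun x : s => f x x.2 := by
    intro x y hxy
    by_contra hne
    have hy := hf y y.2
    rw [← show f x x.2 = f y y.2 from hxy] at hy
    have h1 := dist_le_of_ediam_le hδ.le (hU _) (hf x x.2) hy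
    exact absurd (hs x x.2 y y.2 fun h => hne (Subtype.ext h)) (not_lt.2 h1)
  simpa using Fintype.card_le_of_injective _ hinj

theorem coverNumber_pos {δ : ℝ} (hδ : 0 < δ) {A : Set X} (hA : TotallyBounded A)
    (hne : A.Nonempty) : 1 ≤ coverNumber δ A := by
  obtain ⟨x, hx⟩ := hne
  simpa using card_le_coverNumber (s := {x}) hδ hA (by simpa using hx) (by simp)

/-- A maximal separated subset of `A`: the balls of the separation radius about its points
cover `A`. -/
theorem exists_separated {δ : ℝ} (hδ : 0 < δ) {A : Set X} (hA : TotallyBounded A) :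
    ∃ s : Finset X, ↑s ⊆ A ∧ (∀ x ∈ s, ∀ y ∈ s, x ≠ y → δ < dist x y) ∧
      coverNumber (2 * δ) A ≤ s.card := by
  classical
  let p : ℕ → Prop := fun n => ∃ s : Finset X, ↑s ⊆ A ∧
    (∀ x ∈ s, ∀ y ∈ s, x ≠ y → δ < dist x y) ∧ s.card = n
  have hp0 : p 0 := ⟨∅, by simp, by simp, by simp⟩
  have hbd : ∀ n, p n → n ≤ coverNumber δ A := by
    rintro n ⟨s, h1, h2, rfl⟩
    exact card_le_coverNumber hδ hA h1 h2
  obtain ⟨s, hsA, hs, hcard⟩ := Nat.findGreatest_spec (P := p) (Nat.zero_le (coverNumber δ A)) hp0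
  refine ⟨s, hsA, hs, ?_⟩
  refine coverNumber_le_card s (fun x => Metric.closedBall x δ) (fun x _ => ?_) ?_
  · refine Metric.ediam_le_of_forall_dist_le fun a ha b hb => ?_
    have := dist_triangle_right a b x
    rw [Metric.mem_closedBall] at ha hb
    linarith
  · intro x hx
    by_contra hcon
    simp only [Set.mem_iUnion, Metric.mem_closedBall, not_exists, not_le] at hcon
    have hxs : x ∉ s := fun h => by simpa using (hcon x h).trans_le' hδ.le
    have hpn : p (s.card + 1) := by
      refine ⟨insert x s, ?_, ?_, Finset.card_insert_of_notMem hxs⟩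
      · rw [Finset.coe_insert]; exact Set.insert_subset hx hsA
      · intro a ha b hb hab
        rcases Finset.mem_insert.1 ha with ha | ha <;> rcases Finset.mem_insert.1 hb with hb | hb
        · exact absurd (ha.trans hb.symm) hab
        · exact ha ▸ hcon b hb
        · rw [dist_comm]; exact hb ▸ hcon a ha
        · exact hs a ha b hb hab
    have := Nat.le_findGreatest (hbd _ hpn) hpn
    omega

end Covering

/-! ### Box dimensions from power bounds -/

section BoxDim

variable {X : Type*} [MetricSpace X] {A : Set X}

theorem tendsto_neg_log_nhdsGT : Tendsto (fun δ : ℝ => -Real.log δ) (𝓝[>] 0) atTop :=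
  tendsto_neg_atBot_atTop.comp Real.tendsto_log_nhdsGT_zero

theorem tendsto_log_power_ratio (C d : ℝ) :
    Tendsto (fun δ : ℝ => (((Real.log C / (-Real.log δ) + d : ℝ)) : EReal)) (𝓝[>] 0)
      (𝓝 (d : EReal)) := by
  refine (continuous_coe_real_ereal.tendsto d).comp ?_
  simpa using (tendsto_neg_log_nhdsGT.const_div_atTop (Real.log C)).add_const d

theorem eventually_small {r : ℝ} (hr : 0 < r) : ∀ᶠ δ : ℝ in 𝓝[>] 0, 0 < δ ∧ δ < r :=
  Ioo_mem_nhdsGT hr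

theorem log_power_div {C d δ : ℝ} (hC : 0 < C) (hδ : 0 < δ) (hδ1 : δ < 1) :
    Real.log (C * δ ^ (-d)) / (-Real.log δ) = Real.log C / (-Real.log δ) + d := by
  have h := Real.log_neg hδ hδ1
  rw [Real.log_mul hC.ne' (Real.rpow_pos_of_pos hδ _).ne', Real.log_rpow hδ, add_div]
  rw [neg_mul, neg_div_neg_eq, mul_div_cancel_right₀ _ h.ne]

theorem upperBoxDim_le {C d : ℝ} (hC : 0 < C)
    (hpos : ∀ᶠ δ : ℝ in 𝓝[>] 0, 1 ≤ coverNumber δ A)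
    (h : ∀ᶠ δ : ℝ in 𝓝[>] 0, (coverNumber δ A : ℝ) ≤ C * δ ^ (-d)) : upperBoxDim A ≤ d := by
  rw [← (tendsto_log_power_ratio C d).limsup_eq]
  refine limsup_le_limsup ?_
  filter_upwards [h, hpos, eventually_small one_pos] with δ h hN hδ
  rw [← log_power_div hC hδ.1 hδ.2, EReal.coe_le_coe_iff]
  have := Real.log_neg hδ.1 hδ.2
  have hN' : (0 : ℝ) < coverNumber δ A := by exact_mod_cast hN
  have := Real.log_le_log hN' h
  gcongr
  linarith

theorem le_lowerBoxDim {C d : ℝ} (hC : 0 < C)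
    (h : ∀ᶠ δ : ℝ in 𝓝[>] 0, C * δ ^ (-d) ≤ (coverNumber δ A : ℝ)) : d ≤ lowerBoxDim A := by
  rw [← (tendsto_log_power_ratio C d).liminf_eq]
  refine liminf_le_liminf ?_
  filter_upwards [h, eventually_small one_pos] with δ h hδ
  rw [← log_power_div hC hδ.1 hδ.2, EReal.coe_le_coe_iff]
  have := Real.log_neg hδ.1 hδ.2
  have := Real.log_le_log (mul_pos hC (Real.rpow_pos_of_pos hδ.1 _)) h
  gcongr
  linarith

theorem lowerBoxDim_le_upperBoxDim : lowerBoxDim A ≤ upperBoxDim A := liminf_le_limsup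

theorem HasBoxDim.boxDim_eq {d : ℝ} (h : HasBoxDim A d) : boxDim A = d := by
  rw [boxDim, h.2, EReal.toReal_coe]

/-- Power bounds on the covering numbers at all scales at most `1`, sharp up to `δ ^ (-ε)` from
below and up to a constant from above. -/
structure HasPowerGrowth (A : Set X) (d : ℝ) : Prop where
  nonneg : 0 ≤ d
  upper : ∃ C > 0, ∀ δ : ℝ, 0 < δ → δ ≤ 1 → (coverNumber δ A : ℝ) ≤ C * δ ^ (-d)
  lower : ∀ ε > 0, ∃ c > 0, ∀ δ : ℝ, 0 < δ → δ ≤ 1 → c * δ ^ (-(d - ε)) ≤ (coverNumber δ A : ℝ)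

theorem HasPowerGrowth.hasBoxDim {d : ℝ} (h : HasPowerGrowth A d) (hA : TotallyBounded A)
    (hne : A.Nonempty) : HasBoxDim A d := by
  have hup : upperBoxDim A ≤ d := by
    obtain ⟨C, hC, hb⟩ := h.upper
    refine upperBoxDim_le hC ?_ ?_
    · filter_upwards [eventually_small one_pos] with δ hδ
      exact coverNumber_pos hδ.1 hA hne
    · filter_upwards [eventually_small one_pos] with δ hδ
      exact hb δ hδ.1 hδ.2.le
  have hlow : (d : EReal) ≤ lowerBoxDim A := by
    refine EReal.ge_of_forall_gt_iff_ge.1 fun z hz => ?_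
    have hz' : z < d := by exact_mod_cast hz
    obtain ⟨c, hc, hb⟩ := h.lower (d - z) (by linarith)
    refine le_lowerBoxDim hc ?_
    filter_upwards [eventually_small one_pos] with δ hδ
    simpa using hb δ hδ.1 hδ.2.le
  exact ⟨le_antisymm (lowerBoxDim_le_upperBoxDim.trans hup) hlow,
    le_antisymm hup (hlow.trans lowerBoxDim_le_upperBoxDim)⟩

end BoxDim

/-! ### Box dimension of sets with approximate copies of themselves at every scale -/

section SelfSimilar

variable {X : Type*} [MetricSpace X] {E : Set X}

/-- Every ball centred in `E` of radius `δ ≤ 1` contains a copy of `E` shrunk by no more than the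
factor `c * δ`. -/
def HasSmallCopies (c : ℝ) (E : Set X) : Prop :=
  ∀ x ∈ E, ∀ δ : ℝ, 0 < δ → δ ≤ 1 → ∃ φ : X → X, (∀ y ∈ E, φ y ∈ E ∧ dist (φ y) x ≤ δ) ∧
    ∀ y ∈ E, ∀ z ∈ E, c * δ * dist y z ≤ dist (φ y) (φ z)

/-- Placing copies of an `ε`-separated set around the points of a `δ`-separated set shows that the
covering numbers are supermultiplicative, up to a constant in the scale. -/
theorem HasSmallCopies.coverNumber_mul_le {c : ℝ} (hc : 0 < c) (hc1 : c ≤ 1)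
    (hE : TotallyBounded E) (hcopy : HasSmallCopies c E) {δ ε : ℝ} (hδ : 0 < δ) (hδ1 : δ ≤ 1)
    (hε : 0 < ε) (hε1 : ε ≤ 1) :
    coverNumber δ E * coverNumber ε E ≤ coverNumber (c / 16 * δ * ε) E := by
  classical
  -- Copies of `t` at radius `δ / 8` around the points of the `δ / 2`-separated set `s` stay `δ / 4`
  -- apart, and within one copy the separation is at least `c * (δ / 8) * (ε / 2)`.
  obtain ⟨s, hsE, hs, hsc⟩ := exists_separated (half_pos hδ) hE
  obtain ⟨t, htE, ht, htc⟩ := exists_separated (half_pos hε) hE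
  rw [mul_div_cancel₀ _ two_ne_zero] at hsc htc
  have hex : ∀ x : E, ∃ φ : X → X, (∀ y ∈ E, φ y ∈ E ∧ dist (φ y) x ≤ δ / 8) ∧
      ∀ y ∈ E, ∀ z ∈ E, c * (δ / 8) * dist y z ≤ dist (φ y) (φ z) :=
    fun x => hcopy x x.2 (δ / 8) (by positivity) (by linarith)
  choose φ hφ1 hφ2 using hex
  let g : s × t → X := fun p => φ ⟨p.1, hsE p.1.2⟩ p.2
  have hsep : ∀ p q : s × t, p ≠ q → c / 16 * δ * ε < dist (g p) (g q) := by
    rintro ⟨x, y⟩ ⟨x', y'⟩ hpq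
    by_cases hx : x = x'
    · subst hx
      have hy : (y : X) ≠ y' := fun h => hpq (by rw [Subtype.ext h])
      have h1 := hφ2 ⟨x, hsE x.2⟩ y (htE y.2) y' (htE y'.2)
      have h2 := ht y y.2 y' y'.2 hy
      calc c / 16 * δ * ε = c * (δ / 8) * (ε / 2) := by ring
        _ < c * (δ / 8) * dist (y : X) y' := by gcongr
        _ ≤ _ := h1
    · have hx' : (x : X) ≠ x' := fun h => hx (Subtype.ext h)
      have h1 := hs x x.2 x' x'.2 hx'
      have h2 := (hφ1 ⟨x, hsE x.2⟩ y (htE y.2)).2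
      have h3 := (hφ1 ⟨x', hsE x'.2⟩ y' (htE y'.2)).2
      have h4 : dist (x : X) x' ≤ dist (g (x, y)) x + dist (g (x, y)) (g (x', y')) +
          dist (g (x', y')) x' := by
        have := dist_triangle4 (x : X) (g (x, y)) (g (x', y')) x'
        rwa [dist_comm (x : X) (g (x, y))] at this
      have h5 : c / 16 * δ * ε ≤ δ / 16 := by
        have : c * ε ≤ 1 := mul_le_one₀ hc1 hε.le hε1
        nlinarith
      simp only [g] at h4 ⊢
      linarith
  have hpos : 0 < c / 16 * δ * ε := by positivity
  have hinj : Function.Injective g := fun p q hpq => by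
    by_contra hne
    have := hsep p q hne
    rw [hpq, dist_self] at this
    linarith
  have hcard := card_le_coverNumber (s := Finset.univ.image g) hpos hE ?_ ?_
  · rw [Finset.card_image_of_injective _ hinj, Finset.card_univ, Fintype.card_prod,
      Fintype.card_coe, Fintype.card_coe] at hcard
    exact (Nat.mul_le_mul hsc htc).trans hcard
  · intro z hz
    obtain ⟨p, -, rfl⟩ := Finset.mem_image.1 (Finset.mem_coe.1 hz)
    exact (hφ1 _ _ (htE p.2.2)).1
  · intro z hz z' hz' hzz
    obtain ⟨p, -, rfl⟩ := Finset.mem_image.1 hz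
    obtain ⟨q, -, rfl⟩ := Finset.mem_image.1 hz'
    exact hsep p q fun h => hzz (by rw [h])

/-- A set with approximate copies of itself at every scale has an exact growth exponent of its
covering numbers: apply Fekete's lemma to the supermultiplicative sequence of covering numbers along
a geometric sequence of scales. -/
theorem HasSmallCopies.exists_hasPowerGrowth {c : ℝ} (hc : 0 < c) (hc1 : c ≤ 1)
    (hE : TotallyBounded E) (hne : E.Nonempty) (hcopy : HasSmallCopies c E)
    (hpoly : ∃ C > 0, ∃ D : ℝ, ∀ δ : ℝ, 0 < δ → δ ≤ 1 → (coverNumber δ E : ℝ) ≤ C * δ ^ (-D)) :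
    ∃ d, HasPowerGrowth E d := by
  set κ : ℝ := c / 16 with hκ
  have hκ0 : 0 < κ := by positivity
  have hκ1 : κ < 1 := by linarith
  have hlogκ : Real.log κ < 0 := Real.log_neg hκ0 hκ1
  have hN1 : ∀ δ : ℝ, 0 < δ → (1 : ℝ) ≤ coverNumber δ E := fun δ hδ => by
    exact_mod_cast coverNumber_pos hδ hE hne
  have hpow0 : ∀ n : ℕ, 0 < κ ^ n := fun n => by positivity
  have hpow1 : ∀ n : ℕ, κ ^ n ≤ 1 := fun n => pow_le_one₀ hκ0.le hκ1.le
  -- The index is shifted by one to absorb the factor `κ` lost in the scale.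
  let u : ℕ → ℝ := fun n => Nat.casesOn n 0 fun n => -Real.log (coverNumber (κ ^ n) E)
  have hu : ∀ n, u (n + 1) = -Real.log (coverNumber (κ ^ n) E) := fun n => rfl
  have hu0 : u 0 = 0 := rfl
  have hsub : Subadditive u := by
    rintro (_ | m) (_ | n)
    · simp [hu0]
    · simp [hu0]
    · simp [hu0]
    · rw [show m + 1 + (n + 1) = (m + n + 1) + 1 by ring, hu, hu, hu]
      have h := hcopy.coverNumber_mul_le hc hc1 hE (hpow0 m) (hpow1 m) (hpow0 n) (hpow1 n)
      rw [show c / 16 * κ ^ m * κ ^ n = κ ^ (m + n + 1) by rw [← hκ]; ring] at h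
      have h' : (coverNumber (κ ^ m) E : ℝ) * coverNumber (κ ^ n) E ≤
        coverNumber (κ ^ (m + n + 1)) E := by exact_mod_cast h
      have p1 := hN1 _ (hpow0 m)
      have p2 := hN1 _ (hpow0 n)
      have := Real.log_le_log (by positivity) h'
      rw [Real.log_mul (by positivity) (by positivity)] at this
      linarith
  have hbdd : BddBelow (Set.range fun n => u n / n) := by
    obtain ⟨C, hC, D, hb⟩ := hpoly
    refine ⟨-(|Real.log C| + |D * Real.log κ|), ?_⟩
    rintro _ ⟨_ | n, rfl⟩
    · simp only [hu0, Nat.cast_zero, div_zero]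
      have := abs_nonneg (Real.log C)
      have := abs_nonneg (D * Real.log κ)
      linarith
    · simp only [hu]
      rw [le_div_iff₀ (by positivity)]
      have h := Real.log_le_log (zero_lt_one.trans_le (hN1 _ (hpow0 n))) (hb _ (hpow0 n) (hpow1 n))
      rw [Real.log_mul hC.ne' (Real.rpow_pos_of_pos (hpow0 n) _).ne', Real.log_rpow (hpow0 n),
        Real.log_pow] at h
      have h1 := le_abs_self (Real.log C)
      have h2 := neg_abs_le (D * Real.log κ)
      have h3 := abs_nonneg (Real.log C)
      have h4 := abs_nonneg (D * Real.log κ)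
      push_cast
      have hn : (0 : ℝ) ≤ n := Nat.cast_nonneg n
      nlinarith
  set L := hsub.lim with hL
  have hLu : ∀ n : ℕ, ((n : ℝ) + 1) * L ≤ -Real.log (coverNumber (κ ^ n) E) := fun n => by
    have := hsub.lim_le_div hbdd (n := n + 1) (by simp)
    rw [le_div_iff₀ (by positivity), hu] at this
    push_cast at this
    linarith
  have hL0 : L ≤ 0 := by
    have h1 := hLu 0
    have h2 := Real.log_nonneg (hN1 _ (hpow0 0))
    push_cast at h1
    linarith
  set d := L / Real.log κ with hd
  have hdL : d * Real.log κ = L := div_mul_cancel₀ _ hlogκ.ne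
  have hd0 : 0 ≤ d := div_nonneg_of_nonpos hL0 hlogκ.le
  refine ⟨d, hd0, ⟨Real.exp (-(2 * L)), Real.exp_pos _, fun δ hδ hδ1 => ?_⟩, fun ε hε => ?_⟩
  · obtain ⟨n, hn1, hn2⟩ := exists_nat_pow_near_of_lt_one hδ hδ1 hκ0 hκ1
    have h1 : (coverNumber δ E : ℝ) ≤ coverNumber (κ ^ (n + 1)) E := by
      exact_mod_cast coverNumber_mono (hpow0 _) hn1.le le_rfl hE
    have h2 : (coverNumber (κ ^ (n + 1)) E : ℝ) ≤ Real.exp (-((n + 2) * L)) := by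
      rw [← Real.log_le_iff_le_exp (zero_lt_one.trans_le (hN1 _ (hpow0 _)))]
      have := hLu (n + 1)
      push_cast at this
      linarith
    refine h1.trans (h2.trans ?_)
    rw [Real.rpow_def_of_pos hδ, ← Real.exp_add, Real.exp_le_exp]
    have h3 := Real.log_le_log hδ hn2
    rw [Real.log_pow] at h3
    have := mul_le_mul_of_nonneg_right h3 hd0
    nlinarith
  · rcases lt_or_ge d ε with hdε | hdε
    · refine ⟨1, one_pos, fun δ hδ hδ1 => ?_⟩
      rw [one_mul]
      exact (Real.rpow_le_one hδ.le hδ1 (by linarith)).trans (hN1 δ hδ)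
    · have hη : 0 < -(ε * Real.log κ) := by nlinarith
      have hev := (hsub.tendsto_lim hbdd).eventually (gt_mem_nhds (show L < L + -(ε * Real.log κ)
        by linarith))
      obtain ⟨n₀, hn₀⟩ := eventually_atTop.1 hev
      refine ⟨κ ^ (n₀ * (d - ε)), Real.rpow_pos_of_pos hκ0 _, fun δ hδ hδ1 => ?_⟩
      obtain ⟨n, hn1, hn2⟩ := exists_nat_pow_near_of_lt_one hδ hδ1 hκ0 hκ1
      have hlogδ : (n + 1) * Real.log κ ≤ Real.log δ := by
        have := Real.log_le_log (hpow0 _) hn1.le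
        rw [Real.log_pow] at this
        exact_mod_cast this
      have h1 : (coverNumber (κ ^ n) E : ℝ) ≤ coverNumber δ E := by
        exact_mod_cast coverNumber_mono hδ hn2 le_rfl hE
      rw [Real.rpow_def_of_pos hκ0, Real.rpow_def_of_pos hδ, ← Real.exp_add]
      refine le_trans ?_ h1
      rcases le_or_gt n₀ (n + 1) with hcase | hcase
      · have h2 := hn₀ (n + 1) hcase
        rw [div_lt_iff₀ (by positivity), hu] at h2
        push_cast at h2
        rw [← Real.exp_log (zero_lt_one.trans_le (hN1 _ (hpow0 n))), Real.exp_le_exp]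
        have h3 := mul_le_mul_of_nonneg_right hlogδ (sub_nonneg.2 hdε)
        have h4 : Real.log κ * (n₀ * (d - ε)) ≤ 0 :=
          mul_nonpos_of_nonpos_of_nonneg hlogκ.le (mul_nonneg (Nat.cast_nonneg _) (by linarith))
        nlinarith
      · refine le_trans ?_ (hN1 _ (hpow0 n))
        rw [Real.exp_le_one_iff]
        have h3 := mul_le_mul_of_nonneg_right hlogδ (sub_nonneg.2 hdε)
        have h4 : ((n : ℝ) + 1) ≤ n₀ := by exact_mod_cast hcase.le
        have h5 : Real.log κ * (d - ε) ≤ 0 :=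
          mul_nonpos_of_nonpos_of_nonneg hlogκ.le (by linarith)
        nlinarith

end SelfSimilar

/-! ### Axis-preserving affine maps of the plane -/

/-- The length of the image of the `j`-th unit vector under the linear part of `T`. -/
def stretch (T : Plane →ᵃ[ℝ] Plane) (j : Fin 2) : ℝ := ‖T.linear (EuclideanSpace.single j 1)‖

/-- `T` is invertible and maps the `j`-th coordinate direction to the `σ j`-th one, that is, the
coordinate `σ j` of `T x` depends on the coordinate `j` of `x` only. -/
def IsAxisMap (T : Plane →ᵃ[ℝ] Plane) (σ : Equiv.Perm (Fin 2)) : Prop :=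
  ∃ u c : Fin 2 → ℝ, (∀ j, u j ≠ 0) ∧ ∀ x j, T x (σ j) = u j * x j + c j

theorem perm_one_sub (σ : Equiv.Perm (Fin 2)) (j : Fin 2) : σ (1 - j) = 1 - σ j := by
  revert σ j; decide

theorem perm_perm (σ : Equiv.Perm (Fin 2)) (j : Fin 2) : σ (σ j) = j := by
  revert σ j; decide

theorem sum_fin_two_perm (f : Fin 2 → ℝ) (j : Fin 2) : ∑ i, f i = f j + f (1 - j) := by
  fin_cases j <;> simp [Fin.sum_univ_two, add_comm]

theorem one_sub_ne (j : Fin 2) : 1 - j ≠ j := by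
  revert j; decide

theorem one_sub_one_sub (j : Fin 2) : 1 - (1 - j) = j := by
  revert j; decide

theorem eq_zero_or_eq_one (j : Fin 2) : j = 0 ∨ j = 1 := by
  revert j; decide

theorem eq_or_eq_one_sub (i j : Fin 2) : i = j ∨ i = 1 - j := by
  revert i j; decide

variable {T U : Plane →ᵃ[ℝ] Plane} {σ τ : Equiv.Perm (Fin 2)}

theorem dist_sq_eq (x y : Plane) (j : Fin 2) :
    dist x y ^ 2 = (x j - y j) ^ 2 + (x (1 - j) - y (1 - j)) ^ 2 := by
  rw [EuclideanSpace.dist_eq, Real.sq_sqrt (by positivity),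
    sum_fin_two_perm (fun i => dist (x i) (y i) ^ 2) j]
  simp [Real.dist_eq, sq_abs]

theorem abs_coord_sub_le (x y : Plane) (j : Fin 2) : |x j - y j| ≤ dist x y := by
  refine abs_le_of_sq_le_sq ?_ dist_nonneg
  rw [dist_sq_eq x y j]
  nlinarith [sq_nonneg (x (1 - j) - y (1 - j))]

theorem dist_le_add (x y : Plane) (j : Fin 2) :
    dist x y ≤ |x j - y j| + |x (1 - j) - y (1 - j)| := by
  refine le_of_sq_le_sq ?_ (by positivity)
  rw [dist_sq_eq x y j, add_sq, sq_abs, sq_abs]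
  have := mul_nonneg (abs_nonneg (x j - y j)) (abs_nonneg (x (1 - j) - y (1 - j)))
  linarith

namespace IsAxisMap

theorem exists_coeff (h : IsAxisMap T σ) : ∃ u c : Fin 2 → ℝ,
    (∀ j, stretch T j = |u j|) ∧ (∀ j, u j ≠ 0) ∧ ∀ x j, T x (σ j) = u j * x j + c j := by
  obtain ⟨u, c, hu, hT⟩ := h
  refine ⟨u, c, fun j => ?_, hu, hT⟩
  have hlin : T.linear (EuclideanSpace.single j 1) = T (EuclideanSpace.single j 1) - T 0 := by
    have := T.linearMap_vsub (EuclideanSpace.single j 1) 0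
    simpa using this
  have h2 : stretch T j ^ 2 = |u j| ^ 2 := by
    rw [stretch, hlin, ← dist_eq_norm, dist_sq_eq _ _ (σ j), ← perm_one_sub, hT, hT, hT, hT]
    simp [one_sub_ne j, sq_abs]
  exact (sq_eq_sq₀ (norm_nonneg _) (abs_nonneg _)).1 h2

theorem stretch_pos (h : IsAxisMap T σ) (j : Fin 2) : 0 < stretch T j := by
  obtain ⟨u, c, hs, hu, -⟩ := h.exists_coeff
  rw [hs]; exact abs_pos.2 (hu j)

theorem abs_sub (h : IsAxisMap T σ) (x y : Plane) (j : Fin 2) :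
    |T x (σ j) - T y (σ j)| = stretch T j * |x j - y j| := by
  obtain ⟨u, c, hs, hu, hT⟩ := h.exists_coeff
  rw [hT, hT, hs, ← abs_mul]
  congr 1; ring

theorem unique (h : IsAxisMap T σ) (h' : IsAxisMap T τ) : σ = τ := by
  ext j : 1
  by_contra hne
  have h1 := h.abs_sub (EuclideanSpace.single j 1) 0 j
  have h2 := h'.abs_sub (EuclideanSpace.single j 1) 0 (τ.symm (σ j))
  have hne' : τ.symm (σ j) ≠ j := fun h => hne ((Equiv.symm_apply_eq τ).1 h)
  rw [Equiv.apply_symm_apply, h1] at h2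
  have := h.stretch_pos j
  simp [hne'] at h2
  linarith

theorem one : IsAxisMap 1 1 := ⟨1, 0, fun _ => one_ne_zero, fun x j => by simp⟩

theorem stretch_one (j : Fin 2) : stretch 1 j = 1 := by
  have : (1 : Plane →ᵃ[ℝ] Plane).linear = LinearMap.id := rfl
  simp [stretch, this]

theorem mul (hT : IsAxisMap T σ) (hU : IsAxisMap U τ) : IsAxisMap (T * U) (σ * τ) := by
  obtain ⟨u, c, hu, hT⟩ := hT
  obtain ⟨v, d, hv, hU⟩ := hU
  refine ⟨fun j => u (τ j) * v j, fun j => u (τ j) * d j + c (τ j),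
    fun j => mul_ne_zero (hu _) (hv _), fun x j => ?_⟩
  rw [AffineMap.coe_mul, Function.comp_apply, Equiv.Perm.mul_apply, hT, hU]
  ring

theorem stretch_mul (hT : IsAxisMap T σ) (hU : IsAxisMap U τ) (j : Fin 2) :
    stretch (T * U) j = stretch T (τ j) * stretch U j := by
  have h := (hT.mul hU).abs_sub (EuclideanSpace.single j 1) 0 j
  rw [AffineMap.coe_mul, Function.comp_apply, Function.comp_apply, Equiv.Perm.mul_apply,
    hT.abs_sub, hU.abs_sub] at h
  simpa using h.symm

theorem stretch_mul_abs_le (h : IsAxisMap T σ) (x y : Plane) (j : Fin 2) :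
    stretch T j * |x j - y j| ≤ dist (T x) (T y) := by
  rw [← h.abs_sub]; exact abs_coord_sub_le _ _ _

theorem dist_le_add (h : IsAxisMap T σ) (x y : Plane) (j : Fin 2) :
    dist (T x) (T y) ≤
      stretch T j * |x j - y j| + stretch T (1 - j) * |x (1 - j) - y (1 - j)| := by
  refine (BoxLike.dist_le_add (T x) (T y) (σ j)).trans_eq ?_
  rw [← perm_one_sub, h.abs_sub, h.abs_sub]

theorem dist_le (h : IsAxisMap T σ) {M : ℝ} (hM : ∀ j, stretch T j ≤ M) (x y : Plane) :
    dist (T x) (T y) ≤ M * dist x y := by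
  have hM0 : 0 ≤ M := (h.stretch_pos 0).le.trans (hM 0)
  refine le_of_sq_le_sq ?_ (by positivity)
  have hj : ∀ j, (T x (σ j) - T y (σ j)) ^ 2 ≤ M ^ 2 * (x j - y j) ^ 2 := fun j => by
    rw [← sq_abs, h.abs_sub, mul_pow, sq_abs]
    have := pow_le_pow_left₀ (h.stretch_pos j).le (hM j) 2
    gcongr
  rw [mul_pow, dist_sq_eq _ _ (σ 0), dist_sq_eq _ _ (0 : Fin 2), ← perm_one_sub]
  linarith [hj 0, hj (1 - 0)]

theorem le_dist (h : IsAxisMap T σ) {m : ℝ} (hm0 : 0 ≤ m) (hm : ∀ j, m ≤ stretch T j)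
    (x y : Plane) : m * dist x y ≤ dist (T x) (T y) := by
  refine le_of_sq_le_sq ?_ dist_nonneg
  have hj : ∀ j, m ^ 2 * (x j - y j) ^ 2 ≤ (T x (σ j) - T y (σ j)) ^ 2 := fun j => by
    rw [← sq_abs (T x (σ j) - T y (σ j)), h.abs_sub, mul_pow, sq_abs]
    have := pow_le_pow_left₀ hm0 (hm j) 2
    gcongr
  rw [mul_pow, dist_sq_eq (T x) _ (σ 0), dist_sq_eq _ _ (0 : Fin 2), ← perm_one_sub]
  linarith [hj 0, hj (1 - 0)]

theorem inner_linear (h : IsAxisMap T σ) (x : Plane) (j : Fin 2) (y : Plane) (hy : y (1 - j) = 0) :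
    inner ℝ (T.linear y) (T.linear x) = stretch T j ^ 2 * (y j * x j) := by
  obtain ⟨u, c, hs, hu, hT⟩ := h.exists_coeff
  have hlin : ∀ (x : Plane) (j : Fin 2), T.linear x (σ j) = u j * x j := fun x j => by
    have h1 := T.linearMap_vsub x 0
    simp only [vsub_eq_sub, sub_zero] at h1
    rw [h1, PiLp.sub_apply, hT, hT]
    simp
  rw [PiLp.inner_apply, sum_fin_two_perm _ (σ j), ← perm_one_sub, hlin, hlin, hlin, hlin, hy, hs,
    sq_abs]
  simp
  ring

/-- The coordinate directions are eigenvectors of `T* T`. -/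
theorem adjoint_comp_self_apply (h : IsAxisMap T σ) (x : Plane) (j : Fin 2) :
    (LinearMap.adjoint T.linear ∘ₗ T.linear) x j = stretch T j ^ 2 * x j := by
  have h1 := h.inner_linear x j (EuclideanSpace.single j 1) (by simp [one_sub_ne j])
  rw [← LinearMap.adjoint_inner_right, EuclideanSpace.inner_single_left] at h1
  simpa using h1

theorem singularValues (h : IsAxisMap T σ) {j : Fin 2} (hj : stretch T (1 - j) ≤ stretch T j) :
    α₁ T = stretch T j ∧ α₂ T = stretch T (1 - j) := by
  have hfin : Module.finrank ℝ Plane = 2 := by simp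
  have hsym := T.linear.isSymmetric_adjoint_comp_self
  set ev := hsym.eigenvalues hfin with hev
  have hanti : ev 1 ≤ ev 0 := hsym.eigenvalues_antitone hfin (by decide)
  have hmem : ∀ i, ∃ k, ev k = stretch T i ^ 2 := fun i => by
    refine hsym.exists_eigenvalues_eq hfin (μ := stretch T i ^ 2) ?_
    refine Module.End.hasEigenvalue_of_hasEigenvector (x := EuclideanSpace.single i 1)
      ⟨Module.End.mem_eigenspace_iff.2 ?_, ?_⟩
    · ext k
      rw [h.adjoint_comp_self_apply]
      by_cases hk : k = i
      · subst hk; simp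
      · simp [hk]
    · intro h0
      have := congrArg (fun v : Plane => v i) h0
      simp at this
  have hall : ∀ k, ∃ i, ev k = stretch T i ^ 2 := fun k => by
    obtain ⟨v, hv⟩ := (hsym.hasEigenvalue_eigenvalues hfin k).exists_hasEigenvector
    have hne : ∃ i, v i ≠ 0 := by
      by_contra hcon
      push Not at hcon
      exact hv.2 (by ext i; simpa using hcon i)
    obtain ⟨i, hi⟩ := hne
    refine ⟨i, ?_⟩
    have h1 := congrArg (fun v : Plane => v i) hv.apply_eq_smul
    simp only [h.adjoint_comp_self_apply, PiLp.smul_apply, smul_eq_mul] at h1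
    exact (mul_right_cancel₀ hi h1).symm
  have hsq : stretch T (1 - j) ^ 2 ≤ stretch T j ^ 2 :=
    pow_le_pow_left₀ (h.stretch_pos _).le hj 2
  have h01 : ev 0 = stretch T j ^ 2 ∧ ev 1 = stretch T (1 - j) ^ 2 := by
    obtain ⟨a, ha⟩ := hmem j
    obtain ⟨b, hb⟩ := hmem (1 - j)
    obtain ⟨i0, hi0⟩ := hall 0
    obtain ⟨i1, hi1⟩ := hall 1
    have hj0 := eq_or_eq_one_sub i0 j
    have hj1 := eq_or_eq_one_sub i1 j
    rcases eq_zero_or_eq_one a with rfl | rfl <;>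
      rcases eq_zero_or_eq_one b with rfl | rfl <;> rcases hj0 with rfl | rfl <;>
      rcases hj1 with rfl | rfl <;> constructor <;> linarith
  have hs0 : (T.linear.singularValues 0) ^ 2 = stretch T j ^ 2 := by
    rw [← h01.1]; exact T.linear.sq_singularValues_fin hfin 0
  have hs1 : (T.linear.singularValues 1) ^ 2 = stretch T (1 - j) ^ 2 := by
    rw [← h01.2]; exact T.linear.sq_singularValues_fin hfin 1
  exact ⟨(sq_eq_sq₀ (T.linear.singularValues_nonneg 0) (h.stretch_pos _).le).1 hs0,
    (sq_eq_sq₀ (T.linear.singularValues_nonneg 1) (h.stretch_pos _).le).1 hs1⟩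

end IsAxisMap

/-! ### Coordinate projections and the modified singular value function -/

variable {T U : Plane →ᵃ[ℝ] Plane} {σ τ : Equiv.Perm (Fin 2)}

/-- The coordinate projections `π₁ = proj 0` and `π₂ = proj 1`. -/
def proj (j : Fin 2) (x : Plane) : ℝ := x j

theorem proj_zero : proj 0 = π₁ := rfl

theorem proj_one : proj 1 = π₂ := rfl

theorem continuous_proj (j : Fin 2) : Continuous (proj j) := by unfold proj; fun_prop

/-- The box dimension of the `j`-th projection of `F`. -/
def projDim (F : Set Plane) (j : Fin 2) : ℝ := boxDim (proj j '' F)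

/-- The weight of `T` when the dimension of the `j`-th projection is used. The modified singular
value function is the larger or the smaller of the two weights, depending on whether `t` is at most
or at least `s 0 + s 1`. -/
def weight (s : Fin 2 → ℝ) (t : ℝ) (T : Plane →ᵃ[ℝ] Plane) (j : Fin 2) : ℝ :=
  stretch T j ^ s j * stretch T (1 - j) ^ (t - s j)

namespace IsAxisMap

/-- `i = 1` gives the condition that horizontal lines are mapped to horizontal lines, `i = 0` that
they are mapped to vertical ones. -/
theorem image_horizontal_line_iff (h : IsAxisMap T σ) (i : Fin 2) :
    (∀ c : ℝ, ∃ c' : ℝ, T '' {x | x 1 = c} = {x | x i = c'}) ↔ σ 1 = i := by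
  constructor
  · intro hmap
    by_contra hne
    have hi : σ 0 = i := by
      rcases eq_or_eq_one_sub (σ 0) i with h1 | h1
      · exact h1
      · exact absurd (by rw [show (1 : Fin 2) = 1 - 0 from rfl, perm_one_sub, h1,
          one_sub_one_sub]) hne
    obtain ⟨c', hc'⟩ := hmap 0
    have h1 : T 0 i = c' := by
      have : T 0 ∈ T '' {x : Plane | x 1 = 0} := ⟨0, by simp, rfl⟩
      rw [hc'] at this; exact this
    have h2 : T (EuclideanSpace.single 0 1) i = c' := by
      have : T (EuclideanSpace.single 0 1) ∈ T '' {x : Plane | x 1 = 0} := ⟨_, by simp, rfl⟩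
      rw [hc'] at this; exact this
    have h3 := h.abs_sub (EuclideanSpace.single 0 1) 0 0
    rw [hi, h1, h2] at h3
    have := h.stretch_pos 0
    simp at h3
    linarith
  · rintro rfl c
    obtain ⟨u, d, hu, hT⟩ := h
    refine ⟨u 1 * c + d 1, Set.Subset.antisymm ?_ ?_⟩
    · rintro _ ⟨x, hx, rfl⟩
      simp only [Set.mem_ofPred_eq] at hx ⊢
      rw [hT, hx]
    · intro y hy
      simp only [Set.mem_ofPred_eq] at hy
      refine ⟨WithLp.toLp 2 fun j => (y (σ j) - d j) / u j, ?_, ?_⟩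
      · simp only [Set.mem_ofPred_eq, hy]
        have := hu 1
        field_simp
        ring
      · ext k
        obtain ⟨j, rfl⟩ := σ.surjective k
        rw [hT]
        have := hu j
        field_simp
        ring

theorem diam_proj (h : IsAxisMap T σ) (j : Fin 2) :
    Metric.diam (proj (σ j) '' (T '' unitSquare)) = stretch T j := by
  have hle : ∀ a ∈ proj (σ j) '' (T '' unitSquare), ∀ b ∈ proj (σ j) '' (T '' unitSquare),
      dist a b ≤ stretch T j := by
    rintro _ ⟨_, ⟨x, hx, rfl⟩, rfl⟩ _ ⟨_, ⟨y, hy, rfl⟩, rfl⟩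
    rw [Real.dist_eq, proj, proj, h.abs_sub]
    refine mul_le_of_le_one_right (h.stretch_pos j).le ?_
    have h1 := hx j
    have h2 := hy j
    rw [abs_le]
    constructor <;> linarith [h1.1, h1.2, h2.1, h2.2]
  refine le_antisymm (Metric.diam_le_of_forall_dist_le (h.stretch_pos j).le hle) ?_
  have h0 : (0 : Plane) ∈ unitSquare := fun i => by simp
  have h1 : (EuclideanSpace.single j 1 : Plane) ∈ unitSquare := fun i => by
    by_cases hi : i = j
    · subst hi; simp
    · simp [hi]
  have := Metric.dist_le_diam_of_mem (Metric.isBounded_iff.2 ⟨_, fun a ha b hb => hle a ha b hb⟩)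
    (Set.mem_image_of_mem (proj (σ j)) (Set.mem_image_of_mem T h1))
    (Set.mem_image_of_mem (proj (σ j)) (Set.mem_image_of_mem T h0))
  rw [Real.dist_eq, proj, proj, h.abs_sub] at this
  simpa using this

/-- The projection attached to `T` is the one along which the image of a square is longest, read in
the coordinates of the domain. -/
theorem wordProj_eq (h : IsAxisMap T σ) :
    ∃ j, wordProj T = proj j ∧ stretch T (1 - j) ≤ stretch T j := by
  have hHH : MapsHToH T ↔ σ 1 = 1 := h.image_horizontal_line_iff 1
  have hHV : MapsHToV T ↔ σ 1 = 0 := h.image_horizontal_line_iff 0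
  have h01 : σ 0 = 1 - σ 1 := by rw [← perm_one_sub]; rfl
  unfold wordProj
  rw [hHH, hHV]
  rcases eq_zero_or_eq_one (σ 1) with h1 | h1
  · have hb : base T = stretch T 1 := by rw [← h.diam_proj, h1]; rfl
    have hh : height T = stretch T 0 := by rw [← h.diam_proj, h01, h1]; rfl
    rw [hb, hh, h1]
    by_cases hlt : stretch T 1 < stretch T 0
    · exact ⟨0, by simp [hlt, proj_zero], hlt.le⟩
    · exact ⟨1, by simp [hlt, proj_one], not_lt.1 hlt⟩
  · have hb : base T = stretch T 0 := by rw [← h.diam_proj, h01, h1]; rfl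
    have hh : height T = stretch T 1 := by rw [← h.diam_proj, h1]; rfl
    rw [hb, hh, h1]
    by_cases hlt : stretch T 1 ≤ stretch T 0
    · exact ⟨0, by simp [hlt, proj_zero], hlt⟩
    · exact ⟨1, by simp [hlt, proj_one], (not_le.1 hlt).le⟩

theorem weight_pos (h : IsAxisMap T σ) (s : Fin 2 → ℝ) (t : ℝ) (j : Fin 2) :
    0 < weight s t T j :=
  mul_pos (Real.rpow_pos_of_pos (h.stretch_pos _) _) (Real.rpow_pos_of_pos (h.stretch_pos _) _)

theorem modSV_eq (h : IsAxisMap T σ) (F : Set Plane) (t : ℝ) :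
    ∃ j, α₁ T = stretch T j ∧ α₂ T = stretch T (1 - j) ∧ wordProj T = proj j ∧
      stretch T (1 - j) ≤ stretch T j ∧ modSV F t T = weight (projDim F) t T j := by
  obtain ⟨j, hj, hle⟩ := h.wordProj_eq
  obtain ⟨h1, h2⟩ := h.singularValues hle
  exact ⟨j, h1, h2, hj, hle, by rw [modSV, h1, h2, hj]; rfl⟩

/-- Each weight is multiplicative along a composition if the dimensions of the projections agree
whenever the inner map exchanges the axes. -/
theorem weight_mul (hT : IsAxisMap T σ) (hU : IsAxisMap U τ) {s : Fin 2 → ℝ} {j : Fin 2}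
    (hs : s (τ j) = s j) (t : ℝ) :
    weight s t (T * U) j = weight s t T (τ j) * weight s t U j := by
  rw [weight, weight, weight, hT.stretch_mul hU, hT.stretch_mul hU, hs, perm_one_sub,
    Real.mul_rpow (hT.stretch_pos _).le (hU.stretch_pos _).le,
    Real.mul_rpow (hT.stretch_pos _).le (hU.stretch_pos _).le]
  ring

/-- The first two factors together do not change when `j` is replaced by `1 - j`, so the last one
decides which of the two weights is larger. -/
theorem weight_eq_mul_rpow (h : IsAxisMap T σ) (s : Fin 2 → ℝ) (t : ℝ) (j : Fin 2) :
    weight s t T j = stretch T j ^ (t - s (1 - j)) * stretch T (1 - j) ^ (t - s j) *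
      stretch T j ^ (s 0 + s 1 - t) := by
  have : s 0 + s 1 = s j + s (1 - j) := by rw [← sum_fin_two_perm s j, Fin.sum_univ_two]
  rw [weight, this, mul_right_comm, ← Real.rpow_add (h.stretch_pos j)]
  congr 2
  ring

theorem weight_le_weight (h : IsAxisMap T σ) {s : Fin 2 → ℝ} {t : ℝ} {j : Fin 2}
    (hle : stretch T (1 - j) ≤ stretch T j) (ht : t ≤ s 0 + s 1) (i : Fin 2) :
    weight s t T i ≤ weight s t T j := by
  rcases eq_or_eq_one_sub i j with rfl | rfl
  · exact le_rfl
  · rw [h.weight_eq_mul_rpow s t j, h.weight_eq_mul_rpow s t (1 - j), one_sub_one_sub,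
      mul_comm (stretch T (1 - j) ^ (t - s j))]
    have p1 := Real.rpow_pos_of_pos (h.stretch_pos j) (t - s (1 - j))
    have p2 := Real.rpow_pos_of_pos (h.stretch_pos (1 - j)) (t - s j)
    have := Real.rpow_le_rpow (h.stretch_pos _).le hle (sub_nonneg.2 ht)
    gcongr

theorem weight_ge_weight (h : IsAxisMap T σ) {s : Fin 2 → ℝ} {t : ℝ} {j : Fin 2}
    (hle : stretch T (1 - j) ≤ stretch T j) (ht : s 0 + s 1 ≤ t) (i : Fin 2) :
    weight s t T j ≤ weight s t T i := by
  rcases eq_or_eq_one_sub i j with rfl | rfl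
  · exact le_rfl
  · rw [h.weight_eq_mul_rpow s t j, h.weight_eq_mul_rpow s t (1 - j), one_sub_one_sub,
      mul_comm (stretch T (1 - j) ^ (t - s j))]
    have p1 := Real.rpow_pos_of_pos (h.stretch_pos j) (t - s (1 - j))
    have p2 := Real.rpow_pos_of_pos (h.stretch_pos (1 - j)) (t - s j)
    have := Real.rpow_le_rpow_of_nonpos (h.stretch_pos _) hle (sub_nonpos.2 ht)
    gcongr

theorem modSV_mul_le (hT : IsAxisMap T σ) (hU : IsAxisMap U τ) {F : Set Plane}
    (hs : ∀ j, projDim F (τ j) = projDim F j) {t : ℝ} (ht : t ≤ projDim F 0 + projDim F 1) :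
    modSV F t (T * U) ≤ modSV F t T * modSV F t U := by
  obtain ⟨i, -, -, -, -, hi⟩ := (hT.mul hU).modSV_eq F t
  obtain ⟨j, -, -, -, hj, hTj⟩ := hT.modSV_eq F t
  obtain ⟨k, -, -, -, hk, hUk⟩ := hU.modSV_eq F t
  rw [hi, hTj, hUk, hT.weight_mul hU (hs i)]
  exact mul_le_mul (hT.weight_le_weight hj ht _) (hU.weight_le_weight hk ht _)
    (hU.weight_pos _ _ _).le (hT.weight_pos _ _ _).le

theorem le_modSV_mul (hT : IsAxisMap T σ) (hU : IsAxisMap U τ) {F : Set Plane}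
    (hs : ∀ j, projDim F (τ j) = projDim F j) {t : ℝ} (ht : projDim F 0 + projDim F 1 ≤ t) :
    modSV F t T * modSV F t U ≤ modSV F t (T * U) := by
  obtain ⟨i, -, -, -, -, hi⟩ := (hT.mul hU).modSV_eq F t
  obtain ⟨j, -, -, -, hj, hTj⟩ := hT.modSV_eq F t
  obtain ⟨k, -, -, -, hk, hUk⟩ := hU.modSV_eq F t
  rw [hi, hTj, hUk, hT.weight_mul hU (hs i)]
  exact mul_le_mul (hT.weight_ge_weight hj ht _) (hU.weight_ge_weight hk ht _)
    (hU.weight_pos _ _ _).le (hT.weight_pos _ _ _).le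

theorem modSV_pos (hT : IsAxisMap T σ) (F : Set Plane) (t : ℝ) : 0 < modSV F t T := by
  obtain ⟨i, -, -, -, -, hi⟩ := hT.modSV_eq F t
  rw [hi]; exact hT.weight_pos _ _ _

theorem modSV_one (F : Set Plane) (t : ℝ) : modSV F t 1 = 1 := by
  obtain ⟨i, -, -, -, -, hi⟩ := IsAxisMap.one.modSV_eq F t
  rw [hi, weight, stretch_one, stretch_one]
  simp

end IsAxisMap

/-- A linear isometry preserving the square `[-1,1]²` permutes the coordinate axes, because each row
of its matrix has `ℓ¹`-norm at most `1` while each column has Euclidean norm `1`. -/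
theorem IsBoxLikeMap.isAxisMap {S : Plane →ᵃ[ℝ] Plane} (hS : IsBoxLikeMap S) :
    ∃ σ, IsAxisMap S σ ∧ ∀ j, stretch S j < 1 := by
  obtain ⟨a, b, L, t, ha, hb, hL, hS⟩ := hS
  have hsq : ∀ x ∈ bigSquare, ∀ i, L x i ∈ Set.Icc (-1 : ℝ) 1 := fun x hx => by
    have : L x ∈ L '' bigSquare := ⟨x, hx, rfl⟩
    rw [hL] at this; exact this
  set e : Fin 2 → Plane := fun j => EuclideanSpace.single j 1 with he
  have hx : ∀ x : Plane, x = x 0 • e 0 + x 1 • e 1 := fun x => by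
    ext i
    fin_cases i <;> simp [he]
  have hLx : ∀ (x : Plane) i, L x i = x 0 * L (e 0) i + x 1 * L (e 1) i := fun x i => by
    conv_lhs => rw [hx x]
    simp
  have hrow : ∀ i, |L (e 0) i| + |L (e 1) i| ≤ 1 := fun i => by
    have h1 := hsq (!₂[1, 1]) (fun i => by fin_cases i <;> simp) i
    have h2 := hsq (!₂[1, -1]) (fun i => by fin_cases i <;> simp) i
    rw [hLx] at h1 h2
    simp at h1 h2
    rcases abs_cases (L (e 0) i) with ⟨h3, -⟩ | ⟨h3, -⟩ <;>
      rcases abs_cases (L (e 1) i) with ⟨h4, -⟩ | ⟨h4, -⟩ <;> rw [h3, h4] <;> linarith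
  have hcol : ∀ j, |L (e j) 0| ^ 2 + |L (e j) 1| ^ 2 = 1 := fun j => by
    have h1 : ‖L (e j)‖ ^ 2 = 1 := by rw [L.norm_map]; simp [he]
    rw [EuclideanSpace.norm_sq_eq, Fin.sum_univ_two] at h1
    simpa using h1
  have hr0 := hrow 0
  have hr1 := hrow 1
  have hc0 := hcol 0
  have hc1 := hcol 1
  have hSx : ∀ x, S x 0 = a * L x 0 + t 0 ∧ S x 1 = b * L x 1 + t 1 := fun x => by
    rw [hS]; simp
  suffices h : ∃ σ : Equiv.Perm (Fin 2), ∃ u c : Fin 2 → ℝ, (∀ j, u j ≠ 0) ∧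
      (∀ x j, S x (σ j) = u j * x j + c j) ∧ ∀ j, |u j| < 1 by
    obtain ⟨σ, u, c, hu, hT, hlt⟩ := h
    have hax : IsAxisMap S σ := ⟨u, c, hu, hT⟩
    refine ⟨σ, hax, fun j => ?_⟩
    have h1 := hax.abs_sub (EuclideanSpace.single j 1) 0 j
    rw [hT, hT] at h1
    simp at h1
    rw [← h1]; exact hlt j
  have key : ∀ p q r s : ℝ, 0 ≤ p → 0 ≤ q → 0 ≤ r → 0 ≤ s → p + q ≤ 1 → r + s ≤ 1 →
      p ^ 2 + r ^ 2 = 1 → q ^ 2 + s ^ 2 = 1 → (p = 1 ∧ q = 0 ∧ r = 0 ∧ s = 1) ∨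
        (p = 0 ∧ q = 1 ∧ r = 1 ∧ s = 0) := by
    intro p q r s hp hq hr hs h1 h2 h3 h4
    have h5 : 1 ≤ p + r := by nlinarith
    have h6 : 1 ≤ q + s := by nlinarith
    have h7 : p + r = 1 := by linarith
    have hpr : p * r = 0 := by nlinarith
    rcases mul_eq_zero.1 hpr with h | h
    · right
      subst h
      have hr1 : r = 1 := by nlinarith
      have hs0 : s = 0 := by linarith
      subst hs0
      have : q = 1 := by nlinarith
      exact ⟨rfl, this, hr1, rfl⟩
    · left
      subst h
      have hp1 : p = 1 := by nlinarith
      have hq0 : q = 0 := by linarith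
      subst hq0
      have : s = 1 := by nlinarith
      exact ⟨hp1, rfl, rfl, this⟩
  have habs1 : |a| < 1 := by rw [abs_of_pos ha.1]; exact ha.2
  have habs2 : |b| < 1 := by rw [abs_of_pos hb.1]; exact hb.2
  rcases key _ _ _ _ (abs_nonneg _) (abs_nonneg _) (abs_nonneg _) (abs_nonneg _) hr0 hr1 hc0 hc1
    with ⟨h00, h10, h01, h11⟩ | ⟨h00, h10, h01, h11⟩
  · rw [abs_eq_zero] at h10 h01
    refine ⟨1, ![a * L (e 0) 0, b * L (e 1) 1], ![t 0, t 1], ?_, ?_, ?_⟩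
    · rw [Fin.forall_fin_two]
      constructor
      · exact mul_ne_zero ha.1.ne' (abs_pos.1 (by rw [h00]; exact one_pos))
      · exact mul_ne_zero hb.1.ne' (abs_pos.1 (by rw [h11]; exact one_pos))
    · intro x
      rw [Fin.forall_fin_two]
      refine ⟨?_, ?_⟩
      · change S x 0 = a * L (e 0) 0 * x 0 + t 0
        rw [(hSx x).1, hLx x 0, h10]; ring
      · change S x 1 = b * L (e 1) 1 * x 1 + t 1
        rw [(hSx x).2, hLx x 1, h01]; ring
    · rw [Fin.forall_fin_two]
      simp [abs_mul, h00, h11, habs1, habs2]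
  · rw [abs_eq_zero] at h00 h11
    refine ⟨Equiv.swap 0 1, ![b * L (e 0) 1, a * L (e 1) 0], ![t 1, t 0], ?_, ?_, ?_⟩
    · rw [Fin.forall_fin_two]
      constructor
      · exact mul_ne_zero hb.1.ne' (abs_pos.1 (by rw [h01]; exact one_pos))
      · exact mul_ne_zero ha.1.ne' (abs_pos.1 (by rw [h10]; exact one_pos))
    · intro x
      rw [Fin.forall_fin_two]
      refine ⟨?_, ?_⟩
      · change S x 1 = b * L (e 0) 1 * x 0 + t 1
        rw [(hSx x).2, hLx x 1, h11]; ring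
      · change S x 0 = a * L (e 1) 0 * x 1 + t 0
        rw [(hSx x).1, hLx x 0, h00]; ring
    · rw [Fin.forall_fin_two]
      simp [abs_mul, h01, h10, habs1, habs2]

/-! ### Words, cylinders and the projections of the attractor -/

namespace IsAxisMap

variable {T U : Plane →ᵃ[ℝ] Plane} {σ τ : Equiv.Perm (Fin 2)}

theorem exists_alpha (h : IsAxisMap T σ) :
    ∃ j, α₁ T = stretch T j ∧ α₂ T = stretch T (1 - j) ∧ stretch T (1 - j) ≤ stretch T j := by
  obtain ⟨j, h1, h2, -, h3, -⟩ := h.modSV_eq ∅ 0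
  exact ⟨j, h1, h2, h3⟩

theorem alpha₂_le (h : IsAxisMap T σ) (j : Fin 2) : α₂ T ≤ stretch T j := by
  obtain ⟨k, h1, h2, h3⟩ := h.exists_alpha
  rw [h2]
  rcases eq_or_eq_one_sub j k with rfl | rfl
  exacts [h3, le_rfl]

theorem le_alpha₁ (h : IsAxisMap T σ) (j : Fin 2) : stretch T j ≤ α₁ T := by
  obtain ⟨k, h1, h2, h3⟩ := h.exists_alpha
  rw [h1]
  rcases eq_or_eq_one_sub j k with rfl | rfl
  exacts [le_rfl, h3]

theorem alpha₂_pos (h : IsAxisMap T σ) : 0 < α₂ T := by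
  obtain ⟨k, h1, h2, h3⟩ := h.exists_alpha
  rw [h2]; exact h.stretch_pos _

theorem alpha₂_le_alpha₁ (h : IsAxisMap T σ) : α₂ T ≤ α₁ T := (h.alpha₂_le 0).trans (h.le_alpha₁ 0)

theorem alpha₂_mul_le (hT : IsAxisMap T σ) (hU : IsAxisMap U τ) {M : ℝ}
    (hM : ∀ j, stretch U j ≤ M) : α₂ (T * U) ≤ α₂ T * M := by
  obtain ⟨k, h1, h2, h3⟩ := hT.exists_alpha
  refine ((hT.mul hU).alpha₂_le (τ.symm (1 - k))).trans ?_
  rw [hT.stretch_mul hU, Equiv.apply_symm_apply, h2]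
  exact mul_le_mul_of_nonneg_left (hM _) (hT.stretch_pos _).le

theorem le_alpha₂_mul (hT : IsAxisMap T σ) (hU : IsAxisMap U τ) {m : ℝ} (hm0 : 0 ≤ m)
    (hm : ∀ j, m ≤ stretch U j) : α₂ T * m ≤ α₂ (T * U) := by
  obtain ⟨k, h1, h2, h3⟩ := (hT.mul hU).exists_alpha
  rw [h2, hT.stretch_mul hU]
  exact mul_le_mul (hT.alpha₂_le _) (hm _) hm0 (hT.stretch_pos _).le

theorem alpha₁_mul_le (hT : IsAxisMap T σ) (hU : IsAxisMap U τ) {M : ℝ}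
    (hM : ∀ j, stretch U j ≤ M) : α₁ (T * U) ≤ α₁ T * M := by
  obtain ⟨k, h1, h2, h3⟩ := (hT.mul hU).exists_alpha
  rw [h1, hT.stretch_mul hU]
  exact mul_le_mul (hT.le_alpha₁ _) (hM _) (hU.stretch_pos _).le
    ((hT.stretch_pos 0).le.trans (hT.le_alpha₁ _))

end IsAxisMap

/-- The composition of the maps `S i` along the letters of a word. -/
def listMap {ι : Type*} (S : ι → Plane →ᵃ[ℝ] Plane) (w : List ι) : Plane →ᵃ[ℝ] Plane :=
  (w.map S).prod

/-- A system of axis-preserving maps with attractor `F` whose stretches all lie in `[m, M]`. -/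
structure BoxLikeSystem {ι : Type*} (S : ι → Plane →ᵃ[ℝ] Plane) (F : Set Plane) (m M : ℝ) :
    Prop where
  axis : ∀ i, ∃ σ, IsAxisMap (S i) σ
  m_pos : 0 < m
  M_lt : M < 1
  le_stretch : ∀ i j, m ≤ stretch (S i) j
  stretch_le : ∀ i j, stretch (S i) j ≤ M
  attractor : IsAttractor S F

theorem exists_boxLikeSystem {ι : Type*} [Fintype ι] {S : ι → Plane →ᵃ[ℝ] Plane} {F : Set Plane}
    (hS : ∀ i, IsBoxLikeMap (S i)) (hF : IsAttractor S F) : ∃ m M, BoxLikeSystem S F m M := by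
  have hne : Nonempty ι := by
    obtain ⟨x, hx⟩ := hF.1
    rw [hF.2.2] at hx
    obtain ⟨i, -⟩ := Set.mem_iUnion.1 hx
    exact ⟨i⟩
  choose σ hσ hlt using fun i => (hS i).isAxisMap
  obtain ⟨p, hp⟩ := Finite.exists_min fun q : ι × Fin 2 => stretch (S q.1) q.2
  obtain ⟨P, hP⟩ := Finite.exists_max fun q : ι × Fin 2 => stretch (S q.1) q.2
  exact ⟨stretch (S p.1) p.2, stretch (S P.1) P.2, fun i => ⟨σ i, hσ i⟩, (hσ p.1).stretch_pos _,
    hlt _ _, fun i j => hp (i, j), fun i j => hP (i, j), hF⟩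

section ListMap

variable {ι : Type*} (S : ι → Plane →ᵃ[ℝ] Plane)

@[simp] theorem listMap_nil : listMap S [] = 1 := rfl

theorem listMap_append (v w : List ι) : listMap S (v ++ w) = listMap S v * listMap S w := by
  simp [listMap]

theorem listMap_concat (w : List ι) (i : ι) : listMap S (w ++ [i]) = listMap S w * S i := by
  simp [listMap]

end ListMap

theorem exists_polynomial_bound {E : Set ℝ} (hE : Bornology.IsBounded E) :
    ∃ C > 0, ∃ D : ℝ, ∀ δ : ℝ, 0 < δ → δ ≤ 1 → (coverNumber δ E : ℝ) ≤ C * δ ^ (-D) := by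
  obtain ⟨R, hR, hER⟩ := hE.subset_ball_lt 0 0
  refine ⟨2 * R + 1, by positivity, 1, fun δ hδ hδ1 => ?_⟩
  have h := coverNumber_le_card (δ := δ) (A := E) (Finset.range (⌊2 * R / δ⌋₊ + 1))
    (fun k => Set.Icc (-R + k * δ) (-R + (k + 1) * δ)) (fun k _ => ?_) ?_
  · have h' : (coverNumber δ E : ℝ) ≤ ⌊2 * R / δ⌋₊ + 1 := by
      rw [Finset.card_range] at h; exact_mod_cast h
    have h2 : (⌊2 * R / δ⌋₊ : ℝ) ≤ 2 * R / δ := Nat.floor_le (by positivity)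
    rw [Real.rpow_neg_one]
    have h3 : 1 ≤ δ⁻¹ := (one_le_inv₀ hδ).2 hδ1
    rw [div_eq_mul_inv (2 * R)] at h2 h'
    nlinarith
  · refine Metric.ediam_le_of_forall_dist_le fun a ha b hb => ?_
    rw [Real.dist_eq, abs_le]
    constructor <;> linarith [ha.1, ha.2, hb.1, hb.2]
  · intro x hx
    have hxR := hER hx
    rw [Metric.mem_ball, Real.dist_eq, sub_zero, abs_lt] at hxR
    have h0 : 0 ≤ (x + R) / δ := div_nonneg (by linarith) hδ.le
    refine Set.mem_iUnion₂.2 ⟨⌊(x + R) / δ⌋₊, ?_, ?_, ?_⟩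
    · rw [Finset.mem_range, Nat.lt_succ_iff]
      exact Nat.floor_le_floor (by gcongr; linarith)
    · have := Nat.floor_le h0
      rw [le_div_iff₀ hδ] at this
      linarith
    · have := (Nat.lt_floor_add_one ((x + R) / δ)).le
      rw [div_le_iff₀ hδ] at this
      linarith

namespace BoxLikeSystem

variable {ι : Type*} {S : ι → Plane →ᵃ[ℝ] Plane} {F : Set Plane} {m M : ℝ}

theorem nonempty_index (h : BoxLikeSystem S F m M) : Nonempty ι := by
  obtain ⟨x, hx⟩ := h.attractor.1
  rw [h.attractor.2.2] at hx
  obtain ⟨i, -⟩ := Set.mem_iUnion.1 hx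
  exact ⟨i⟩

theorem m_le_M (h : BoxLikeSystem S F m M) : m ≤ M := by
  obtain ⟨i⟩ := h.nonempty_index
  exact (h.le_stretch i 0).trans (h.stretch_le i 0)

theorem M_pos (h : BoxLikeSystem S F m M) : 0 < M := h.m_pos.trans_le h.m_le_M

theorem m_lt (h : BoxLikeSystem S F m M) : m < 1 := h.m_le_M.trans_lt h.M_lt

theorem isCompact (h : BoxLikeSystem S F m M) : IsCompact F := h.attractor.2.1

theorem nonempty (h : BoxLikeSystem S F m M) : F.Nonempty := h.attractor.1

theorem exists_axis (h : BoxLikeSystem S F m M) (w : List ι) :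
    ∃ σ, IsAxisMap (listMap S w) σ := by
  induction w with
  | nil => exact ⟨1, IsAxisMap.one⟩
  | cons i w ih =>
    obtain ⟨σ, hσ⟩ := ih
    obtain ⟨τ, hτ⟩ := h.axis i
    exact ⟨τ * σ, by simpa [listMap] using hτ.mul hσ⟩

theorem totallyBounded_image (h : BoxLikeSystem S F m M) (T : Plane →ᵃ[ℝ] Plane) :
    TotallyBounded (T '' F) :=
  (h.isCompact.image T.continuous_of_finiteDimensional).totallyBounded

theorem totallyBounded_proj (h : BoxLikeSystem S F m M) (j : Fin 2) :
    TotallyBounded (proj j '' F) :=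
  (h.isCompact.image (continuous_proj j)).totallyBounded

theorem maps_listMap (h : BoxLikeSystem S F m M) (w : List ι) {x : Plane} (hx : x ∈ F) :
    listMap S w x ∈ F := by
  induction w with
  | nil => exact hx
  | cons i w ih =>
    rw [h.attractor.2.2]
    refine Set.mem_iUnion.2 ⟨i, listMap S w x, ih, ?_⟩
    simp [listMap]

theorem image_subset (h : BoxLikeSystem S F m M) (w : List ι) : listMap S w '' F ⊆ F := by
  rintro _ ⟨x, hx, rfl⟩
  exact h.maps_listMap w hx

theorem exists_mem_concat (h : BoxLikeSystem S F m M) {w : List ι} {x : Plane}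
    (hx : x ∈ listMap S w '' F) : ∃ i, x ∈ listMap S (w ++ [i]) '' F := by
  obtain ⟨y, hy, rfl⟩ := hx
  rw [h.attractor.2.2] at hy
  obtain ⟨i, z, hz, rfl⟩ := Set.mem_iUnion.1 hy
  exact ⟨i, z, hz, by rw [listMap_concat]; rfl⟩

/-- If a size `q` of words shrinks by a factor in `[m, M]` with each letter, then every point lies
in a cylinder whose word has a prescribed size, up to a factor `m`. -/
theorem exists_word_size (h : BoxLikeSystem S F m M) {q : List ι → ℝ} (hq1 : q [] = 1)
    (hqm : ∀ w i, q w * m ≤ q (w ++ [i])) (hqM : ∀ w i, q (w ++ [i]) ≤ q w * M) {x : Plane}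
    (hx : x ∈ F) {ρ : ℝ} (hρ : 0 < ρ) (hρ1 : ρ ≤ 1) :
    ∃ w, x ∈ listMap S w '' F ∧ ρ * m ≤ q w ∧ q w ≤ ρ := by
  have key : ∀ (n : ℕ) (w : List ι), x ∈ listMap S w '' F → ρ * m ≤ q w → q w * M ^ n ≤ ρ →
      ∃ w, x ∈ listMap S w '' F ∧ ρ * m ≤ q w ∧ q w ≤ ρ := by
    intro n
    induction n with
    | zero => exact fun w h1 h2 h3 => ⟨w, h1, h2, by simpa using h3⟩
    | succ n ih =>
      intro w h1 h2 h3
      rcases le_or_gt (q w) ρ with hle | hlt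
      · exact ⟨w, h1, h2, hle⟩
      · obtain ⟨i, hi⟩ := h.exists_mem_concat h1
        refine ih (w ++ [i]) hi ?_ ?_
        · exact (mul_le_mul_of_nonneg_right hlt.le h.m_pos.le).trans (hqm w i)
        · refine (mul_le_mul_of_nonneg_right (hqM w i) (pow_nonneg h.M_pos.le n)).trans ?_
          rwa [mul_assoc, ← pow_succ']
  obtain ⟨n, hn⟩ := exists_pow_lt_of_lt_one hρ h.M_lt
  refine key n [] ⟨x, hx, rfl⟩ ?_ ?_
  · rw [hq1]
    exact mul_le_one₀ hρ1 h.m_pos.le h.m_lt.le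
  · rw [hq1, one_mul]; exact hn.le

theorem stretch_concat (w : List ι) (i : ι) {σ : Equiv.Perm (Fin 2)}
    (hσ : IsAxisMap (listMap S w) σ) {τ : Equiv.Perm (Fin 2)} (hτ : IsAxisMap (S i) τ)
    (j : Fin 2) :
    stretch (listMap S (w ++ [i])) ((σ * τ).symm j) =
      stretch (listMap S w) (σ.symm j) * stretch (S i) (τ.symm (σ.symm j)) := by
  rw [listMap_concat, hσ.stretch_mul hτ]
  congr 2
  simp [Equiv.Perm.mul_def]

/-- The projections of the attractor contain small copies of themselves: a cylinder of the right
size is projected to a copy of one of the two projections, and if this is the other one, then a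
further letter exchanging the axes is appended. -/
theorem hasSmallCopies_proj (h : BoxLikeSystem S F m M) (j : Fin 2) :
    ∃ c, 0 < c ∧ c ≤ 1 ∧ HasSmallCopies c (proj j '' F) := by
  obtain ⟨R, hR⟩ := Metric.isBounded_iff.1 h.isCompact.isBounded
  set R' := max R 1 with hR'
  have hR1 : 1 ≤ R' := le_max_right _ _
  have hR0 : 0 < R' := by positivity
  choose τ hτ using h.axis
  choose σ hσ using h.exists_axis
  have hm := h.m_pos
  have hm1 := h.m_lt
  have hdiv : m ^ 2 / R' ≤ 1 := by
    rw [div_le_one hR0]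
    exact (pow_le_one₀ hm.le hm1.le).trans hR1
  refine ⟨m ^ 2 / R', by positivity, hdiv, ?_⟩
  rintro _ ⟨z, hz, rfl⟩ δ hδ hδ1
  have hσc : ∀ w i, σ (w ++ [i]) = σ w * τ i := fun w i =>
    (hσ _).unique (by rw [listMap_concat]; exact (hσ w).mul (hτ i))
  obtain ⟨w, hzw, hw1, hw2⟩ := h.exists_word_size
    (q := fun w => stretch (listMap S w) ((σ w).symm j)) (IsAxisMap.stretch_one _)
    (fun w i => by
      rw [hσc, stretch_concat w i (hσ w) (hτ i)]
      exact mul_le_mul_of_nonneg_left (h.le_stretch _ _) ((hσ w).stretch_pos _).le)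
    (fun w i => by
      rw [hσc, stretch_concat w i (hσ w) (hτ i)]
      exact mul_le_mul_of_nonneg_left (h.stretch_le _ _) ((hσ w).stretch_pos _).le)
    hz (ρ := δ / R') (by positivity) ((div_le_one hR0).2 (hδ1.trans hR1))
  -- Extend the word, if necessary, so that the `j`-th axis is mapped to itself.
  obtain ⟨v, ρ, hρ, hvj, hv⟩ : ∃ v, ∃ ρ, IsAxisMap (listMap S (w ++ v)) ρ ∧ ρ j = j ∧
      δ / R' * m ^ 2 ≤ stretch (listMap S (w ++ v)) j := by
    by_cases hj : σ w j = j
    · refine ⟨[], σ w, by simpa using hσ w, hj, ?_⟩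
      simp only [List.append_nil]
      have : (σ w).symm j = j := by rw [Equiv.symm_apply_eq, hj]
      rw [this] at hw1
      refine le_trans ?_ hw1
      have : m ^ 2 ≤ m := by nlinarith
      gcongr
    · have hex : ∃ i, τ i j ≠ j := by
        by_contra hcon
        push Not at hcon
        apply hj
        have hall : ∀ w : List ι, ∃ ρ, IsAxisMap (listMap S w) ρ ∧ ρ j = j := fun w => by
          induction w with
          | nil => exact ⟨1, IsAxisMap.one, rfl⟩
          | cons i w ih =>
            obtain ⟨ρ, h1, h2⟩ := ih
            refine ⟨τ i * ρ, by simpa [listMap] using (hτ i).mul h1, ?_⟩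
            rw [Equiv.Perm.mul_apply, h2, hcon]
        obtain ⟨ρ, h1, h2⟩ := hall w
        rwa [(hσ w).unique h1]
      obtain ⟨i, hi⟩ := hex
      have h1 : σ w j = 1 - j := (eq_or_eq_one_sub _ _).resolve_left hj
      have h2 : τ i j = 1 - j := (eq_or_eq_one_sub _ _).resolve_left hi
      refine ⟨[i], σ w * τ i, by rw [listMap_concat]; exact (hσ w).mul (hτ i), ?_, ?_⟩
      · rw [Equiv.Perm.mul_apply, h2, perm_one_sub, h1, one_sub_one_sub]
      · rw [listMap_concat, (hσ w).stretch_mul (hτ i)]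
        have h3 : (σ w).symm j = τ i j := by
          rw [Equiv.symm_apply_eq, h2, perm_one_sub, h1, one_sub_one_sub]
        rw [h3] at hw1
        calc δ / R' * m ^ 2 = δ / R' * m * m := by ring
          _ ≤ _ := mul_le_mul hw1 (h.le_stretch _ _) hm.le ((hσ w).stretch_pos _).le
  obtain ⟨u, d, hu, -, hT⟩ := hρ.exists_coeff
  have hTj : ∀ x : Plane, listMap S (w ++ v) x j = u j * x j + d j := fun x => by
    rw [← hT, hvj]
  refine ⟨fun y => u j * y + d j, ?_, ?_⟩
  · rintro _ ⟨y, hy, rfl⟩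
    beta_reduce
    refine ⟨⟨_, h.maps_listMap (w ++ v) hy, hTj y⟩, ?_⟩
    obtain ⟨b, hb, rfl⟩ := hzw
    have h1 : u j * proj j y + d j = listMap S w (listMap S v y) j := by
      rw [proj, ← hTj, listMap_append]; rfl
    have h2 := (hσ w).abs_sub (listMap S v y) b ((σ w).symm j)
    rw [Equiv.apply_symm_apply] at h2
    rw [Real.dist_eq, h1, proj, h2]
    have h3 := (abs_coord_sub_le (listMap S v y) b ((σ w).symm j)).trans
      ((hR (h.maps_listMap v hy) hb).trans (le_max_left R 1))
    calc _ ≤ δ / R' * R' := mul_le_mul hw2 h3 (abs_nonneg _) (by positivity)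
      _ = δ := by field_simp
  · rintro y - z' -
    have : u j * y + d j - (u j * z' + d j) = u j * (y - z') := by ring
    rw [Real.dist_eq, Real.dist_eq, this, abs_mul, ← hu]
    refine mul_le_mul_of_nonneg_right (le_trans (le_of_eq ?_) hv) (abs_nonneg _)
    ring

theorem hasPowerGrowth_proj (h : BoxLikeSystem S F m M) (j : Fin 2) :
    HasPowerGrowth (proj j '' F) (projDim F j) := by
  obtain ⟨c, hc, hc1, hcopy⟩ := h.hasSmallCopies_proj j
  have hne : (proj j '' F).Nonempty := h.nonempty.image _
  obtain ⟨d, hd⟩ := hcopy.exists_hasPowerGrowth hc hc1 (h.totallyBounded_proj j) hne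
    (exists_polynomial_bound (h.isCompact.image (continuous_proj j)).isBounded)
  rw [projDim, (hd.hasBoxDim (h.totallyBounded_proj j) hne).boxDim_eq]
  exact hd

theorem hasBoxDim_proj (h : BoxLikeSystem S F m M) (j : Fin 2) :
    HasBoxDim (proj j '' F) (projDim F j) :=
  (h.hasPowerGrowth_proj j).hasBoxDim (h.totallyBounded_proj j) (h.nonempty.image _)

/-- If some composition of the maps exchanges the axes, then the two projections contain similar
copies of each other and so have equal dimensions. -/
theorem projDim_perm (h : BoxLikeSystem S F m M) {w : List ι} {σ : Equiv.Perm (Fin 2)}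
    (hσ : IsAxisMap (listMap S w) σ) (j : Fin 2) : projDim F (σ j) = projDim F j := by
  have key : ∀ j, projDim F j ≤ projDim F (σ j) := fun j => by
    obtain ⟨C, hC, hb⟩ := (h.hasPowerGrowth_proj (σ j)).upper
    have hp := hσ.stretch_pos j
    set p := stretch (listMap S w) j with hpdef
    have hle : ∀ δ : ℝ, 0 < δ → coverNumber δ (proj j '' F) ≤
        coverNumber (p * δ) (proj (σ j) '' F) := fun δ hδ => by
      have h1 := coverNumber_image_le (g := proj j) (h := fun x => proj (σ j) (listMap S w x))
        (B := F) (K := p⁻¹) (L := 0) (δ := p * δ) (by positivity) (by positivity)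
        ((h.totallyBounded_proj (σ j)).subset ?_) ?_
      · rw [show p⁻¹ * (p * δ) + 0 = δ by field_simp; simp] at h1
        refine h1.trans (coverNumber_mono (by positivity) le_rfl ?_ (h.totallyBounded_proj _))
        rintro _ ⟨x, hx, rfl⟩
        exact ⟨_, h.maps_listMap w hx, rfl⟩
      · rintro _ ⟨x, hx, rfl⟩
        exact ⟨_, h.maps_listMap w hx, rfl⟩
      · intro x _ y _
        simp only [Real.dist_eq, proj]
        rw [hσ.abs_sub, ← hpdef]
        field_simp
        simp
    have hup : upperBoxDim (proj j '' F) ≤ (projDim F (σ j) : ℝ) := by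
      refine upperBoxDim_le (C := C * p ^ (-projDim F (σ j))) (by positivity) ?_ ?_
      · filter_upwards [eventually_small one_pos] with δ hδ
        exact coverNumber_pos hδ.1 (h.totallyBounded_proj j) (h.nonempty.image _)
      · filter_upwards [eventually_small one_pos, eventually_small (inv_pos.2 hp)] with δ hδ hδ'
        have h1 : (coverNumber δ (proj j '' F) : ℝ) ≤ coverNumber (p * δ) (proj (σ j) '' F) := by
          exact_mod_cast hle δ hδ.1
        refine h1.trans ((hb (p * δ) (mul_pos hp hδ.1) ?_).trans_eq ?_)
        · rw [← mul_inv_cancel₀ hp.ne']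
          gcongr
          exact hδ'.2.le
        · rw [Real.mul_rpow hp.le hδ.1.le]
          ring
    rw [(h.hasBoxDim_proj j).2] at hup
    exact_mod_cast hup
  have hinv : σ (σ j) = j := perm_perm σ j
  have := key (σ j)
  rw [hinv] at this
  exact le_antisymm this (key j)

end BoxLikeSystem

/-! ### Sums over levels and cuts of the tree of words -/

section Tree

theorem eq_of_concat_prefix {ι : Type*} {w v : List ι} {i j : ι} (hi : w ++ [i] <+: v)
    (hj : w ++ [j] <+: v) :
    i = j := by
  have := (List.prefix_of_prefix_length_le hi hj (by simp)).eq_of_length (by simp)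
  simpa using this

variable {ι : Type*} [Fintype ι]

/-- The sum of `f` over the extensions of a word by `k` letters. -/
def levelSum (f : List ι → ℝ) : ℕ → List ι → ℝ
  | 0, w => f w
  | k + 1, w => ∑ i, levelSum f k (w ++ [i])

open Classical in
/-- The extensions of a word obtained by appending letters until the predicate `halt` holds, or
until `n` letters have been appended. -/
def cut (halt : List ι → Prop) : ℕ → List ι → Finset (List ι)
  | 0, w => {w}
  | n + 1, w => if halt w then {w} else Finset.univ.biUnion fun i => cut halt n (w ++ [i])

variable {halt : List ι → Prop} {f : List ι → ℝ}

theorem prefix_of_mem_cut {n : ℕ} {w v : List ι} (hv : v ∈ cut halt n w) : w <+: v := by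
  classical
  induction n generalizing w with
  | zero => rw [cut, Finset.mem_singleton] at hv; rw [hv]
  | succ n ih =>
    rw [cut] at hv
    split_ifs at hv with hs
    · rw [Finset.mem_singleton] at hv; rw [hv]
    · obtain ⟨i, -, hi⟩ := Finset.mem_biUnion.1 hv
      exact (List.prefix_append _ _).trans (ih hi)

theorem sum_cut_succ {n : ℕ} {w : List ι} (hw : ¬ halt w) :
    ∑ v ∈ cut halt (n + 1) w, f v = ∑ i, ∑ v ∈ cut halt n (w ++ [i]), f v := by
  classical
  rw [cut, if_neg hw, Finset.sum_biUnion]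
  intro i _ j _ hij
  refine Finset.disjoint_left.2 fun v hvi hvj => hij ?_
  exact eq_of_concat_prefix (prefix_of_mem_cut hvi) (prefix_of_mem_cut hvj)

theorem sum_cut_of_halt {n : ℕ} {w : List ι} (hw : halt w) : ∑ v ∈ cut halt n w, f v = f w := by
  cases n <;> simp [cut, hw]

/-- A subharmonic function on the tree is at most its sum over any cut below. -/
theorem le_sum_cut (hf : ∀ w, f w ≤ ∑ i, f (w ++ [i])) (n : ℕ) (w : List ι) :
    f w ≤ ∑ v ∈ cut halt n w, f v := by
  induction n generalizing w with
  | zero => simp [cut]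
  | succ n ih =>
    by_cases hs : halt w
    · rw [sum_cut_of_halt hs]
    · rw [sum_cut_succ hs]
      exact (hf w).trans (Finset.sum_le_sum fun i _ => ih _)

theorem levelSum_nonneg (hf : ∀ w, 0 ≤ f w) (k : ℕ) (w : List ι) : 0 ≤ levelSum f k w := by
  induction k generalizing w with
  | zero => exact hf w
  | succ k ih => exact Finset.sum_nonneg fun i _ => ih _

theorem sum_cut_le (hf : ∀ w, 0 ≤ f w) (n : ℕ) (w : List ι) :
    ∑ v ∈ cut halt n w, f v ≤ ∑ k ∈ Finset.range (n + 1), levelSum f k w := by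
  induction n generalizing w with
  | zero => simp [cut, levelSum]
  | succ n ih =>
    rw [Finset.sum_range_succ']
    have h0 : 0 ≤ ∑ k ∈ Finset.range (n + 1), levelSum f (k + 1) w :=
      Finset.sum_nonneg fun k _ => levelSum_nonneg hf _ _
    by_cases hs : halt w
    · rw [sum_cut_of_halt hs]
      exact le_add_of_nonneg_left h0
    · rw [sum_cut_succ hs]
      refine (Finset.sum_le_sum fun i _ => ih _).trans ?_
      rw [Finset.sum_comm]
      exact le_add_of_nonneg_right (hf w)

/-- Descendants at a fixed level are grouped according to the element of the cut they extend. -/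
theorem levelSum_eq_sum_cut {n K : ℕ} {w : List ι} (h : w.length + n ≤ K) :
    levelSum f (K - w.length) w = ∑ u ∈ cut halt n w, levelSum f (K - u.length) u := by
  induction n generalizing w with
  | zero => simp [cut]
  | succ n ih =>
    by_cases hs : halt w
    · rw [sum_cut_of_halt (f := fun u => levelSum f (K - u.length) u) hs]
    · rw [sum_cut_succ (f := fun u => levelSum f (K - u.length) u) hs,
        show K - w.length = K - (w.length + 1) + 1 by omega, levelSum]
      refine Finset.sum_congr rfl fun i _ => ?_
      rw [← ih (by simp; omega)]
      simp

theorem cut_spec {n : ℕ} {w v : List ι} (hv : v ∈ cut halt n w) :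
    (halt v ∨ v.length = w.length + n) ∧ (v = w ∨ ∃ v' i, v = v' ++ [i] ∧ ¬ halt v') := by
  classical
  induction n generalizing w with
  | zero => rw [cut, Finset.mem_singleton] at hv; simp [hv]
  | succ n ih =>
    rw [cut] at hv
    split_ifs at hv with hs
    · rw [Finset.mem_singleton] at hv; simp [hv, hs]
    · obtain ⟨i, -, hi⟩ := Finset.mem_biUnion.1 hv
      obtain ⟨h1, h2⟩ := ih hi
      refine ⟨h1.imp_right fun h => by rw [h]; simp; omega, Or.inr ?_⟩
      rcases h2 with rfl | h2
      · exact ⟨w, i, rfl, hs⟩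
      · exact h2

/-- Two elements of a cut separate at some letter. -/
theorem cut_incomparable {n : ℕ} {w u v : List ι} (hu : u ∈ cut halt n w) (hv : v ∈ cut halt n w)
    (huv : u ≠ v) : ∃ x i j, i ≠ j ∧ x ++ [i] <+: u ∧ x ++ [j] <+: v := by
  classical
  induction n generalizing w with
  | zero =>
    rw [cut, Finset.mem_singleton] at hu hv
    exact absurd (hu.trans hv.symm) huv
  | succ n ih =>
    rw [cut] at hu hv
    split_ifs at hu hv with hs
    · rw [Finset.mem_singleton] at hu hv
      exact absurd (hu.trans hv.symm) huv
    · obtain ⟨i, -, hi⟩ := Finset.mem_biUnion.1 hu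
      obtain ⟨j, -, hj⟩ := Finset.mem_biUnion.1 hv
      by_cases hij : i = j
      · subst hij; exact ih hi hj
      · exact ⟨w, i, j, hij, prefix_of_mem_cut hi, prefix_of_mem_cut hj⟩

theorem exists_mem_cut {X : Type*} {A : List ι → Set X}
    (hA : ∀ w, ∀ x ∈ A w, ∃ i, x ∈ A (w ++ [i])) (n : ℕ) {w : List ι} {x : X} (hx : x ∈ A w) :
    ∃ v ∈ cut halt n w, x ∈ A v := by
  classical
  induction n generalizing w with
  | zero => exact ⟨w, by simp [cut], hx⟩
  | succ n ih =>
    by_cases hs : halt w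
    · exact ⟨w, by simp [cut, hs], hx⟩
    · obtain ⟨i, hi⟩ := hA w x hx
      obtain ⟨v, hv, hxv⟩ := ih hi
      refine ⟨v, ?_, hxv⟩
      rw [cut, if_neg hs]
      exact Finset.mem_biUnion.2 ⟨i, Finset.mem_univ _, hv⟩

theorem levelSum_eq_sum (f : List ι → ℝ) (k : ℕ) (w : List ι) :
    levelSum f k w = ∑ v : Fin k → ι, f (w ++ List.ofFn v) := by
  induction k generalizing w with
  | zero => simp [levelSum]
  | succ k ih =>
    rw [levelSum, ← (Fin.consEquiv fun _ : Fin (k + 1) => ι).sum_comp, Fintype.sum_prod_type]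
    refine Finset.sum_congr rfl fun i _ => ?_
    rw [ih]
    refine Finset.sum_congr rfl fun v _ => ?_
    simp [Fin.consEquiv, List.ofFn_succ]

theorem levelSum_add (f : List ι → ℝ) (j k : ℕ) (w : List ι) :
    levelSum f (j + k) w = ∑ v : Fin j → ι, levelSum f k (w ++ List.ofFn v) := by
  rw [← levelSum_eq_sum (levelSum f k)]
  induction j generalizing w with
  | zero => simp [levelSum]
  | succ j ih =>
    rw [show j + 1 + k = (j + k) + 1 by ring, levelSum, levelSum]
    exact Finset.sum_congr rfl fun i _ => ih _

theorem levelSum_mono {f g : List ι → ℝ} {k : ℕ} {w : List ι}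
    (h : ∀ v : List ι, v.length = w.length + k → f v ≤ g v) : levelSum f k w ≤ levelSum g k w := by
  rw [levelSum_eq_sum, levelSum_eq_sum]
  exact Finset.sum_le_sum fun v _ => h _ (by simp)

theorem levelSum_const_mul (c : ℝ) (f : List ι → ℝ) (k : ℕ) (w : List ι) :
    levelSum (fun v => c * f v) k w = c * levelSum f k w := by
  rw [levelSum_eq_sum, levelSum_eq_sum, Finset.mul_sum]

theorem levelSum_append_le (hsub : ∀ u v, f (u ++ v) ≤ f u * f v)
    (k : ℕ) (w : List ι) : levelSum f k w ≤ f w * levelSum f k [] := by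
  rw [levelSum_eq_sum, levelSum_eq_sum, Finset.mul_sum]
  exact Finset.sum_le_sum fun v _ => hsub _ _

theorem le_levelSum_append (hsup : ∀ u v, f u * f v ≤ f (u ++ v))
    (k : ℕ) (w : List ι) : f w * levelSum f k [] ≤ levelSum f k w := by
  rw [levelSum_eq_sum, levelSum_eq_sum, Finset.mul_sum]
  exact Finset.sum_le_sum fun v _ => hsup _ _

end Tree

/-! ### The pressure of a sub- or supermultiplicative weight -/

/-- A positive weight on words that is submultiplicative or supermultiplicative under concatenation
and that changes by bounded factors when a letter is appended. -/
structure IsTreeWeight {ι : Type*} (f : List ι → ℝ) (c C : ℝ) : Prop where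
  pos : ∀ w, 0 < f w
  nil : f [] = 1
  mult : (∀ u v, f (u ++ v) ≤ f u * f v) ∨ ∀ u v, f u * f v ≤ f (u ++ v)
  c_pos : 0 < c
  c_le : ∀ w i, c * f w ≤ f (w ++ [i])
  le_C : ∀ w i, f (w ++ [i]) ≤ C * f w

namespace IsTreeWeight

theorem C_pos {ι : Type*} [Nonempty ι] {f : List ι → ℝ} {c C : ℝ} (h : IsTreeWeight f c C) :
    0 < C := by
  obtain ⟨i⟩ := ‹Nonempty ι›
  have h1 := h.le_C [] i
  have h2 := h.pos ([] ++ [i])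
  rw [h.nil, mul_one] at h1
  exact h2.trans_le h1

variable {ι : Type*} [Fintype ι] [Nonempty ι] {f : List ι → ℝ} {c C : ℝ}

theorem levelSum_pos (h : IsTreeWeight f c C) (k : ℕ) (w : List ι) : 0 < levelSum f k w := by
  rw [levelSum_eq_sum]
  exact Finset.sum_pos (fun v _ => h.pos _) Finset.univ_nonempty

theorem levelSum_le (h : IsTreeWeight f c C) (k : ℕ) (w : List ι) :
    levelSum f k w ≤ (Fintype.card ι * C) ^ k * f w := by
  have hC := h.C_pos
  induction k generalizing w with
  | zero => simp [levelSum]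
  | succ k ih =>
    rw [levelSum]
    calc ∑ i, levelSum f k (w ++ [i]) ≤ ∑ i : ι, (Fintype.card ι * C) ^ k * (C * f w) :=
          Finset.sum_le_sum fun i _ => (ih _).trans (by gcongr; exact h.le_C w i)
      _ = _ := by rw [Finset.sum_const, Finset.card_univ, nsmul_eq_mul]; ring

theorem le_levelSum (h : IsTreeWeight f c C) (k : ℕ) (w : List ι) :
    c ^ k * f w ≤ levelSum f k w := by
  have hc := h.c_pos
  induction k generalizing w with
  | zero => simp [levelSum]
  | succ k ih =>
    rw [levelSum]
    obtain ⟨i⟩ := ‹Nonempty ι›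
    calc c ^ (k + 1) * f w = c ^ k * (c * f w) := by ring
      _ ≤ c ^ k * f (w ++ [i]) := by gcongr; exact h.c_le w i
      _ ≤ levelSum f k (w ++ [i]) := ih _
      _ ≤ _ := Finset.single_le_sum (f := fun i => levelSum f k (w ++ [i]))
        (fun i _ => (h.levelSum_pos k _).le) (Finset.mem_univ i)

theorem abs_log_levelSum_div_le (h : IsTreeWeight f c C) (n : ℕ) :
    |Real.log (levelSum f n []) / n| ≤ |Real.log c| + |Real.log (Fintype.card ι * C)| := by
  have hc := h.c_pos
  have hC := h.C_pos
  have hcard : 0 < (Fintype.card ι : ℝ) := by exact_mod_cast Fintype.card_pos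
  rcases Nat.eq_zero_or_pos n with rfl | hn
  · simp; positivity
  have hn' : (0 : ℝ) < n := by exact_mod_cast hn
  have h1 := Real.log_le_log (h.levelSum_pos n []) (h.levelSum_le n [])
  have h2 := Real.log_le_log (mul_pos (pow_pos hc n) (h.pos [])) (h.le_levelSum n [])
  rw [h.nil, mul_one, Real.log_pow] at h1 h2
  rw [abs_le, div_le_iff₀ hn', le_div_iff₀ hn']
  have a1 := neg_abs_le (Real.log c)
  have a2 := le_abs_self (Real.log (Fintype.card ι * C))
  have a3 := abs_nonneg (Real.log c)
  have a4 := abs_nonneg (Real.log (Fintype.card ι * C))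
  constructor <;> nlinarith

/-- The exponential growth rate of the level sums exists, by Fekete's lemma. -/
theorem exists_pressure (h : IsTreeWeight f c C) :
    ∃ p, Tendsto (fun k : ℕ => Real.log (levelSum f k []) / k) atTop (𝓝 p) := by
  have habs := h.abs_log_levelSum_div_le
  have hadd : ∀ j k, levelSum f (j + k) [] = ∑ v : Fin j → ι, levelSum f k (List.ofFn v) := by
    intro j k; simpa using levelSum_add f j k []
  have hz : ∀ j, levelSum f j [] = ∑ v : Fin j → ι, f (List.ofFn v) := by
    intro j; simpa using levelSum_eq_sum f j []
  rcases h.mult with hsub | hsup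
  · have hS : Subadditive fun k => Real.log (levelSum f k []) := by
      intro j k
      rw [← Real.log_mul (h.levelSum_pos _ _).ne' (h.levelSum_pos _ _).ne']
      refine Real.log_le_log (h.levelSum_pos _ _) ?_
      rw [hadd, hz j, Finset.sum_mul]
      exact Finset.sum_le_sum fun v _ => levelSum_append_le hsub _ _
    exact ⟨_, hS.tendsto_lim ⟨-_, by rintro _ ⟨n, rfl⟩; exact (abs_le.1 (habs n)).1⟩⟩
  · have hS : Subadditive fun k => -Real.log (levelSum f k []) := by
      intro j k
      rw [← neg_add, neg_le_neg_iff,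
        ← Real.log_mul (h.levelSum_pos _ _).ne' (h.levelSum_pos _ _).ne']
      refine Real.log_le_log (mul_pos (h.levelSum_pos _ _) (h.levelSum_pos _ _)) ?_
      rw [hadd, hz j, Finset.sum_mul]
      exact Finset.sum_le_sum fun v _ => le_levelSum_append hsup _ _
    have := hS.tendsto_lim ⟨-_, by
      rintro _ ⟨n, rfl⟩
      beta_reduce
      rw [neg_div, neg_le_neg_iff]
      exact (abs_le.1 (habs n)).2⟩
    exact ⟨_, by simpa [neg_div] using this.neg⟩

/-- For negative pressure, the sums over cuts are bounded above. -/
theorem exists_sum_cut_le (h : IsTreeWeight f c C) {p : ℝ}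
    (hp : Tendsto (fun k : ℕ => Real.log (levelSum f k []) / k) atTop (𝓝 p)) (hp0 : p < 0) :
    ∃ B > 0, ∀ (halt : List ι → Prop) n, ∑ v ∈ cut halt n [], f v ≤ B := by
  have hsum : Summable fun k => levelSum f k [] := by
    refine Summable.of_norm_bounded_eventually_nat (g := fun k => Real.exp (p / 2) ^ k)
      (summable_geometric_of_lt_one (Real.exp_pos _).le (Real.exp_lt_one_iff.2 (by linarith))) ?_
    filter_upwards [hp.eventually (gt_mem_nhds (show p < p / 2 by linarith)), eventually_gt_atTop 0]
      with k hk hk0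
    have hk0' : (0 : ℝ) < k := by exact_mod_cast hk0
    rw [div_lt_iff₀ hk0', Real.log_lt_iff_lt_exp (h.levelSum_pos _ _)] at hk
    rw [Real.norm_of_nonneg (h.levelSum_pos _ _).le, ← Real.exp_nat_mul, mul_comm]
    exact hk.le
  refine ⟨∑' k, levelSum f k [], hsum.tsum_pos (fun k => (h.levelSum_pos _ _).le) 0
    (h.levelSum_pos _ _), fun halt n => ?_⟩
  exact (sum_cut_le (fun w => (h.pos w).le) n []).trans
    (hsum.sum_le_tsum _ fun k _ => (h.levelSum_pos _ _).le)

/-- For positive pressure, the sums over cuts are bounded below. In the submultiplicative case a cut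
with sum at most `1` would bound all level sums. In the supermultiplicative case some level sum is
at least `1`, and the sum of the levels below it is a subharmonic function on the tree. -/
theorem exists_le_sum_cut (h : IsTreeWeight f c C) {p : ℝ}
    (hp : Tendsto (fun k : ℕ => Real.log (levelSum f k []) / k) atTop (𝓝 p)) (hp0 : 0 < p) :
    ∃ A > 0, ∀ (halt : List ι → Prop) n, A ≤ ∑ v ∈ cut halt n [], f v := by
  have hf0 : ∀ w, 0 ≤ f w := fun w => (h.pos w).le
  rcases h.mult with hsub | hsup
  · refine ⟨1, one_pos, fun halt n => ?_⟩
    by_contra hlt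
    rw [not_le] at hlt
    have hlen : ∀ u ∈ cut halt n [], 1 ≤ u.length := fun u hu => by
      by_contra hlen
      have : u = [] := by
        rw [← List.length_eq_zero_iff]; omega
      subst this
      have := Finset.single_le_sum (f := f) (fun v _ => hf0 v) hu
      rw [h.nil] at this
      linarith
    have hbound : ∀ k, levelSum f k [] ≤ 1 + ∑ j ∈ Finset.range n, levelSum f j [] := by
      set B := 1 + ∑ j ∈ Finset.range n, levelSum f j [] with hB
      have hB0 : 0 ≤ B := add_nonneg zero_le_one
        (Finset.sum_nonneg fun j _ => levelSum_nonneg hf0 _ _)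
      intro k
      induction k using Nat.strong_induction_on with
      | _ k ih =>
        rcases lt_or_ge k n with hk | hk
        · have := Finset.single_le_sum (f := fun j => levelSum f j [])
            (fun j _ => levelSum_nonneg hf0 j []) (Finset.mem_range.2 hk)
          linarith
        · have h1 := levelSum_eq_sum_cut (halt := halt) (f := f) (n := n) (K := k) (w := [])
            (by simpa using hk)
          simp only [List.length_nil, Nat.sub_zero] at h1
          rw [h1]
          calc ∑ u ∈ cut halt n [], levelSum f (k - u.length) u
              ≤ ∑ u ∈ cut halt n [], f u * B := by
                refine Finset.sum_le_sum fun u hu => ?_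
                refine (levelSum_append_le hsub _ u).trans ?_
                refine mul_le_mul_of_nonneg_left ?_ (hf0 u)
                have hu1 := hlen u hu
                rcases Nat.eq_zero_or_pos k with rfl | hk0
                · have hn : n = 0 := by omega
                  subst hn
                  simp only [cut, Finset.mem_singleton] at hu
                  simp [hu] at hu1
                · exact ih _ (by omega)
            _ = (∑ u ∈ cut halt n [], f u) * B := by rw [Finset.sum_mul]
            _ ≤ 1 * B := by gcongr
            _ = B := one_mul B
    set B := 1 + ∑ j ∈ Finset.range n, levelSum f j []
    have hlim : Tendsto (fun k : ℕ => Real.log B / k) atTop (𝓝 0) :=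
      tendsto_const_div_atTop_nhds_zero_nat _
    have := le_of_tendsto_of_tendsto' hp hlim fun k => by
      have := Real.log_le_log (h.levelSum_pos k []) (hbound k)
      gcongr
    linarith
  · obtain ⟨k, hk, hk0⟩ :=
      ((hp.eventually (lt_mem_nhds hp0)).and (eventually_gt_atTop 0)).exists
    have hk0' : (0 : ℝ) < k := by exact_mod_cast hk0
    have hk1 : 1 ≤ levelSum f k [] := by
      rw [div_pos_iff_of_pos_right hk0'] at hk
      exact ((Real.log_pos_iff (levelSum_nonneg hf0 _ _)).1 hk).le
    have hC := h.C_pos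
    set D := ∑ j ∈ Finset.range k, (Fintype.card ι * C) ^ j with hD
    have hD0 : 0 < D := Finset.sum_pos (fun j _ => pow_pos (mul_pos (by
      exact_mod_cast Fintype.card_pos) hC) j) (by simpa using hk0.ne')
    let g : List ι → ℝ := fun w => ∑ j ∈ Finset.range k, levelSum f j w
    have hgle : ∀ w, g w ≤ D * f w := fun w => by
      rw [hD, Finset.sum_mul]
      exact Finset.sum_le_sum fun j _ => h.levelSum_le j w
    have hg1 : 1 ≤ g [] := by
      have := Finset.single_le_sum (f := fun j => levelSum f j [])
        (fun j _ => levelSum_nonneg hf0 j []) (Finset.mem_range.2 hk0)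
      simpa [levelSum, h.nil] using this
    have hgsub : ∀ w, g w ≤ ∑ i, g (w ++ [i]) := fun w => by
      have h1 : ∑ i, g (w ++ [i]) = ∑ j ∈ Finset.range k, levelSum f (j + 1) w := by
        rw [Finset.sum_comm]; rfl
      have h2 : g w + levelSum f k w = ∑ j ∈ Finset.range k, levelSum f (j + 1) w + f w := by
        rw [← Finset.sum_range_succ, Finset.sum_range_succ']; rfl
      have h3 : f w ≤ levelSum f k w := by
        have := le_levelSum_append hsup k w
        exact le_trans (le_mul_of_one_le_right (hf0 w) hk1) this
      linarith
    refine ⟨D⁻¹, inv_pos.2 hD0, fun halt n => ?_⟩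
    have h1 : 1 ≤ D * ∑ v ∈ cut halt n [], f v := by
      rw [Finset.mul_sum]
      exact hg1.trans ((le_sum_cut hgsub n []).trans (Finset.sum_le_sum fun v _ => hgle v))
    rw [inv_le_iff_one_le_mul₀ hD0]
    linarith

end IsTreeWeight

/-! ### The pressure of a box-like system -/

namespace BoxLikeSystem

variable {ι : Type*} {S : ι → Plane →ᵃ[ℝ] Plane} {F : Set Plane} {m M : ℝ}

theorem alpha₂_nil : α₂ (listMap S []) = 1 := by
  obtain ⟨j, -, h2, -⟩ := IsAxisMap.one.exists_alpha
  rw [listMap_nil, h2, IsAxisMap.stretch_one]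

theorem alpha₁_nil : α₁ (listMap S []) = 1 := by
  obtain ⟨j, h1, -, -⟩ := IsAxisMap.one.exists_alpha
  rw [listMap_nil, h1, IsAxisMap.stretch_one]

theorem alpha₂_concat_le (h : BoxLikeSystem S F m M) (w : List ι) (i : ι) :
    α₂ (listMap S (w ++ [i])) ≤ α₂ (listMap S w) * M := by
  obtain ⟨σ, hσ⟩ := h.exists_axis w
  obtain ⟨τ, hτ⟩ := h.axis i
  rw [listMap_concat]
  exact hσ.alpha₂_mul_le hτ (h.stretch_le i)

theorem le_alpha₂_concat (h : BoxLikeSystem S F m M) (w : List ι) (i : ι) :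
    α₂ (listMap S w) * m ≤ α₂ (listMap S (w ++ [i])) := by
  obtain ⟨σ, hσ⟩ := h.exists_axis w
  obtain ⟨τ, hτ⟩ := h.axis i
  rw [listMap_concat]
  exact hσ.le_alpha₂_mul hτ h.m_pos.le (h.le_stretch i)

theorem alpha₂_pos (h : BoxLikeSystem S F m M) (w : List ι) : 0 < α₂ (listMap S w) :=
  (h.exists_axis w).choose_spec.alpha₂_pos

theorem alpha₂_le_alpha₁ (h : BoxLikeSystem S F m M) (w : List ι) :
    α₂ (listMap S w) ≤ α₁ (listMap S w) :=
  (h.exists_axis w).choose_spec.alpha₂_le_alpha₁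

theorem alpha₂_le_pow (h : BoxLikeSystem S F m M) (w : List ι) :
    α₂ (listMap S w) ≤ M ^ w.length := by
  induction w using List.reverseRecOn with
  | nil => simpa using (alpha₂_nil (S := S)).le
  | append_singleton w i ih =>
    refine (h.alpha₂_concat_le w i).trans ?_
    rw [List.length_append, List.length_singleton, pow_succ]
    exact mul_le_mul_of_nonneg_right ih h.M_pos.le

theorem pow_le_alpha₂ (h : BoxLikeSystem S F m M) (w : List ι) :
    m ^ w.length ≤ α₂ (listMap S w) := by
  induction w using List.reverseRecOn with
  | nil => simpa using (alpha₂_nil (S := S)).ge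
  | append_singleton w i ih =>
    refine le_trans ?_ (h.le_alpha₂_concat w i)
    rw [List.length_append, List.length_singleton, pow_succ]
    exact mul_le_mul_of_nonneg_right ih h.m_pos.le

theorem alpha₁_le_pow (h : BoxLikeSystem S F m M) (w : List ι) :
    α₁ (listMap S w) ≤ M ^ w.length := by
  induction w using List.reverseRecOn with
  | nil => simpa using (alpha₁_nil (S := S)).le
  | append_singleton w i ih =>
    obtain ⟨σ, hσ⟩ := h.exists_axis w
    obtain ⟨τ, hτ⟩ := h.axis i
    rw [listMap_concat, List.length_append, List.length_singleton, pow_succ]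
    exact (hσ.alpha₁_mul_le hτ (h.stretch_le i)).trans (mul_le_mul_of_nonneg_right ih h.M_pos.le)

theorem modSV_add (h : BoxLikeSystem S F m M) (w : List ι) (t ε : ℝ) :
    modSV F (t + ε) (listMap S w) = α₂ (listMap S w) ^ ε * modSV F t (listMap S w) := by
  rw [modSV, modSV, add_sub_right_comm, Real.rpow_add (h.alpha₂_pos w)]
  ring

variable [Fintype ι]

theorem Psi_eq_levelSum (S : ι → Plane →ᵃ[ℝ] Plane) (F : Set Plane) (k : ℕ) (t : ℝ) :
    Psi S F k t = levelSum (fun w => modSV F t (listMap S w)) k [] := by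
  rw [levelSum_eq_sum, Psi]
  refine Finset.sum_congr rfl fun w _ => ?_
  rw [wordMap, listMap, List.nil_append, List.map_ofFn]
  rfl

theorem exists_isTreeWeight (h : BoxLikeSystem S F m M) (t : ℝ) :
    ∃ c C, IsTreeWeight (fun w => modSV F t (listMap S w)) c C := by
  have hne := h.nonempty_index
  choose τ hτ using h.axis
  have hs : ∀ (w : List ι) (σ : Equiv.Perm (Fin 2)), IsAxisMap (listMap S w) σ →
    ∀ j, projDim F (σ j) = projDim F j := fun w σ hσ j => h.projDim_perm hσ j
  have hs1 : ∀ i j, projDim F (τ i j) = projDim F j := fun i j =>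
    h.projDim_perm (w := [i]) (by simpa [listMap] using hτ i) j
  obtain ⟨a, ha⟩ := Finite.exists_min fun q : ι × Fin 2 => weight (projDim F) t (S q.1) q.2
  obtain ⟨b, hb⟩ := Finite.exists_max fun q : ι × Fin 2 => weight (projDim F) t (S q.1) q.2
  set c := weight (projDim F) t (S a.1) a.2
  set C := weight (projDim F) t (S b.1) b.2
  have hc : 0 < c := (hτ a.1).weight_pos _ _ _
  have hbounds : ∀ i, c ≤ modSV F t (S i) ∧ modSV F t (S i) ≤ C := fun i => by
    obtain ⟨j, -, -, -, -, hj⟩ := (hτ i).modSV_eq F t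
    rw [hj]; exact ⟨ha (i, j), hb (i, j)⟩
  have hpos : ∀ w : List ι, 0 < modSV F t (listMap S w) := fun w =>
    (h.exists_axis w).choose_spec.modSV_pos F t
  refine ⟨c, C, hpos, IsAxisMap.modSV_one F t, ?_, hc, fun w i => ?_, fun w i => ?_⟩
  · rcases le_total t (projDim F 0 + projDim F 1) with ht | ht
    · refine Or.inl fun u v => ?_
      obtain ⟨σ, hσ⟩ := h.exists_axis u
      obtain ⟨ρ, hρ⟩ := h.exists_axis v
      rw [listMap_append]
      exact hσ.modSV_mul_le hρ (hs v ρ hρ) ht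
    · refine Or.inr fun u v => ?_
      obtain ⟨σ, hσ⟩ := h.exists_axis u
      obtain ⟨ρ, hρ⟩ := h.exists_axis v
      rw [listMap_append]
      exact hσ.le_modSV_mul hρ (hs v ρ hρ) ht
  · obtain ⟨σ, hσ⟩ := h.exists_axis w
    rw [listMap_concat]
    rcases le_total t (projDim F 0 + projDim F 1) with ht | ht
    · -- The maximal weight of the product dominates the one extending the maximal weight of `w`.
      obtain ⟨j, -, -, -, -, hj⟩ := hσ.modSV_eq F t
      obtain ⟨k, -, -, -, hk, hk'⟩ := (hσ.mul (hτ i)).modSV_eq F t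
      have h1 := (hσ.mul (hτ i)).weight_le_weight hk ht ((τ i).symm j)
      rw [hσ.weight_mul (hτ i) (hs1 i ((τ i).symm j)), Equiv.apply_symm_apply] at h1
      rw [hj, hk', mul_comm]
      exact (mul_le_mul_of_nonneg_left (ha (i, _)) (hσ.weight_pos _ _ _).le).trans h1
    · rw [mul_comm]
      exact (mul_le_mul_of_nonneg_left (hbounds i).1 (hpos w).le).trans
        (hσ.le_modSV_mul (hτ i) (hs1 i) ht)
  · obtain ⟨σ, hσ⟩ := h.exists_axis w
    rw [listMap_concat]
    rcases le_total t (projDim F 0 + projDim F 1) with ht | ht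
    · rw [mul_comm]
      exact (hσ.modSV_mul_le (hτ i) (hs1 i) ht).trans
        (mul_le_mul_of_nonneg_left (hbounds i).2 (hpos w).le)
    · obtain ⟨j, -, -, -, -, hj⟩ := hσ.modSV_eq F t
      obtain ⟨k, -, -, -, hk, hk'⟩ := (hσ.mul (hτ i)).modSV_eq F t
      have h1 := (hσ.mul (hτ i)).weight_ge_weight hk ht ((τ i).symm j)
      rw [hσ.weight_mul (hτ i) (hs1 i ((τ i).symm j)), Equiv.apply_symm_apply] at h1
      rw [hj, hk', mul_comm]
      exact h1.trans (mul_le_mul_of_nonneg_left (hb (i, _)) (hσ.weight_pos _ _ _).le)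

theorem levelSum_add_le (h : BoxLikeSystem S F m M) (t : ℝ) {ε : ℝ} (hε : 0 ≤ ε) (k : ℕ) :
    levelSum (fun w => modSV F (t + ε) (listMap S w)) k [] ≤
      (M ^ k) ^ ε * levelSum (fun w => modSV F t (listMap S w)) k [] := by
  rw [← levelSum_const_mul]
  refine levelSum_mono fun v hv => ?_
  rw [h.modSV_add]
  have h1 := h.alpha₂_le_pow v
  rw [hv, List.length_nil, zero_add] at h1
  refine mul_le_mul_of_nonneg_right (Real.rpow_le_rpow (h.alpha₂_pos v).le h1 hε) ?_
  exact ((h.exists_axis v).choose_spec.modSV_pos F t).le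

theorem le_levelSum_add (h : BoxLikeSystem S F m M) (t : ℝ) {ε : ℝ} (hε : 0 ≤ ε) (k : ℕ) :
    (m ^ k) ^ ε * levelSum (fun w => modSV F t (listMap S w)) k [] ≤
      levelSum (fun w => modSV F (t + ε) (listMap S w)) k [] := by
  rw [← levelSum_const_mul]
  refine levelSum_mono fun v hv => ?_
  rw [h.modSV_add]
  have h1 := h.pow_le_alpha₂ v
  rw [hv, List.length_nil, zero_add] at h1
  refine mul_le_mul_of_nonneg_right (Real.rpow_le_rpow (pow_nonneg h.m_pos.le k) h1 hε) ?_
  exact ((h.exists_axis v).choose_spec.modSV_pos F t).le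

/-- The logarithm of the pressure function: it decreases at a rate between `-log M` and `-log m`,
and it is positive at `0`, where every word has weight at least `1`. -/
theorem exists_pressure (h : BoxLikeSystem S F m M) (hι : 2 ≤ Fintype.card ι) :
    ∃ p : ℝ → ℝ, (∀ t, Tendsto (fun k : ℕ => Real.log (Psi S F k t) / k) atTop (𝓝 (p t))) ∧
      StrictAnti p ∧ ∃ s, 0 < s ∧ p s = 0 := by
  have hne := h.nonempty_index
  choose c C hw using h.exists_isTreeWeight
  choose p hp using fun t => (hw t).exists_pressure
  have hlogM : Real.log M < 0 := Real.log_neg h.M_pos h.M_lt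
  have hlogm : Real.log m < 0 := Real.log_neg h.m_pos h.m_lt
  have hup : ∀ t ε, 0 ≤ ε → p (t + ε) ≤ p t + ε * Real.log M := fun t ε hε => by
    refine le_of_tendsto_of_tendsto (hp (t + ε)) ((hp t).add_const _) ?_
    filter_upwards [eventually_gt_atTop 0] with k hk
    have hk' : (0 : ℝ) < k := by exact_mod_cast hk
    have h1 := Real.log_le_log ((hw (t + ε)).levelSum_pos k []) (h.levelSum_add_le t hε k)
    have h2 := pow_pos h.M_pos k
    rw [Real.log_mul (Real.rpow_pos_of_pos h2 _).ne' ((hw t).levelSum_pos k []).ne',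
      Real.log_rpow h2, Real.log_pow] at h1
    rw [div_le_iff₀ hk', add_mul, div_mul_cancel₀ _ hk'.ne']
    linarith
  have hlow : ∀ t ε, 0 ≤ ε → p t + ε * Real.log m ≤ p (t + ε) := fun t ε hε => by
    refine le_of_tendsto_of_tendsto ((hp t).add_const _) (hp (t + ε)) ?_
    filter_upwards [eventually_gt_atTop 0] with k hk
    have hk' : (0 : ℝ) < k := by exact_mod_cast hk
    have h2 := pow_pos h.m_pos k
    have h1 := Real.log_le_log (mul_pos (Real.rpow_pos_of_pos h2 _) ((hw t).levelSum_pos k []))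
      (h.le_levelSum_add t hε k)
    rw [Real.log_mul (Real.rpow_pos_of_pos h2 _).ne' ((hw t).levelSum_pos k []).ne',
      Real.log_rpow h2, Real.log_pow] at h1
    rw [le_div_iff₀ hk', add_mul, div_mul_cancel₀ _ hk'.ne']
    linarith
  have hanti : StrictAnti p := fun a b hab => by
    have h1 := hup a (b - a) (by linarith)
    rw [add_sub_cancel] at h1
    nlinarith
  have hcont : Continuous p := by
    refine (LipschitzWith.of_le_add_mul (Real.toNNReal (-Real.log m)) fun a b => ?_).continuous
    rw [Real.coe_toNNReal _ (by linarith), Real.dist_eq]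
    rcases le_total a b with hab | hab
    · have h1 := hlow a (b - a) (by linarith)
      rw [add_sub_cancel] at h1
      rw [abs_of_nonpos (by linarith)]
      linarith
    · have h1 := hup b (a - b) (by linarith)
      rw [add_sub_cancel] at h1
      rw [abs_of_nonneg (by linarith)]
      nlinarith
  have hp0 : 0 < p 0 := by
    have hlog2 : 0 < Real.log 2 := Real.log_pos (by norm_num)
    refine hlog2.trans_le (ge_of_tendsto (hp 0) ?_)
    filter_upwards [eventually_gt_atTop 0] with k hk
    have hk' : (0 : ℝ) < k := by exact_mod_cast hk
    have h1 : (2 : ℝ) ^ k ≤ levelSum (fun w => modSV F 0 (listMap S w)) k [] := by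
      rw [levelSum_eq_sum]
      calc (2 : ℝ) ^ k ≤ (Fintype.card ι : ℝ) ^ k := by gcongr; exact_mod_cast hι
        _ = ∑ v : Fin k → ι, (1 : ℝ) := by simp
        _ ≤ _ := Finset.sum_le_sum fun v _ => ?_
      obtain ⟨σ, hσ⟩ := h.exists_axis ([] ++ List.ofFn v)
      obtain ⟨j, -, -, -, hj, hj'⟩ := hσ.modSV_eq F 0
      rw [hj', weight, zero_sub, Real.rpow_neg (hσ.stretch_pos _).le, ← div_eq_mul_inv,
        one_le_div (Real.rpow_pos_of_pos (hσ.stretch_pos _) _)]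
      exact Real.rpow_le_rpow (hσ.stretch_pos _).le hj (h.hasPowerGrowth_proj j).nonneg
    have h2 := Real.log_le_log (by positivity) h1
    rw [Real.log_pow] at h2
    rw [le_div_iff₀ hk']
    linarith
  refine ⟨p, fun t => by simpa only [Psi_eq_levelSum] using hp t, hanti, ?_⟩
  set b := p 0 / (-Real.log M) with hb
  have hb0 : 0 < b := div_pos hp0 (by linarith)
  have hpb : p b ≤ 0 := by
    have h1 := hup 0 b hb0.le
    rw [zero_add] at h1
    have h2 : b * (-Real.log M) = p 0 := div_mul_cancel₀ _ (by linarith)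
    linarith
  obtain ⟨s, hs, hs0⟩ := intermediate_value_Icc' hb0.le hcont.continuousOn ⟨hpb, hp0.le⟩
  refine ⟨s, lt_of_le_of_ne hs.1 fun h0 => ?_, hs0⟩
  rw [← h0] at hs0
  linarith

theorem tendsto_Psi_rpow (h : BoxLikeSystem S F m M) {t q : ℝ}
    (hq : Tendsto (fun k : ℕ => Real.log (Psi S F k t) / k) atTop (𝓝 q)) :
    Tendsto (fun k : ℕ => Psi S F k t ^ (1 / (k : ℝ))) atTop (𝓝 (Real.exp q)) := by
  have hne := h.nonempty_index
  obtain ⟨c, C, hw⟩ := h.exists_isTreeWeight t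
  refine ((Real.continuous_exp.tendsto q).comp hq).congr fun k => ?_
  have hpos : 0 < Psi S F k t := by rw [Psi_eq_levelSum]; exact hw.levelSum_pos k []
  rw [Function.comp_apply, Real.rpow_def_of_pos hpos, mul_one_div]

end BoxLikeSystem

/-! ### Covering numbers of cylinders and the upper bound -/

theorem coverNumber_le_sum {X κ : Type*} [MetricSpace X] {δ : ℝ} (hδ : 0 < δ) {A : Set X}
    (s : Finset κ) {B : κ → Set X} (hB : ∀ v ∈ s, TotallyBounded (B v)) (hA : A ⊆ ⋃ v ∈ s, B v) :
    coverNumber δ A ≤ ∑ v ∈ s, coverNumber δ (B v) := by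
  choose! U hU using fun v (hv : v ∈ s) => exists_cover hδ (hB v hv)
  have := coverNumber_le_card (δ := δ) (A := A)
    (s.sigma fun v => (Finset.univ : Finset (Fin (coverNumber δ (B v)))))
    (fun p => U p.1 p.2) ?_ ?_
  · simpa [Finset.card_sigma] using this
  · intro p hp
    exact (hU p.1 (Finset.mem_sigma.1 hp).1).1 p.2
  · intro x hx
    obtain ⟨v, hv, hxv⟩ := Set.mem_iUnion₂.1 (hA hx)
    obtain ⟨k, hk⟩ := Set.mem_iUnion.1 ((hU v hv).2 hxv)
    exact Set.mem_iUnion₂.2 ⟨⟨v, k⟩, by simp [hv], hk⟩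

theorem rpow_bounds {m x : ℝ} (hm : 0 < m) (hmx : m ≤ x) (hx : x ≤ 1) (e : ℝ) :
    m ^ |e| ≤ x ^ e ∧ x ^ e ≤ m ^ (-|e|) := by
  have hx0 : 0 < x := hm.trans_le hmx
  rcases le_total 0 e with he | he
  · rw [abs_of_nonneg he]
    refine ⟨Real.rpow_le_rpow hm.le hmx he, (Real.rpow_le_one hx0.le hx he).trans ?_⟩
    exact Real.one_le_rpow_of_pos_of_le_one_of_nonpos hm (hmx.trans hx) (by linarith)
  · rw [abs_of_nonpos he, neg_neg]
    refine ⟨le_trans ?_ (Real.one_le_rpow_of_pos_of_le_one_of_nonpos hx0 hx he),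
      Real.rpow_le_rpow_of_nonpos hm hmx he⟩
    exact Real.rpow_le_one hm.le (hmx.trans hx) (by linarith)

/-- The expected number of `δ`-sets covering a strip with sides `a₁` and `a₂`, in terms of the
weight, up to a power of `δ / a₂`. -/
theorem ratio_rpow_eq {δ a₁ a₂ : ℝ} (hδ : 0 < δ) (ha₁ : 0 < a₁) (ha₂ : 0 < a₂) (s t : ℝ) :
    (δ / a₁) ^ (-s) = (a₁ ^ s * a₂ ^ (t - s)) * (δ / a₂) ^ (t - s) * δ ^ (-t) := by
  have h1 : a₂ ^ (t - s) ≠ 0 := (Real.rpow_pos_of_pos ha₂ _).ne'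
  rw [Real.div_rpow hδ.le ha₁.le, Real.div_rpow hδ.le ha₂.le, Real.rpow_neg ha₁.le s,
    div_inv_eq_mul, show -s = (t - s) + -t by ring, Real.rpow_add hδ]
  field_simp

namespace BoxLikeSystem

variable {ι : Type*} {S : ι → Plane →ᵃ[ℝ] Plane} {F : Set Plane} {m M : ℝ}

theorem coverNumber_image_le (h : BoxLikeSystem S F m M) {R : ℝ}
    (hR : ∀ x ∈ F, ∀ y ∈ F, dist x y ≤ R) {T : Plane →ᵃ[ℝ] Plane} {σ : Equiv.Perm (Fin 2)}
    (hσ : IsAxisMap T σ) {δ : ℝ} (hδ : 0 < δ) {j : Fin 2} (hj : stretch T (1 - j) ≤ δ / m) :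
    coverNumber (δ * (1 + R / m)) (T '' F) ≤ coverNumber (δ / stretch T j) (proj j '' F) := by
  have hp := hσ.stretch_pos j
  have h1 := BoxLike.coverNumber_image_le (g := T) (h := proj j) (B := F) (K := stretch T j)
    (L := δ / m * R) (δ := δ / stretch T j) (by positivity) hp.le (h.totallyBounded_proj j)
    fun x hx y hy => by
      refine (hσ.dist_le_add x y j).trans ?_
      have h2 := (abs_coord_sub_le x y (1 - j)).trans (hR x hx y hy)
      have h3 := mul_le_mul hj h2 (abs_nonneg _) (div_pos hδ h.m_pos).le
      rw [Real.dist_eq, proj, proj]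
      linarith
  rwa [show stretch T j * (δ / stretch T j) + δ / m * R = δ * (1 + R / m) by field_simp] at h1

theorem le_coverNumber_image (h : BoxLikeSystem S F m M) {T : Plane →ᵃ[ℝ] Plane}
    {σ : Equiv.Perm (Fin 2)} (hσ : IsAxisMap T σ) {δ : ℝ} (hδ : 0 < δ) (j : Fin 2) :
    coverNumber (δ / stretch T j) (proj j '' F) ≤ coverNumber δ (T '' F) := by
  have hp := hσ.stretch_pos j
  have h1 := BoxLike.coverNumber_image_le (g := proj j) (h := T) (B := F) (K := (stretch T j)⁻¹)
    (L := 0) hδ (inv_nonneg.2 hp.le) (h.totallyBounded_image T) fun x hx y hy => by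
      rw [Real.dist_eq, proj, proj, add_zero, inv_mul_eq_div, le_div_iff₀ hp, mul_comm]
      exact hσ.stretch_mul_abs_le x y j
  rwa [add_zero, inv_mul_eq_div] at h1

variable [Fintype ι]

/-- The words stopped when the smaller singular value first drops to `δ / m`: in them this singular
value lies between `δ` and `δ / m`. -/
theorem exists_cut (h : BoxLikeSystem S F m M) {δ : ℝ} (hδ : 0 < δ) (hδ1 : δ ≤ 1) :
    ∃ n, ∀ v ∈ cut (fun w => α₂ (listMap S w) ≤ δ / m) n [],
      δ ≤ α₂ (listMap S v) ∧ α₂ (listMap S v) ≤ δ / m := by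
  obtain ⟨n, hn⟩ := exists_pow_lt_of_lt_one (div_pos hδ h.m_pos) h.M_lt
  refine ⟨n, fun v hv => ?_⟩
  obtain ⟨h1, h2⟩ := cut_spec hv
  constructor
  · rcases h2 with rfl | ⟨v', i, rfl, hv'⟩
    · rwa [alpha₂_nil]
    · rw [not_le, div_lt_iff₀ h.m_pos] at hv'
      exact hv'.le.trans (h.le_alpha₂_concat v' i)
  · rcases h1 with h1 | h1
    · exact h1
    · refine (h.alpha₂_le_pow v).trans ?_
      rw [h1, List.length_nil, zero_add]
      exact hn.le

/-- The stopped cylinders are covered along their longer sides, with covering numbers bounded by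
those of the corresponding projection of `F`. -/
theorem upperBoxDim_le_of_sum_cut (h : BoxLikeSystem S F m M) {t B : ℝ} (hB : 0 < B)
    (hcut : ∀ (halt : List ι → Prop) n, ∑ v ∈ cut halt n [], modSV F t (listMap S v) ≤ B) :
    upperBoxDim F ≤ t := by
  have hm := h.m_pos
  choose C hC hb using fun j => (h.hasPowerGrowth_proj j).upper
  obtain ⟨R, hR⟩ := Metric.isBounded_iff.1 h.isCompact.isBounded
  have hR0 : 0 ≤ R := by
    obtain ⟨x, hx⟩ := h.nonempty
    simpa using hR hx hx
  set K := 1 + R / m with hK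
  have hK1 : 1 ≤ K := by rw [hK]; have := div_nonneg hR0 hm.le; linarith
  have hK0 : 0 < K := by linarith
  set D := ∑ j, C j * m ^ (-|t - projDim F j|) with hD
  have hterm : ∀ j, 0 < C j * m ^ (-|t - projDim F j|) := fun j =>
    mul_pos (hC j) (Real.rpow_pos_of_pos hm _)
  have hD0 : 0 < D := Finset.sum_pos (fun j _ => hterm j) Finset.univ_nonempty
  have hDj : ∀ j, C j * m ^ (-|t - projDim F j|) ≤ D := fun j =>
    Finset.single_le_sum (f := fun j => C j * m ^ (-|t - projDim F j|))
      (fun j _ => (hterm j).le) (Finset.mem_univ j)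
  have main : ∀ δ : ℝ, 0 < δ → δ ≤ 1 → (coverNumber (δ * K) F : ℝ) ≤ D * B * δ ^ (-t) := by
    intro δ hδ hδ1
    obtain ⟨n, hn⟩ := h.exists_cut hδ hδ1
    set V := cut (fun w => α₂ (listMap S w) ≤ δ / m) n []
    have hδK : 0 < δ * K := by positivity
    have h1 := coverNumber_le_sum (A := F) hδK V
      (B := fun v => listMap S v '' F) (fun v _ => h.totallyBounded_image _) fun x hx => by
        obtain ⟨v, hv, hxv⟩ := exists_mem_cut (A := fun w => listMap S w '' F)
          (fun w x hx => h.exists_mem_concat hx) n (w := []) (x := x) ⟨x, hx, rfl⟩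
        exact Set.mem_iUnion₂.2 ⟨v, hv, hxv⟩
    have h2 : ∀ v ∈ V, (coverNumber (δ * K) (listMap S v '' F) : ℝ) ≤
        D * δ ^ (-t) * modSV F t (listMap S v) := by
      intro v hv
      obtain ⟨σ, hσ⟩ := h.exists_axis v
      obtain ⟨j, hj1, hj2, -, hj3, hj⟩ := hσ.modSV_eq F t
      obtain ⟨hn1, hn2⟩ := hn v hv
      rw [hj2] at hn1 hn2
      have p1 := hσ.stretch_pos j
      have p2 := hσ.stretch_pos (1 - j)
      have h3 : (coverNumber (δ * K) (listMap S v '' F) : ℝ) ≤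
          coverNumber (δ / stretch (listMap S v) j) (proj j '' F) := by
        exact_mod_cast h.coverNumber_image_le (fun x hx y hy => hR hx hy) hσ hδ hn2
      have h4 := hb j (δ / stretch (listMap S v) j) (by positivity)
        ((div_le_one p1).2 (hn1.trans hj3))
      refine h3.trans (h4.trans ?_)
      rw [ratio_rpow_eq hδ p1 p2 _ t, hj]
      have h5 := (rpow_bounds (x := δ / stretch (listMap S v) (1 - j)) hm
        (by rwa [le_div_iff₀ p2, ← le_div_iff₀' hm]) ((div_le_one p2).2 hn1)
        (t - projDim F j)).2
      have hw := hσ.weight_pos (projDim F) t j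
      have hδt := Real.rpow_pos_of_pos hδ (-t)
      calc _ = C j * (δ / stretch (listMap S v) (1 - j)) ^ (t - projDim F j) *
            (δ ^ (-t) * weight (projDim F) t (listMap S v) j) := by rw [weight]; ring
        _ ≤ C j * m ^ (-|t - projDim F j|) *
            (δ ^ (-t) * weight (projDim F) t (listMap S v) j) := by
              have := hC j
              gcongr
        _ ≤ D * (δ ^ (-t) * weight (projDim F) t (listMap S v) j) := by
              gcongr
              exact hDj j
        _ = _ := by ring
    calc (coverNumber (δ * K) F : ℝ) ≤ ∑ v ∈ V, (coverNumber (δ * K) (listMap S v '' F) : ℝ) := by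
          exact_mod_cast h1
      _ ≤ ∑ v ∈ V, D * δ ^ (-t) * modSV F t (listMap S v) := Finset.sum_le_sum h2
      _ = D * δ ^ (-t) * ∑ v ∈ V, modSV F t (listMap S v) := by rw [Finset.mul_sum]
      _ ≤ D * δ ^ (-t) * B := by
          have := Real.rpow_pos_of_pos hδ (-t)
          gcongr
          exact hcut _ n
      _ = _ := by ring
  refine upperBoxDim_le (C := D * B * K⁻¹ ^ (-t)) (by positivity) ?_ ?_
  · filter_upwards [eventually_small one_pos] with δ hδ
    exact coverNumber_pos hδ.1 h.isCompact.totallyBounded h.nonempty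
  · filter_upwards [eventually_small one_pos] with δ hδ
    have h1 := main (δ * K⁻¹) (mul_pos hδ.1 (inv_pos.2 hK0)) (by
      rw [← div_eq_mul_inv, div_le_one hK0]; exact hδ.2.le.trans hK1)
    rw [inv_mul_cancel_right₀ hK0.ne', Real.mul_rpow hδ.1.le (inv_nonneg.2 hK0.le)] at h1
    linarith

theorem upperBoxDim_le_of_pressure (h : BoxLikeSystem S F m M) {p : ℝ → ℝ}
    (hp : ∀ t, Tendsto (fun k : ℕ => Real.log (Psi S F k t) / k) atTop (𝓝 (p t)))
    (hanti : StrictAnti p) {s : ℝ} (hs : p s = 0) : upperBoxDim F ≤ s := by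
  have hne := h.nonempty_index
  refine EReal.le_of_forall_lt_iff_le.1 fun t ht => ?_
  have ht' : s < t := by exact_mod_cast ht
  obtain ⟨c, C, hw⟩ := h.exists_isTreeWeight t
  obtain ⟨B, hB, hcut⟩ := hw.exists_sum_cut_le (by simpa only [Psi_eq_levelSum] using hp t)
    (hs ▸ hanti ht')
  exact h.upperBoxDim_le_of_sum_cut hB hcut

end BoxLikeSystem

/-! ### The rectangular open set condition and the lower bound -/

/-- A bounded number of pairwise disjoint squares of side `η` can be placed near a point: each of
them contains a point of a grid of mesh `η / 2`. -/
theorem card_le_of_disjoint_squares {κ : Type*} (V : Finset κ) (l : κ → Fin 2 → ℝ) {z : Fin 2 → ℝ}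
    {r η : ℝ} (hη : 0 < η) (hl : ∀ v ∈ V, ∀ k, |l v k - z k| ≤ r)
    (hdisj : ∀ u ∈ V, ∀ v ∈ V, u ≠ v → ¬ ∃ x : Fin 2 → ℝ,
      ∀ k, x k ∈ Set.Ioo (l u k) (l u k + η) ∧ x k ∈ Set.Ioo (l v k) (l v k + η)) :
    V.card ≤ (⌊4 * r / η⌋₊ + 1) ^ 2 := by
  set Q := ⌊4 * r / η⌋₊
  let n : κ → Fin 2 → ℕ := fun v k => ⌊(l v k - (z k - r)) / (η / 2)⌋₊
  have h0 : ∀ v ∈ V, ∀ k, 0 ≤ (l v k - (z k - r)) / (η / 2) := fun v hv k => by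
    have := (abs_le.1 (hl v hv k)).1
    exact div_nonneg (by linarith) (by positivity)
  have hn : ∀ v ∈ V, ∀ k, n v k < Q + 1 := fun v hv k => by
    refine Nat.lt_succ_of_le (Nat.floor_le_floor ?_)
    have := (abs_le.1 (hl v hv k)).2
    rw [div_le_div_iff₀ (by positivity) hη]
    nlinarith
  have hgrid : ∀ v ∈ V, ∀ k, z k - r + (n v k + 1) * (η / 2) ∈
      Set.Ioo (l v k) (l v k + η) := fun v hv k => by
    have h1 := Nat.floor_le (h0 v hv k)
    have h2 := Nat.lt_floor_add_one ((l v k - (z k - r)) / (η / 2))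
    rw [le_div_iff₀ (by positivity)] at h1
    rw [div_lt_iff₀ (by positivity)] at h2
    simp only [n]
    constructor <;> linarith
  have hinj : Set.InjOn n V := by
    intro u hu v hv huv
    by_contra hne
    refine hdisj u hu v hv hne ⟨fun k => z k - r + (n u k + 1) * (η / 2),
      fun k => ⟨hgrid u hu k, ?_⟩⟩
    have := hgrid v hv k
    rwa [← huv] at this
  have := Finset.card_le_card_of_injOn (s := V)
    (t := Fintype.piFinset fun _ : Fin 2 => Finset.range (Q + 1)) n
    (fun v hv => by
      simp only [Finset.mem_coe, Fintype.mem_piFinset, Finset.mem_range]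
      exact hn v hv) hinj
  simpa [Fintype.card_piFinset] using this

theorem exists_interval {u : ℝ} (hu : u ≠ 0) (c a b : ℝ) :
    ∃ p q : ℝ, q - p = |u| * (b - a) ∧ (∀ x ∈ Set.Icc a b, u * x + c ∈ Set.Icc p q) ∧
      ∀ y ∈ Set.Ioo p q, (y - c) / u ∈ Set.Ioo a b := by
  rcases lt_or_gt_of_ne hu with h | h
  · refine ⟨u * b + c, u * a + c, by rw [abs_of_neg h]; ring, fun x hx => ⟨?_, ?_⟩,
      fun y hy => ⟨?_, ?_⟩⟩
    · nlinarith [hx.2]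
    · nlinarith [hx.1]
    · rw [lt_div_iff_of_neg h]; linarith [hy.2]
    · rw [div_lt_iff_of_neg h]; linarith [hy.1]
  · refine ⟨u * a + c, u * b + c, by rw [abs_of_pos h]; ring, fun x hx => ⟨?_, ?_⟩,
      fun y hy => ⟨?_, ?_⟩⟩
    · nlinarith [hx.1]
    · nlinarith [hx.2]
    · rw [lt_div_iff₀ h]; linarith [hy.1]
    · rw [div_lt_iff₀ h]; linarith [hy.2]

/-- The image of a rectangle under an axis-preserving map is a rectangle with stretched sides. -/
theorem IsAxisMap.exists_rectangle {T : Plane →ᵃ[ℝ] Plane} {σ : Equiv.Perm (Fin 2)}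
    (hσ : IsAxisMap T σ) (a b : Fin 2 → ℝ) :
    ∃ p q : Fin 2 → ℝ, (∀ j, q (σ j) - p (σ j) = stretch T j * (b j - a j)) ∧
      (∀ x : Plane, (∀ j, x j ∈ Set.Icc (a j) (b j)) → ∀ k, T x k ∈ Set.Icc (p k) (q k)) ∧
      ∀ y : Plane, (∀ k, y k ∈ Set.Ioo (p k) (q k)) →
        ∃ x : Plane, (∀ j, x j ∈ Set.Ioo (a j) (b j)) ∧ T x = y := by
  obtain ⟨u, c, hs, hu, hT⟩ := hσ.exists_coeff
  choose p q h1 h2 h3 using fun j => exists_interval (hu j) (c j) (a j) (b j)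
  refine ⟨fun k => p (σ.symm k), fun k => q (σ.symm k), fun j => ?_, fun x hx k => ?_,
    fun y hy => ?_⟩
  · simp only [Equiv.symm_apply_apply]
    rw [h1, hs]
  · obtain ⟨j, rfl⟩ := σ.surjective k
    simp only [Equiv.symm_apply_apply]
    rw [hT]
    exact h2 j _ (hx j)
  · refine ⟨WithLp.toLp 2 fun j => (y (σ j) - c j) / u j, fun j => ?_, ?_⟩
    · have := hy (σ j)
      simp only [Equiv.symm_apply_apply] at this
      exact h3 j _ this
    · ext k
      obtain ⟨j, rfl⟩ := σ.surjective k
      rw [hT]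
      have := hu j
      field_simp
      ring

theorem IsAxisMap.injective {T : Plane →ᵃ[ℝ] Plane} {σ : Equiv.Perm (Fin 2)}
    (hσ : IsAxisMap T σ) : Function.Injective T := fun x y hxy => by
  have h1 := hσ.le_dist hσ.alpha₂_pos.le hσ.alpha₂_le x y
  rw [hxy, dist_self] at h1
  exact dist_le_zero.1 (nonpos_of_mul_nonpos_right h1 hσ.alpha₂_pos)

namespace BoxLikeSystem

variable {ι : Type*} {S : ι → Plane →ᵃ[ℝ] Plane} {F : Set Plane} {m M : ℝ}

theorem exists_word_length (h : BoxLikeSystem S F m M) {x : Plane} (hx : x ∈ F) (n : ℕ) :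
    ∃ w : List ι, w.length = n ∧ x ∈ listMap S w '' F := by
  induction n with
  | zero => exact ⟨[], rfl, x, hx, rfl⟩
  | succ n ih =>
    obtain ⟨w, hw, hxw⟩ := ih
    obtain ⟨i, hi⟩ := h.exists_mem_concat hxw
    exact ⟨w ++ [i], by simp [hw], hi⟩

theorem dist_listMap_le (h : BoxLikeSystem S F m M) (w : List ι) (x y : Plane) :
    dist (listMap S w x) (listMap S w y) ≤ M ^ w.length * dist x y := by
  obtain ⟨σ, hσ⟩ := h.exists_axis w
  exact hσ.dist_le (fun j => (hσ.le_alpha₁ j).trans (h.alpha₁_le_pow w)) x y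

theorem listMap_mem_of_invariant {O : Set Plane} (hO : ∀ i, S i '' O ⊆ O) (w : List ι) {x : Plane}
    (hx : x ∈ O) : listMap S w x ∈ O := by
  induction w with
  | nil => exact hx
  | cons i w ih => exact hO i ⟨_, ih, by simp [listMap]⟩

/-- The attractor lies in the closure of every non-empty forward invariant set. -/
theorem subset_closure_of_invariant (h : BoxLikeSystem S F m M) {O : Set Plane}
    (hO : ∀ i, S i '' O ⊆ O) (hne : O.Nonempty) : F ⊆ closure O := by
  obtain ⟨x₀, hx₀⟩ := hne
  obtain ⟨R, hR0, hR⟩ := h.isCompact.isBounded.subset_closedBall_lt 0 x₀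
  intro z hz
  refine Metric.mem_closure_iff.2 fun ε hε => ?_
  obtain ⟨n, hn⟩ := exists_pow_lt_of_lt_one (div_pos hε hR0) h.M_lt
  obtain ⟨w, hw, y, hy, rfl⟩ := h.exists_word_length hz n
  refine ⟨_, listMap_mem_of_invariant hO w hx₀, (h.dist_listMap_le w y x₀).trans_lt ?_⟩
  rw [hw]
  rw [lt_div_iff₀ hR0] at hn
  have := mul_le_mul_of_nonneg_left (Metric.mem_closedBall.1 (hR hy)) (pow_nonneg h.M_pos.le n)
  linarith

/-- If sets of diameter `δ` meet at most `K` cylinders of a cut, then the covering numbers of these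
cylinders sum to at most `K` times that of `F`. -/
theorem sum_coverNumber_le (h : BoxLikeSystem S F m M) {δ : ℝ} (hδ : 0 < δ) {K : ℕ}
    (V : Finset (List ι))
    (hK : ∀ U : Set Plane, Metric.ediam U ≤ ENNReal.ofReal δ → ∀ W ⊆ V,
      (∀ v ∈ W, (listMap S v '' F ∩ U).Nonempty) → W.card ≤ K) :
    ∑ v ∈ V, coverNumber δ (listMap S v '' F) ≤ coverNumber δ F * K := by
  classical
  obtain ⟨U, hU, hFU⟩ := exists_cover hδ h.isCompact.totallyBounded
  have h1 : ∀ v ∈ V, coverNumber δ (listMap S v '' F) ≤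
      (Finset.univ.filter fun k => (listMap S v '' F ∩ U k).Nonempty).card := fun v _ => by
    refine coverNumber_le_card _ U (fun k _ => hU k) fun x hx => ?_
    obtain ⟨k, hk⟩ := Set.mem_iUnion.1 (hFU (h.image_subset v hx))
    exact Set.mem_iUnion₂.2 ⟨k, Finset.mem_filter.2 ⟨Finset.mem_univ _, x, hx, hk⟩, hk⟩
  refine (Finset.sum_le_sum h1).trans ?_
  have h2 := Finset.sum_card_bipartiteAbove_eq_sum_card_bipartiteBelow (s := V)
    (t := (Finset.univ : Finset (Fin (coverNumber δ F))))
    fun v k => (listMap S v '' F ∩ U k).Nonempty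
  unfold Finset.bipartiteAbove Finset.bipartiteBelow at h2
  rw [h2]
  refine (Finset.sum_le_card_nsmul _ _ K fun k _ => ?_).trans (by simp)
  exact hK (U k) (hU k) _ (Finset.filter_subset _ _) fun v hv => (Finset.mem_filter.1 hv).2

variable [Fintype ι]

/-- Under the rectangular open set condition, the images of the open rectangle along two different
words of a cut are disjoint. -/
theorem disjoint_of_mem_cut (h : BoxLikeSystem S F m M) {O : Set Plane} (hO : ∀ i, S i '' O ⊆ O)
    (hd : ∀ i j, i ≠ j → Disjoint (S i '' O) (S j '' O)) {halt : List ι → Prop} {n : ℕ}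
    {u v : List ι} (hu : u ∈ cut halt n []) (hv : v ∈ cut halt n []) (huv : u ≠ v) :
    Disjoint (listMap S u '' O) (listMap S v '' O) := by
  obtain ⟨x, i, j, hij, ⟨u', rfl⟩, ⟨v', rfl⟩⟩ := cut_incomparable hu hv huv
  refine Set.disjoint_left.2 ?_
  rintro _ ⟨y, hy, rfl⟩ ⟨z, hz, hyz⟩
  obtain ⟨σ, hσ⟩ := h.exists_axis x
  rw [listMap_append, listMap_concat, listMap_append, listMap_concat] at hyz
  have h1 : S j (listMap S v' z) = S i (listMap S u' y) := hσ.injective hyz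
  exact Set.disjoint_left.1 (hd i j hij) ⟨_, listMap_mem_of_invariant hO u' hy, rfl⟩
    ⟨_, listMap_mem_of_invariant hO v' hz, h1⟩

/-- Under the rectangular open set condition, a set of diameter `δ` meets a bounded number of
cylinders whose smaller side is at least `δ`. -/
theorem exists_card_le_of_ROSC (h : BoxLikeSystem S F m M) (hR : ROSC S) :
    ∃ K : ℕ, 0 < K ∧ ∀ (δ : ℝ) (halt : List ι → Prop) (n : ℕ), 0 < δ →
      (∀ v ∈ cut halt n [], δ ≤ α₂ (listMap S v)) → ∀ U : Set Plane,
        Metric.ediam U ≤ ENNReal.ofReal δ → ∀ W ⊆ cut halt n [],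
          (∀ v ∈ W, (listMap S v '' F ∩ U).Nonempty) → W.card ≤ K := by
  obtain ⟨a₀, b₀, a₁, b₁, hab₀, hab₁, hO, hd⟩ := hR
  set a : Fin 2 → ℝ := ![a₀, a₁] with ha
  set b : Fin 2 → ℝ := ![b₀, b₁] with hb
  have hab : ∀ j, a j < b j := by
    rw [Fin.forall_fin_two]; exact ⟨hab₀, hab₁⟩
  set O := openRect a₀ b₀ a₁ b₁ with hOdef
  have hmemO : ∀ x : Plane, x ∈ O ↔ ∀ j, x j ∈ Set.Ioo (a j) (b j) := fun x => by
    rw [Fin.forall_fin_two]; rfl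
  have hne : O.Nonempty := by
    refine ⟨WithLp.toLp 2 fun j => (a j + b j) / 2, (hmemO _).2 fun j => ?_⟩
    have := hab j
    constructor <;> simp <;> linarith
  have hFO : ∀ x ∈ F, ∀ j, x j ∈ Set.Icc (a j) (b j) := fun x hx j => by
    have h1 := h.subset_closure_of_invariant hO hne hx
    have h2 : closure O ⊆ proj j ⁻¹' Set.Icc (a j) (b j) :=
      closure_minimal (fun y hy => Set.Ioo_subset_Icc_self ((hmemO y).1 hy j))
        (isClosed_Icc.preimage (continuous_proj j))
    exact h2 h1
  obtain ⟨ℓ, hℓ0, hℓ1, hℓ⟩ : ∃ ℓ : ℝ, 0 < ℓ ∧ ℓ ≤ 1 ∧ ∀ j, ℓ ≤ b j - a j := by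
    refine ⟨min 1 (min (b₀ - a₀) (b₁ - a₁)), ?_, min_le_left _ _, ?_⟩
    · exact lt_min one_pos (lt_min (by linarith) (by linarith))
    · rw [Fin.forall_fin_two]
      exact ⟨(min_le_right _ _).trans (min_le_left _ _),
        (min_le_right _ _).trans (min_le_right _ _)⟩
  refine ⟨(⌊8 / ℓ⌋₊ + 1) ^ 2, by positivity, ?_⟩
  intro δ halt n hδ hδα U hU W hW hWU
  rcases W.eq_empty_or_nonempty with rfl | ⟨v₀, hv₀⟩
  · simp
  choose! y hy using hWU
  set η := δ * ℓ with hη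
  have hη0 : 0 < η := by positivity
  choose σ hσ using h.exists_axis
  choose p q h1 h2 h3 using fun v => (hσ v).exists_rectangle a b
  have hsize : ∀ v ∈ W, ∀ k, η ≤ q v k - p v k := fun v hv k => by
    obtain ⟨j, rfl⟩ := (σ v).surjective k
    rw [h1]
    exact mul_le_mul ((hδα v (hW hv)).trans ((hσ v).alpha₂_le j)) (hℓ j) hℓ0.le
      ((hσ v).stretch_pos j).le
  have hyIcc : ∀ v ∈ W, ∀ k, y v k ∈ Set.Icc (p v k) (q v k) := fun v hv k => by
    obtain ⟨⟨x, hx, hxy⟩, -⟩ := hy v hv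
    rw [← hxy]
    exact h2 v x (hFO x hx) k
  -- A corner of a square of side `η` inside the image of the rectangle and close to `y v`.
  let l : List ι → Fin 2 → ℝ := fun v k => max (p v k) (y v k - η)
  have hl : ∀ v ∈ W, ∀ k, p v k ≤ l v k ∧ l v k + η ≤ q v k ∧ |l v k - y v k| ≤ η :=
    fun v hv k => by
      have e1 := hyIcc v hv k
      have e2 := hsize v hv k
      refine ⟨le_max_left _ _, ?_, ?_⟩
      · rw [← le_sub_iff_add_le]
        exact max_le (by linarith) (by linarith [e1.2])
      · rw [abs_le]
        have e3 : l v k ≤ y v k := max_le e1.1 (by linarith)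
        have e4 : y v k - η ≤ l v k := le_max_right _ _
        constructor <;> linarith
  have hcard := card_le_of_disjoint_squares W l (z := fun k => y v₀ k) (r := 2 * δ) hη0 ?_ ?_
  · rwa [show 4 * (2 * δ) / η = 8 / ℓ by rw [hη]; field_simp; norm_num] at hcard
  · intro v hv k
    have e1 := (hl v hv k).2.2
    have e2 := (abs_coord_sub_le (y v) (y v₀) k).trans
      (dist_le_of_ediam_le hδ.le hU (hy v hv).2 (hy v₀ hv₀).2)
    have e3 : η ≤ δ := mul_le_of_le_one_right hδ.le hℓ1
    have e4 := abs_sub_le (l v k) (y v k) (y v₀ k)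
    linarith
  · rintro u hu v hv huv ⟨x, hx⟩
    have hmem : ∀ w ∈ W, (∀ k, x k ∈ Set.Ioo (l w k) (l w k + η)) →
        WithLp.toLp 2 x ∈ listMap S w '' O := fun w hw hxw => by
      obtain ⟨x', hx', hTx'⟩ := h3 w (WithLp.toLp 2 x) fun k =>
        ⟨(hl w hw k).1.trans_lt (hxw k).1, (hxw k).2.trans_le (hl w hw k).2.1⟩
      exact ⟨x', (hmemO x').2 hx', hTx'⟩
    exact Set.disjoint_left.1 (h.disjoint_of_mem_cut hO hd (hW hu) (hW hv) huv)
      (hmem u hu fun k => (hx k).1) (hmem v hv fun k => (hx k).2)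

/-- The stopped cylinders are at least as hard to cover as their longer sides, and no set of
diameter `δ` serves more than a bounded number of them. -/
theorem le_lowerBoxDim_of_le_sum_cut (h : BoxLikeSystem S F m M) (hR : ROSC S) {t ε A : ℝ}
    (hε : 0 < ε) (hA : 0 < A)
    (hcut : ∀ (halt : List ι → Prop) n, A ≤ ∑ v ∈ cut halt n [], modSV F t (listMap S v)) :
    ((t - ε : ℝ) : EReal) ≤ lowerBoxDim F := by
  have hm := h.m_pos
  obtain ⟨K, hK0, hK⟩ := h.exists_card_le_of_ROSC hR
  choose c hc hb using fun j => (h.hasPowerGrowth_proj j).lower ε hε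
  obtain ⟨j₀, hj₀⟩ := Finite.exists_min fun j : Fin 2 => c j * m ^ |t - projDim F j|
  set D := c j₀ * m ^ |t - projDim F j₀| with hD
  have hD0 : 0 < D := mul_pos (hc j₀) (Real.rpow_pos_of_pos hm _)
  have hK0' : (0 : ℝ) < K := by exact_mod_cast hK0
  refine le_lowerBoxDim (C := D * A / K) (by positivity) ?_
  filter_upwards [eventually_small one_pos] with δ hδ'
  obtain ⟨hδ, hδ1⟩ := hδ'
  obtain ⟨n, hn⟩ := h.exists_cut hδ hδ1.le
  set V := cut (fun w => α₂ (listMap S w) ≤ δ / m) n [] with hV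
  have h1 : ∀ v ∈ V, D * δ ^ (-(t - ε)) * modSV F t (listMap S v) ≤
      (coverNumber δ (listMap S v '' F) : ℝ) := by
    intro v hv
    obtain ⟨σ, hσ⟩ := h.exists_axis v
    obtain ⟨j, hj1, hj2, -, hj3, hj⟩ := hσ.modSV_eq F t
    obtain ⟨hn1, hn2⟩ := hn v hv
    have ha1 := h.alpha₁_le_pow v
    rw [hj2] at hn1 hn2
    rw [hj1] at ha1
    have p1 := hσ.stretch_pos j
    have p2 := hσ.stretch_pos (1 - j)
    have ha1' : stretch (listMap S v) j ≤ 1 := ha1.trans (pow_le_one₀ h.M_pos.le h.M_lt.le)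
    have h3 : (coverNumber (δ / stretch (listMap S v) j) (proj j '' F) : ℝ) ≤
        coverNumber δ (listMap S v '' F) := by
      exact_mod_cast h.le_coverNumber_image hσ hδ j
    have h4 := hb j (δ / stretch (listMap S v) j) (by positivity)
      ((div_le_one p1).2 (hn1.trans hj3))
    refine le_trans ?_ (h4.trans h3)
    have h5 := (rpow_bounds (x := δ / stretch (listMap S v) (1 - j)) hm
      (by rwa [le_div_iff₀ p2, ← le_div_iff₀' hm]) ((div_le_one p2).2 hn1)
      (t - projDim F j)).1
    have hw := hσ.weight_pos (projDim F) t j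
    have hδt := Real.rpow_pos_of_pos hδ (-t)
    have hδε := Real.rpow_pos_of_pos hδ ε
    have h6 : δ ^ ε ≤ (δ / stretch (listMap S v) j) ^ ε :=
      Real.rpow_le_rpow hδ.le
        (by rw [le_div_iff₀ p1]; exact mul_le_of_le_one_right hδ.le ha1') hε.le
    rw [show -(t - ε) = ε + -t by ring, Real.rpow_add hδ,
      show -(projDim F j - ε) = ε + -projDim F j by ring, Real.rpow_add (by positivity),
      ratio_rpow_eq hδ p1 p2 _ t, hj]
    have hcj := hc j
    calc D * (δ ^ ε * δ ^ (-t)) * weight (projDim F) t (listMap S v) j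
        ≤ c j * m ^ |t - projDim F j| * (δ ^ ε * δ ^ (-t)) *
          weight (projDim F) t (listMap S v) j := by
            gcongr
            exact hj₀ j
      _ ≤ c j * (δ / stretch (listMap S v) (1 - j)) ^ (t - projDim F j) *
          ((δ / stretch (listMap S v) j) ^ ε * δ ^ (-t)) *
          weight (projDim F) t (listMap S v) j := by gcongr
      _ = _ := by rw [weight]; ring
  have h2 : ∑ v ∈ V, (coverNumber δ (listMap S v '' F) : ℝ) ≤ coverNumber δ F * K := by
    exact_mod_cast h.sum_coverNumber_le hδ V fun U hU W hW hWU =>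
      hK δ _ n hδ (fun v hv => (hn v hv).1) U hU W hW hWU
  rw [div_mul_eq_mul_div, div_le_iff₀ hK0']
  refine le_trans ?_ ((Finset.sum_le_sum h1).trans h2)
  rw [← Finset.mul_sum]
  have := Real.rpow_pos_of_pos hδ (-(t - ε))
  calc D * A * δ ^ (-(t - ε)) = D * δ ^ (-(t - ε)) * A := by ring
    _ ≤ _ := by gcongr; exact hcut _ n

theorem le_lowerBoxDim_of_pressure (h : BoxLikeSystem S F m M) (hR : ROSC S) {p : ℝ → ℝ}
    (hp : ∀ t, Tendsto (fun k : ℕ => Real.log (Psi S F k t) / k) atTop (𝓝 (p t)))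
    (hanti : StrictAnti p) {s : ℝ} (hs : p s = 0) : s ≤ lowerBoxDim F := by
  have hne := h.nonempty_index
  refine EReal.ge_of_forall_gt_iff_ge.1 fun z hz => ?_
  have hz' : z < s := by exact_mod_cast hz
  obtain ⟨c, C, hw⟩ := h.exists_isTreeWeight ((z + s) / 2)
  obtain ⟨A, hA, hcut⟩ := hw.exists_le_sum_cut (by simpa only [Psi_eq_levelSum] using hp _)
    (hs ▸ hanti (show (z + s) / 2 < s by linarith))
  have := h.le_lowerBoxDim_of_le_sum_cut hR (ε := (s - z) / 2) (by linarith) hA hcut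
  rwa [show (z + s) / 2 - (s - z) / 2 = z by ring] at this

end BoxLikeSystem

/-! ### Packing dimension -/

section Packing

variable {X : Type*} [MetricSpace X] {A F : Set X}

theorem zero_le_upperBoxDim (hA : TotallyBounded A) (hne : A.Nonempty) : 0 ≤ upperBoxDim A := by
  refine le_trans ?_ lowerBoxDim_le_upperBoxDim
  have := le_lowerBoxDim (A := A) (C := 1) (d := 0) one_pos (by
    filter_upwards [eventually_small one_pos] with δ hδ
    simpa using coverNumber_pos hδ.1 hA hne)
  exact_mod_cast this

theorem packingPre_empty (t : NNReal) : packingPre t (∅ : Set X) = 0 := by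
  refine le_antisymm ((iInf₂_le (1 : ℝ) one_pos).trans ?_) zero_le
  refine iSup₂_le fun C hC => ?_
  have : C = ∅ := Set.eq_empty_of_forall_notMem fun p hp => (hC.2.1 p hp).1
  subst this
  simp

/-- The centres of a packing with radii comparable to `2 * ρ` are `ρ`-separated. -/
theorem IsPacking.card_le {δ ρ : ℝ} {C : Set (X × ℝ)} (hC : IsPacking δ A C) (hρ : 0 < ρ)
    (hA : TotallyBounded A) (s : Finset (X × ℝ)) (hs : ↑s ⊆ C) (hr : ∀ p ∈ s, ρ < p.2) :
    s.card ≤ coverNumber ρ A := by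
  classical
  have hsep : ∀ p ∈ s, ∀ q ∈ s, p ≠ q → ρ < dist p.1 q.1 := fun p hp q hq hpq => by
    by_contra hle
    rw [not_lt] at hle
    have h1 : q.1 ∈ Metric.closedBall p.1 p.2 := by
      rw [Metric.mem_closedBall, dist_comm]
      exact hle.trans (hr p hp).le
    have h2 : q.1 ∈ Metric.closedBall q.1 q.2 :=
      Metric.mem_closedBall_self (hC.1 q (hs hq)).2.1.le
    exact Set.disjoint_left.1 (hC.2 (hs hp) (hs hq) hpq) h1 h2
  have hinj : Set.InjOn Prod.fst (s : Set (X × ℝ)) := fun p hp q hq hpq => by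
    by_contra hne
    have := hsep p hp q hq hne
    rw [hpq, dist_self] at this
    linarith
  rw [← Finset.card_image_of_injOn hinj]
  refine card_le_coverNumber hρ hA ?_ ?_
  · intro x hx
    obtain ⟨p, hp, rfl⟩ := Finset.mem_image.1 (Finset.mem_coe.1 hx)
    exact (hC.1 p (hs hp)).1
  · intro x hx y hy hxy
    obtain ⟨p, hp, rfl⟩ := Finset.mem_image.1 hx
    obtain ⟨q, hq, rfl⟩ := Finset.mem_image.1 hy
    exact hsep p hp q hq fun h => hxy (by rw [h])

/-- Sorting the balls of a packing by the size of their radii on a dyadic scale. -/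
theorem packingMeasure_ne_top (hA : TotallyBounded A) {t : NNReal} {r : ℝ} (hrt : r < t)
    {δ₀ : ℝ} (hδ₀ : 0 < δ₀) (hδ₁ : δ₀ ≤ 1)
    (hN : ∀ δ, 0 < δ → δ < δ₀ → (coverNumber δ A : ℝ) ≤ δ ^ (-r)) :
    packingMeasure t A ≠ ⊤ := by
  classical
  set q : ℝ := (1 / 2 : ℝ) ^ ((t : ℝ) - r) with hq
  have hq0 : 0 < q := Real.rpow_pos_of_pos (by norm_num) _
  have hq1 : q < 1 := Real.rpow_lt_one (by norm_num) (by norm_num) (by linarith)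
  set G : ℝ := ∑' k : ℕ, (4 : ℝ) ^ (t : ℝ) * (q * q ^ k) with hG
  have hsumm : Summable fun k : ℕ => (4 : ℝ) ^ (t : ℝ) * (q * q ^ k) :=
    ((summable_geometric_of_lt_one hq0.le hq1).mul_left q).mul_left _
  have hpre : packingPreDelta t δ₀ A ≤ ENNReal.ofReal G := by
    refine iSup₂_le fun C hC => ?_
    rw [ENNReal.tsum_eq_iSup_sum]
    refine iSup_le fun s => ?_
    have hpos : ∀ p : C, 0 < 2 * (p : X × ℝ).2 := fun p => by
      have := (hC.2.1 p p.2).2.1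
      linarith
    have hconv : ∀ p : C, ENNReal.ofReal (2 * (p : X × ℝ).2) ^ (t : ℝ) =
        ENNReal.ofReal ((2 * (p : X × ℝ).2) ^ (t : ℝ)) := fun p =>
      ENNReal.ofReal_rpow_of_pos (hpos p)
    simp only [hconv]
    rw [← ENNReal.ofReal_sum_of_nonneg fun p _ => Real.rpow_nonneg (hpos p).le _]
    refine ENNReal.ofReal_le_ofReal ?_
    have hκ : ∀ p : C, ∃ k : ℕ, (1 / 2 : ℝ) ^ (k + 1) < (p : X × ℝ).2 ∧
        (p : X × ℝ).2 ≤ (1 / 2 : ℝ) ^ k := fun p =>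
      exists_nat_pow_near_of_lt_one (hC.2.1 p p.2).2.1 ((hC.2.1 p p.2).2.2.trans hδ₁)
        (by norm_num) (by norm_num)
    choose κ hκ1 hκ2 using hκ
    have hfib : ∀ k, ∑ p ∈ s with κ p = k, (2 * (p : X × ℝ).2) ^ (t : ℝ) ≤
        (4 : ℝ) ^ (t : ℝ) * (q * q ^ k) := by
      intro k
      rcases (s.filter fun p => κ p = k).eq_empty_or_nonempty with he | ⟨p₀, hp₀⟩
      · rw [he, Finset.sum_empty]; positivity
      set ρ : ℝ := (1 / 2 : ℝ) ^ (k + 1) with hρ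
      have hρ0 : 0 < ρ := by positivity
      have hp₀' := (Finset.mem_filter.1 hp₀).2
      have hρδ : ρ < δ₀ := by
        have := hκ1 p₀
        rw [hp₀'] at this
        exact this.trans_le (hC.2.1 p₀ p₀.2).2.2
      have hcard := hC.2.card_le hρ0 hA ((s.filter fun p => κ p = k).map
        (Function.Embedding.subtype _)) (fun x hx => by
          obtain ⟨p, -, rfl⟩ := Finset.mem_map.1 (Finset.mem_coe.1 hx)
          exact p.2) (fun x hx => by
          obtain ⟨p, hp, rfl⟩ := Finset.mem_map.1 hx
          have := hκ1 p
          rwa [(Finset.mem_filter.1 hp).2] at this)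
      rw [Finset.card_map] at hcard
      have hcard' : ((s.filter fun p => κ p = k).card : ℝ) ≤ ρ ^ (-r) :=
        le_trans (by exact_mod_cast hcard) (hN ρ hρ0 hρδ)
      have hterm : ∀ p ∈ s.filter fun p => κ p = k,
          (2 * (p : X × ℝ).2) ^ (t : ℝ) ≤ (4 * ρ) ^ (t : ℝ) := fun p hp => by
        refine Real.rpow_le_rpow (hpos p).le ?_ t.2
        have := hκ2 p
        rw [(Finset.mem_filter.1 hp).2] at this
        rw [hρ, pow_succ]
        linarith
      refine (Finset.sum_le_card_nsmul _ _ _ hterm).trans ?_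
      rw [nsmul_eq_mul]
      refine (mul_le_mul_of_nonneg_right hcard' (by positivity)).trans_eq ?_
      rw [Real.mul_rpow (by norm_num) hρ0.le, mul_left_comm, ← Real.rpow_add hρ0, hq, ← pow_succ',
        hρ, ← Real.rpow_natCast, ← Real.rpow_mul (by norm_num), ← Real.rpow_natCast,
        ← Real.rpow_mul (by norm_num)]
      congr 2
      ring
    calc ∑ p ∈ s, (2 * (p : X × ℝ).2) ^ (t : ℝ)
        = ∑ k ∈ s.image κ, ∑ p ∈ s with κ p = k, (2 * (p : X × ℝ).2) ^ (t : ℝ) :=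
          (Finset.sum_fiberwise_of_maps_to (fun p hp => Finset.mem_image_of_mem κ hp) _).symm
      _ ≤ ∑ k ∈ s.image κ, (4 : ℝ) ^ (t : ℝ) * (q * q ^ k) := Finset.sum_le_sum fun k _ => hfib k
      _ ≤ G := hsumm.sum_le_tsum _ fun k _ => by positivity
  have hle : packingMeasure t A ≤ packingPre t A := by
    refine (iInf₂_le (fun n : ℕ => if n = 0 then A else ∅) ?_).trans ?_
    · exact fun x hx => Set.mem_iUnion.2 ⟨0, by simpa using hx⟩
    · rw [tsum_eq_single 0]
      · simp
      · intro n hn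
        simp [hn, packingPre_empty]
  exact ((hle.trans (iInf₂_le δ₀ hδ₀)).trans hpre).trans_lt ENNReal.ofReal_lt_top |>.ne

theorem packingDim_le_upperBoxDim (hA : TotallyBounded A) (hne : A.Nonempty) :
    ((packingDim A : ENNReal) : EReal) ≤ upperBoxDim A := by
  have h0 := zero_le_upperBoxDim hA hne
  rw [← EReal.coe_toENNReal h0, EReal.coe_ennreal_le_coe_ennreal_iff]
  refine iSup₂_le fun t ht => ?_
  rw [← EReal.coe_ennreal_le_coe_ennreal_iff, EReal.coe_toENNReal h0]
  by_contra hlt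
  rw [not_le] at hlt
  obtain ⟨r, hr1, hr2⟩ := EReal.lt_iff_exists_real_btwn.1 hlt
  have hrt : r < t := by rwa [EReal.coe_nnreal_eq_coe_real, EReal.coe_lt_coe_iff] at hr2
  have hev := (eventually_lt_of_limsup_lt hr1).and (eventually_small one_pos)
  obtain ⟨δ₀, hδ₀, hmem⟩ := mem_nhdsGT_iff_exists_Ioo_subset.1 hev
  refine packingMeasure_ne_top hA hrt (δ₀ := min δ₀ 1) (lt_min hδ₀ one_pos) (min_le_right _ _)
    (fun δ hδ hδ' => ?_) ht
  obtain ⟨h1, h2⟩ := hmem ⟨hδ, hδ'.trans_le (min_le_left _ _)⟩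
  have h1' : Real.log (coverNumber δ A) / (-Real.log δ) < r := by exact_mod_cast h1
  have hlog := Real.log_neg h2.1 h2.2
  rw [div_lt_iff₀ (by linarith), Real.log_lt_iff_lt_exp
    (by exact_mod_cast coverNumber_pos hδ hA hne)] at h1'
  rw [Real.rpow_def_of_pos hδ]
  refine h1'.le.trans_eq ?_
  congr 1
  ring

/-- If the points of `F` near some point all lie in the closure of `U`, and covering numbers of `F`
there exceed `δ ^ (-r)` at arbitrarily small scales, then `U` has large packings. -/
theorem packingPre_eq_top {U : Set X} {t : NNReal} {r : ℝ} (htr : t < r) {B : Set X}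
    (hB : TotallyBounded B) (hBU : B ⊆ closure U)
    (hfreq : ∃ᶠ δ : ℝ in 𝓝[>] 0, δ ^ (-r) ≤ (coverNumber δ B : ℝ)) :
    packingPre t U = ⊤ := by
  classical
  refine iInf₂_eq_top.2 fun δ₀ hδ₀ => ENNReal.eq_top_of_forall_nnreal_le fun b => ?_
  have hlim : Tendsto (fun δ : ℝ => (1 / 4 : ℝ) ^ (t : ℝ) * δ ^ ((t : ℝ) - r)) (𝓝[>] 0) atTop :=
    (tendsto_rpow_neg_nhdsGT_zero (by linarith)).const_mul_atTop
      (Real.rpow_pos_of_pos (by norm_num) _)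
  obtain ⟨δ, hδN, ⟨hδ, hδδ₀⟩, hδb⟩ := (hfreq.and_eventually
    ((eventually_small (show 0 < 8 * δ₀ by positivity)).and
      (hlim.eventually_ge_atTop (b : ℝ)))).exists
  obtain ⟨s, hsB, hs, hscard⟩ := exists_separated (half_pos hδ) hB
  rw [mul_div_cancel₀ _ two_ne_zero] at hscard
  have hclose : ∀ x : s, ∃ y ∈ U, dist (x : X) y < δ / 16 := fun x =>
    Metric.mem_closure_iff.1 (hBU (hsB x.2)) _ (by positivity)
  choose g hgU hg using hclose
  have hsep : ∀ x y : s, x ≠ y → δ / 4 < dist (g x) (g y) := fun x y hxy => by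
    have h1 := hs x x.2 y y.2 fun h => hxy (Subtype.ext h)
    have h2 := dist_triangle4 (x : X) (g x) (g y) y
    rw [dist_comm (g y)] at h2
    linarith [hg x, hg y]
  have hinj : Function.Injective fun x : s => (g x, δ / 8) := fun x y hxy => by
    by_contra hne
    have := hsep x y hne
    rw [(Prod.mk.inj hxy).1, dist_self] at this
    linarith
  have hpack : IsPacking δ₀ U (Set.range fun x : s => (g x, δ / 8)) := by
    constructor
    · rintro _ ⟨x, rfl⟩
      exact ⟨hgU x, by positivity, by simp only; linarith⟩
    · rintro _ ⟨x, rfl⟩ _ ⟨y, rfl⟩ hxy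
      refine Metric.closedBall_disjoint_closedBall ?_
      have := hsep x y fun h => hxy (by rw [h])
      simp only
      linarith
  refine le_trans ?_ (le_iSup₂ (f := fun (C : Set (X × ℝ)) (_ : C.Countable ∧ IsPacking δ₀ U C) =>
    ∑' p : C, ENNReal.ofReal (2 * (p : X × ℝ).2) ^ (t : ℝ)) _ ⟨Set.countable_range _, hpack⟩)
  rw [tsum_range (fun p : X × ℝ => ENNReal.ofReal (2 * p.2) ^ (t : ℝ)) hinj, tsum_fintype]
  simp only [Finset.sum_const, Finset.card_univ, Fintype.card_coe, nsmul_eq_mul]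
  rw [ENNReal.ofReal_rpow_of_pos (by positivity), ← ENNReal.ofReal_natCast,
    ← ENNReal.ofReal_mul (by positivity), ← ENNReal.ofReal_coe_nnreal]
  refine ENNReal.ofReal_le_ofReal (hδb.trans ?_)
  have hcard : δ ^ (-r) ≤ s.card := hδN.trans (by exact_mod_cast hscard)
  calc (1 / 4 : ℝ) ^ (t : ℝ) * δ ^ ((t : ℝ) - r)
      = δ ^ (-r) * (2 * (δ / 8)) ^ (t : ℝ) := by
        rw [show 2 * (δ / 8) = 1 / 4 * δ by ring, Real.mul_rpow (by norm_num) hδ.le, sub_eq_add_neg,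
          Real.rpow_add hδ]
        ring
    _ ≤ _ := by gcongr

/-- By Baire's theorem, one set of any countable cover of a compact set `F` is dense in a relatively
open part of `F`; so the packing measure is infinite if every such part is large. -/
theorem packingMeasure_eq_top (hF : IsCompact F) (hne : F.Nonempty) {t : NNReal} {r : ℝ}
    (htr : t < r) (hloc : ∀ x ∈ F, ∀ ε > 0,
      ∃ᶠ δ : ℝ in 𝓝[>] 0, δ ^ (-r) ≤ (coverNumber δ (F ∩ Metric.ball x ε) : ℝ)) :
    packingMeasure t F = ⊤ := by
  refine iInf₂_eq_top.2 fun U hU => ?_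
  have : CompactSpace F := isCompact_iff_compactSpace.1 hF
  have : Nonempty F := hne.to_subtype
  obtain ⟨n, ⟨x, hx⟩, hxn⟩ := nonempty_interior_of_iUnion_of_closed
    (f := fun n => (Subtype.val : F → X) ⁻¹' closure (U n))
    (fun n => isClosed_closure.preimage continuous_subtype_val)
    (Set.eq_univ_of_forall fun x => by
      obtain ⟨n, hn⟩ := Set.mem_iUnion.1 (hU x.2)
      exact Set.mem_iUnion.2 ⟨n, subset_closure hn⟩)
  obtain ⟨ε, hε, hball⟩ := Metric.mem_nhds_iff.1 (mem_interior_iff_mem_nhds.1 hxn)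
  have htop : packingPre t (U n) = ⊤ := by
    refine packingPre_eq_top htr (hF.totallyBounded.subset Set.inter_subset_left) ?_
      (hloc x hx ε hε)
    rintro y ⟨hyF, hy⟩
    exact hball (a := ⟨y, hyF⟩) hy
  exact ENNReal.tsum_eq_top_of_eq_top ⟨n, htop⟩

end Packing

namespace BoxLikeSystem

variable {ι : Type*} {S : ι → Plane →ᵃ[ℝ] Plane} {F : Set Plane} {m M : ℝ}

/-- Every relatively open part of the attractor contains an invertible affine image of the whole
attractor, and so is at least as large at small scales. -/
theorem frequently_coverNumber_inter_ball (h : BoxLikeSystem S F m M) {r : ℝ}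
    (hr : (r : EReal) < upperBoxDim F) {x : Plane} (hx : x ∈ F) {ε : ℝ} (hε : 0 < ε) :
    ∃ᶠ δ : ℝ in 𝓝[>] 0, δ ^ (-r) ≤ (coverNumber δ (F ∩ Metric.ball x ε) : ℝ) := by
  obtain ⟨r', hr1, hr2⟩ := EReal.lt_iff_exists_real_btwn.1 hr
  have hrr' : r < r' := by exact_mod_cast hr1
  obtain ⟨R, hR0, hR⟩ := h.isCompact.isBounded.subset_closedBall_lt 0 x
  obtain ⟨n, hn⟩ := exists_pow_lt_of_lt_one (show 0 < ε / (2 * R) by positivity) h.M_lt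
  obtain ⟨w, hw, y, hy, hyx⟩ := h.exists_word_length hx n
  obtain ⟨σ, hσ⟩ := h.exists_axis w
  set a := α₂ (listMap S w) with ha
  have ha0 : 0 < a := h.alpha₂_pos w
  have hsub : listMap S w '' F ⊆ F ∩ Metric.ball x ε := by
    rintro _ ⟨z, hz, rfl⟩
    refine ⟨h.maps_listMap w hz, ?_⟩
    rw [Metric.mem_ball]
    conv_lhs => rw [← hyx]
    have h1 := h.dist_listMap_le w z y
    have h2 := dist_triangle_right z y x
    have h3 := Metric.mem_closedBall.1 (hR hz)
    have h4 := Metric.mem_closedBall.1 (hR hy)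
    have h5 := pow_pos h.M_pos n
    rw [hw] at h1
    rw [lt_div_iff₀ (by positivity)] at hn
    have h6 : M ^ n * dist z y ≤ M ^ n * (2 * R) := by gcongr; linarith
    linarith
  have hscale : Tendsto (fun δ : ℝ => a * δ) (𝓝[>] 0) (𝓝[>] 0) := by
    refine tendsto_nhdsWithin_iff.2 ⟨?_, ?_⟩
    · simpa using ((continuous_const_mul a).tendsto 0).mono_left nhdsWithin_le_nhds
    · filter_upwards [self_mem_nhdsWithin] with δ hδ
      exact mul_pos ha0 hδ
  refine hscale.frequently ?_
  have hlim := (tendsto_rpow_neg_nhdsGT_zero (show r - r' < 0 by linarith)).eventually_ge_atTop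
    (a ^ (-r))
  refine ((frequently_lt_of_lt_limsup (by isBoundedDefault) hr2).and_eventually
    ((eventually_small one_pos).and hlim)).mono ?_
  rintro δ ⟨h1, hδ, h2⟩
  have h1' : r' < Real.log (coverNumber δ F) / (-Real.log δ) := by exact_mod_cast h1
  have hlog := Real.log_neg hδ.1 hδ.2
  rw [lt_div_iff₀ (by linarith), Real.lt_log_iff_exp_lt
    (by exact_mod_cast coverNumber_pos hδ.1 h.isCompact.totallyBounded h.nonempty)] at h1'
  have h3 : δ ^ (-r') ≤ (coverNumber δ F : ℝ) := by
    rw [Real.rpow_def_of_pos hδ.1]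
    refine le_trans (le_of_eq ?_) h1'.le
    congr 1
    ring
  have h4 : coverNumber δ F ≤ coverNumber (a * δ) (listMap S w '' F) := by
    have h5 := BoxLike.coverNumber_image_le (g := id) (h := listMap S w) (B := F) (K := a⁻¹)
      (L := 0) (mul_pos ha0 hδ.1) (inv_nonneg.2 ha0.le) (h.totallyBounded_image _)
      fun u _ v _ => by
        rw [add_zero, inv_mul_eq_div, le_div_iff₀ ha0, mul_comm]
        exact hσ.le_dist ha0.le hσ.alpha₂_le u v
    rwa [Set.image_id, add_zero, inv_mul_cancel_left₀ ha0.ne'] at h5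
  have h6 := h4.trans (coverNumber_mono (mul_pos ha0 hδ.1) le_rfl hsub
    (h.isCompact.totallyBounded.subset Set.inter_subset_left))
  calc (a * δ) ^ (-r) = a ^ (-r) * δ ^ (-r) := Real.mul_rpow ha0.le hδ.1.le
    _ ≤ δ ^ (r - r') * δ ^ (-r) := by
        have := Real.rpow_pos_of_pos hδ.1 (-r)
        gcongr
    _ = δ ^ (-r') := by rw [← Real.rpow_add hδ.1]; congr 1; ring
    _ ≤ _ := h3.trans (by exact_mod_cast h6)

theorem packingDim_eq_upperBoxDim (h : BoxLikeSystem S F m M) :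
    ((packingDim F : ENNReal) : EReal) = upperBoxDim F := by
  refine le_antisymm (packingDim_le_upperBoxDim h.isCompact.totallyBounded h.nonempty) ?_
  refine EReal.ge_of_forall_gt_iff_ge.1 fun z hz => ?_
  rcases lt_or_ge z 0 with hz0 | hz0
  · exact le_trans (by exact_mod_cast hz0.le) (EReal.coe_ennreal_nonneg _)
  · obtain ⟨r, hr1, hr2⟩ := EReal.lt_iff_exists_real_btwn.1 hz
    have hzr : z < r := by exact_mod_cast hr1
    lift z to NNReal using hz0
    have htop := packingMeasure_eq_top h.isCompact h.nonempty hzr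
      fun x hx ε hε => h.frequently_coverNumber_inter_ball hr2 hx hε
    have hle : (z : ENNReal) ≤ packingDim F :=
      le_iSup₂ (f := fun (t : NNReal) (_ : packingMeasure t F = ⊤) => (t : ENNReal)) z htop
    rw [← EReal.coe_nnreal_eq_coe_real]
    exact EReal.coe_ennreal_le_coe_ennreal_iff.2 hle

end BoxLikeSystem

end BoxLike

end

theorem theorem2p3 {ι : Type*} [Fintype ι] (hι : 2 ≤ Fintype.card ι)
    (S : ι → BoxLike.Plane →ᵃ[ℝ] BoxLike.Plane) (hS : ∀ i, BoxLike.IsBoxLikeMap (S i))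
    (F : Set BoxLike.Plane) (hF : BoxLike.IsAttractor S F) :
    BoxLike.HasBoxDim (BoxLike.π₁ '' F) (BoxLike.boxDim (BoxLike.π₁ '' F)) ∧
    BoxLike.HasBoxDim (BoxLike.π₂ '' F) (BoxLike.boxDim (BoxLike.π₂ '' F)) ∧
    ∃ P : ℝ → ℝ,
      (∀ t : ℝ, 0 ≤ t →
        Tendsto (fun k : ℕ => BoxLike.Psi S F k t ^ (1 / (k : ℝ))) atTop (𝓝 (P t))) ∧
      ∃ s : ℝ, (0 ≤ s ∧ P s = 1 ∧ ∀ t : ℝ, 0 ≤ t → P t = 1 → t = s) ∧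
        ((BoxLike.packingDim F : ENNReal) : EReal) = BoxLike.upperBoxDim F ∧
        BoxLike.upperBoxDim F ≤ (s : EReal) ∧
        (BoxLike.ROSC S →
          ((BoxLike.packingDim F : ENNReal) : EReal) = (s : EReal) ∧
          BoxLike.HasBoxDim F s) := by
  obtain ⟨m, M, h⟩ := BoxLike.exists_boxLikeSystem hS hF
  obtain ⟨p, hp, hanti, s, hs0, hs⟩ := h.exists_pressure hι
  have hup := h.upperBoxDim_le_of_pressure hp hanti hs
  refine ⟨h.hasBoxDim_proj 0, h.hasBoxDim_proj 1, fun t => Real.exp (p t),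
    fun t _ => h.tendsto_Psi_rpow (hp t), s, ⟨hs0.le, by simp [hs], fun t _ ht => ?_⟩,
    h.packingDim_eq_upperBoxDim, hup, fun hR => ?_⟩
  · exact hanti.injective (((Real.exp_eq_one_iff _).1 ht).trans hs.symm)
  · have hlow := h.le_lowerBoxDim_of_pressure hR hp hanti hs
    have hlu := BoxLike.lowerBoxDim_le_upperBoxDim (A := F)
    have heq : BoxLike.upperBoxDim F = s := le_antisymm hup (hlow.trans hlu)
    exact ⟨h.packingDim_eq_upperBoxDim.trans heq, le_antisymm (hlu.trans hup) hlow, heq⟩
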